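/- Let $\Omega^*=\Omega^*([0,1])=\Omega^0\oplus\Omega^1$ be either the commutative dg algebra $\Bbbk[t]\oplus\Bbbk[t]\,dt$ of polynomial forms over a field $\Bbbk$ of characteristic zero, or the commutative dg algebra of smooth real differential forms on $[0,1]$ (then $\Bbbk=\mathbb R$), and let $C^*=\{at+b(1-t)+c\,dt\}\subset\Omega^*$ be the subcomplex of Whitney forms. Let $\mathbf s$ be the suspension, $(\mathbf sV)^i=V^{i+1}$. $A_\infty$ algebras and $A_\infty$ morphisms are given by Taylor coefficients $Q_n:(\mathbf sV)^{\otimes n}\to\mathbf sV$ and $F_n:(\mathbf sV)^{\otimes n}\to\mathbf sW$, $n\ge1$, i.e. by codifferentials and dg coalgebra morphisms of reduced tensor coalgebras; they are $C_\infty$ if in addition the Taylor coefficients vanish on shuffles (for a morphism: between $C_\infty$ algebras). A dg algebra is an $A_\infty$ algebra via $Q_1(\mathbf sa)=-\mathbf s\,da$, $Q_2(\mathbf sa\otimes\mathbf sb)=(-1)^{|a|}\mathbf s(ab)$, $Q_n=0$ for $n\ge3$. Dupont's contraction consists of the inclusion $\iota:C^*\to\Omega^*$ and of $$\pi(f)=f(1)t+f(0)(1-t),\qquad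 \pi(a\,dt)=\Big(\int_0^1a\Big)dt,\qquad h(f)=0,\qquad h(a\,dt)=t\int_0^1a-\int_0^ta .$$ Let $C^*_\cup$ be $C^*$ with the cup product, the dg algebra structure with unit $1$ and $t\cup t=t$, $t\cup dt=0$, $dt\cup t=dt$. Let $C^*_\infty$ be $C^*$ with the $C_\infty$ structure with Taylor coefficients $m_n$, where $m_1(\mathbf sx)=-\mathbf s\,dx$, the $m_n$ are unital with respect to $1$, $m_2(\mathbf st\otimes\mathbf st)=\mathbf st$, $m_2(\mathbf st\otimes\mathbf sdt)=\frac12\mathbf sdt=-m_2(\mathbf sdt\otimes\mathbf st)$, $m_2(\mathbf sdt\otimes\mathbf sdt)=0$, and for $n\ge2$ the map $m_{n+1}$ vanishes unless precisely one argument is a function, with $$m_{n+1}\big((\mathbf sdt)^{\otimes i}\otimes\mathbf st\otimes(\mathbf sdt)^{\otimes n-i}\big)=(-1)^{i+1}\binom ni\frac{B_n}{n!}\,\mathbf sdt ,$$ $B_n$ being the Bernoulli numbers with $B_1=-\frac12$. Let $\lambda:\Omega^*\to C^*_\cup$ be Gugenheim's morphism: $\lambda_1=\pi$, for $n\ge2$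 the map $\lambda_n$ vanishes if some argument is a zero-form, and $$\lambda_n(\mathbf sa_1dt\otimes\cdots\otimes\mathbf sa_ndt)=\Big(\int_{0\le t_1\le\cdots\le t_n\le1}a_1(t_1)\cdots a_n(t_n)\,dt_1\cdots dt_n\Big)\mathbf sdt$$ (an iterated integral, formal in the polynomial case). Let $\mu:C^*_\infty\to\Omega^*$ be the unital morphism with $\mu_1=\iota$ such that for $n\ge1$ the map $\mu_{n+1}$ vanishes unless precisely one argument is a function, with $$\mu_{n+1}\big((\mathbf sdt)^{\otimes i}\otimes\mathbf st\otimes(\mathbf sdt)^{\otimes n-i}\big)=\mathbf s\Big((-1)^i\binom ni\frac{B_{n+1}(t)-B_{n+1}}{(n+1)!}\Big),$$ $B_n(t)$ being the Bernoulli polynomials. Put $\exp=\lambda\circ\mu:C^*_\infty\to C^*_\cup$, which is invertible, $\log=\exp^{-1}$ and $\varphi=\log\circ\lambda:\Omega^*\to C^*_\infty$. Let $\pi_\infty=(\pi_n)_{n\ge1}$ be the family obtained from homological perturbation theory along Dupont's contraction: $\pi_1=\pi$ and, for $n\ge2$, $\pi_n=\pi_{n-1}\,Q^{n-1}_n\,H^n_n$,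 where $$H^n_n=\sum_{i=0}^{n-1}\mathrm{id}^{\otimes i}\otimes(-h)\otimes(\iota\pi)^{\otimes n-i-1},\qquad Q^{n-1}_n=\sum_{i=0}^{n-2}\mathrm{id}^{\otimes i}\otimes Q_2\otimes\mathrm{id}^{\otimes n-i-2}$$ (with Koszul signs), $Q_2$ being the quadratic coefficient of the $A_\infty$ structure of the dg algebra $\Omega^*$. Then $\pi_\infty$ is an $A_\infty$ morphism $\Omega^*\to C^*_\infty$, $\varphi$ is a $C_\infty$ morphism $\Omega^*\to C^*_\infty$, and they coincide: $\pi_n=\varphi_n$ for all $n\ge1$. -/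

import Mathlib

/-! ## Words, blocks and Taylor coefficients

A graded vector space concentrated in degrees `0` and `1` is written as a product `V₀ × V₁`, and the
same type is used for its suspension, where `V₀` sits in degree `-1` and `V₁` in degree `0`.

A linear map from the reduced tensor coalgebra on `V` to `W` is recorded by its values on words
`[x₁, …, xₙ]`, that is on pure tensors `x₁ ⊗ ⋯ ⊗ xₙ`; the predicate `IsMultilinear` says that the values
are linear in every letter.  Thus a family `F : List V → W` is a sequence of maps
`Fₙ : V^{⊗ n} → W`, `n ≥ 1` (normalized by `F [] = 0`), and such a sequence is the same thing as a
coderivation (when `W = V`), or as a morphism of graded coalgebras, with Taylor coefficients `Fₙ`. -/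

namespace AInf

/-- All ways to cut a word into consecutive non-empty blocks. -/
def splits {V : Type*} : List V → List (List (List V))
  | [] => [[]]
  | x :: w => (splits w).flatMap fun us =>
      match us with
      | [] => [[[x]]]
      | u :: us' => [[x] :: u :: us', (x :: u) :: us']

/-- All ways to write a word as `u ++ v ++ z` (as triples `(u, v, z)`) with `v` of length `m`. -/
def windows {V : Type*} (m : ℕ) (w : List V) : List (List V × List V × List V) :=
  (List.range (w.length + 1 - m)).map fun i => (w.take i, (w.drop i).take m, w.drop (i + m))

section Families

variable {k : Type*} [Field k]
variable {U V W : Type*} [AddCommGroup U] [Module k U] [AddCommGroup V] [Module k V]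
  [AddCommGroup W] [Module k W]

/-- `F` is linear in every letter, and has no component of arity zero. -/
def IsMultilinear (k : Type*) [Field k] {V W : Type*} [AddCommGroup V] [Module k V]
    [AddCommGroup W] [Module k W] (F : List V → W) : Prop :=
  F [] = 0 ∧ ∀ (u v : List V) (x y : V) (c : k),
    F (u ++ (x + c • y) :: v) = F (u ++ x :: v) + c • F (u ++ y :: v)

/-- Taylor coefficients of the composition of two morphisms of tensor coalgebras:
`(F ∘ G)ₙ = ∑_{i₁ + ⋯ + i_r = n} F_r (G_{i₁} ⊗ ⋯ ⊗ G_{i_r})`. -/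
def comp (F : List V → W) (G : List U → V) (w : List U) : W :=
  ((splits w).map fun us => F (us.map G)).sum

/-- Taylor coefficients of the identity morphism. -/
def idFamily : List V → V
  | [x] => x
  | _ => 0

/-- Auxiliary recursion for `compInv`, correct on words of length at most the first argument. -/
def compInvAux (F : List V → V) : ℕ → List V → V
  | 0, _ => 0
  | N + 1, w => idFamily w -
      (((splits w).filter fun us => 2 ≤ us.length).map fun us => F (us.map (compInvAux F N))).sum

/-- The compositional inverse `G` of a family `F` with linear part `F₁ = id`, given by
`G₁ = id` and `Gₙ = - ∑_{r ≥ 2} F_r (G_{i₁} ⊗ ⋯ ⊗ G_{i_r})` for `n ≥ 2`. -/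
def compInv (F : List V → V) (w : List V) : V := compInvAux F w.length w

end Families

/-! ## `A_∞` and `C_∞` structures on spaces concentrated in degrees `0` and `1` -/

section Structures

variable {k : Type*} [Field k]
variable {V₀ V₁ W₀ W₁ : Type*} [AddCommGroup V₀] [Module k V₀] [AddCommGroup V₁] [Module k V₁]
  [AddCommGroup W₀] [Module k W₀] [AddCommGroup W₁] [Module k W₁]

/-- `x` is homogeneous of degree `d` in the suspension of `V₀ ⊕ V₁`. -/
def IsHomog (d : ℤ) (x : V₀ × V₁) : Prop := (d ≠ -1 → x.1 = 0) ∧ (d ≠ 0 → x.2 = 0)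

/-- The Koszul sign operator `x ↦ (-1)^{deg x} x` on the suspension of `V₀ ⊕ V₁`. -/
def sgn (x : V₀ × V₁) : V₀ × V₁ := (-x.1, x.2)

/-- The family `F` is homogeneous of degree `e`. -/
def HasDegree (e : ℤ) (F : List (V₀ × V₁) → W₀ × W₁) : Prop :=
  ∀ (ds : List ℤ) (w : List (V₀ × V₁)), List.Forall₂ IsHomog ds w → IsHomog (ds.sum + e) (F w)

/-- `∑_{i, j} F_{n-j+1} (id^{⊗ i} ⊗ Q_j ⊗ id^{⊗ n-i-j})`: the corestriction of `F` composed with the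
degree one coderivation with Taylor coefficients `Q`, including the Koszul signs. -/
def compCoder (F : List (V₀ × V₁) → W₀ × W₁) (Q : List (V₀ × V₁) → V₀ × V₁)
    (w : List (V₀ × V₁)) : W₀ × W₁ :=
  ∑ j ∈ Finset.Icc 1 w.length,
    ((windows j w).map fun p => F (p.1.map sgn ++ Q p.2.1 :: p.2.2)).sum

/-- `Q` is the family of Taylor coefficients of a codifferential on the reduced tensor coalgebra of
the suspension of `V₀ ⊕ V₁`, that is, of an `A_∞` algebra structure on `V₀ ⊕ V₁`. -/
structure IsAInfAlgebra (k : Type*) [Field k] {V₀ V₁ : Type*} [AddCommGroup V₀] [Module k V₀]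
    [AddCommGroup V₁] [Module k V₁] (Q : List (V₀ × V₁) → V₀ × V₁) : Prop where
  multilinear : IsMultilinear k Q
  degree : HasDegree 1 Q
  codifferential : ∀ w, compCoder Q Q w = 0

/-- `F` is the family of Taylor coefficients of an `A_∞` morphism from `(V, Q)` to `(W, R)`. -/
structure IsAInfMorphism (k : Type*) [Field k] {V₀ V₁ W₀ W₁ : Type*} [AddCommGroup V₀] [Module k V₀]
    [AddCommGroup V₁] [Module k V₁] [AddCommGroup W₀] [Module k W₀] [AddCommGroup W₁] [Module k W₁]
    (Q : List (V₀ × V₁) → V₀ × V₁) (R : List (W₀ × W₁) → W₀ × W₁)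
    (F : List (V₀ × V₁) → W₀ × W₁) : Prop where
  multilinear : IsMultilinear k F
  degree : HasDegree 0 F
  commutes : ∀ w, comp R F w = compCoder F Q w

/-- The shuffle product of two words whose letters carry degrees, as a list of words with
Koszul signs. -/
def shuffle {V : Type*} : List (ℤ × V) → List (ℤ × V) → List (ℤˣ × List (ℤ × V))
  | [], v => [(1, v)]
  | x :: u, [] => [(1, x :: u)]
  | x :: u, y :: v =>
      ((shuffle u (y :: v)).map fun p => (p.1, x :: p.2)) ++
      ((shuffle (x :: u) v).map fun p =>
        (Int.negOnePow (y.1 * ((x :: u).map Prod.fst).sum) * p.1, y :: p.2))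
  termination_by u v => u.length + v.length

/-- The family `F` vanishes on the image of the shuffle product. -/
def VanishesOnShuffles (F : List (V₀ × V₁) → W₀ × W₁) : Prop :=
  ∀ u v : List (ℤ × (V₀ × V₁)), u ≠ [] → v ≠ [] →
    (∀ x ∈ u, IsHomog x.1 x.2) → (∀ x ∈ v, IsHomog x.1 x.2) →
    ((shuffle u v).map fun p => (p.1 : ℤ) • F (p.2.map Prod.snd)).sum = 0

/-- A `C_∞` algebra: an `A_∞` algebra whose Taylor coefficients vanish on shuffles. -/
def IsCInfAlgebra (k : Type*) [Field k] {V₀ V₁ : Type*} [AddCommGroup V₀] [Module k V₀]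
    [AddCommGroup V₁] [Module k V₁] (Q : List (V₀ × V₁) → V₀ × V₁) : Prop :=
  IsAInfAlgebra k Q ∧ VanishesOnShuffles Q

/-- A `C_∞` morphism: an `A_∞` morphism between `C_∞` algebras whose Taylor coefficients vanish on
shuffles. -/
def IsCInfMorphism (k : Type*) [Field k] {V₀ V₁ W₀ W₁ : Type*} [AddCommGroup V₀] [Module k V₀]
    [AddCommGroup V₁] [Module k V₁] [AddCommGroup W₀] [Module k W₀] [AddCommGroup W₁] [Module k W₁]
    (Q : List (V₀ × V₁) → V₀ × V₁) (R : List (W₀ × W₁) → W₀ × W₁)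
    (F : List (V₀ × V₁) → W₀ × W₁) : Prop :=
  IsCInfAlgebra k Q ∧ IsCInfAlgebra k R ∧ IsAInfMorphism k Q R F ∧ VanishesOnShuffles F

/-- The `A_∞` structure of a dg algebra: `Q₁ (s a) = - s (d a)`,
`Q₂ (s a ⊗ s b) = (-1)^{|a|} s (a b)`, and `Qₙ = 0` for `n ≥ 3`. -/
def ofDGAlgebra (d : V₀ × V₁ → V₀ × V₁) (mul : V₀ × V₁ → V₀ × V₁ → V₀ × V₁) :
    List (V₀ × V₁) → V₀ × V₁
  | [x] => -d x
  | [x, y] => mul (x.1, -x.2) y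
  | _ => 0

/-- The words occurring in `H^n_n w`, where
`H^n_n = ∑_{i=0}^{n-1} id^{⊗ i} ⊗ K ⊗ (ι π)^{⊗ n-i-1}` and `K` has degree `-1`. -/
def homotopyTerms (ι : W₀ × W₁ → V₀ × V₁) (π : V₀ × V₁ → W₀ × W₁) (K : V₀ × V₁ → V₀ × V₁)
    (w : List (V₀ × V₁)) : List (List (V₀ × V₁)) :=
  (windows 1 w).map fun p => p.1.map sgn ++ (p.2.1.map K ++ p.2.2.map fun x => ι (π x))

/-- The words occurring in `Q^{n-1}_n w`, where
`Q^{n-1}_n = ∑_{i=0}^{n-2} id^{⊗ i} ⊗ Q₂ ⊗ id^{⊗ n-i-2}`. -/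
def quadraticTerms (Q : List (V₀ × V₁) → V₀ × V₁) (w : List (V₀ × V₁)) : List (List (V₀ × V₁)) :=
  (windows 2 w).map fun p => p.1.map sgn ++ Q p.2.1 :: p.2.2

/-- The maps `π₁ = π` and `πₙ = πₙ₋₁ ∘ Q^{n-1}_n ∘ H^n_n` for `n ≥ 2`, with `H^n_n` built from
`K = - h`. -/
def transferAux (Q : List (V₀ × V₁) → V₀ × V₁) (ι : W₀ × W₁ → V₀ × V₁) (π : V₀ × V₁ → W₀ × W₁)
    (h : V₀ × V₁ → V₀ × V₁) : ℕ → List (V₀ × V₁) → W₀ × W₁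
  | 0, _ => 0
  | 1, w => (w.map π).sum
  | n + 2, w => ((homotopyTerms ι π (fun x => -h x) w).map fun w' =>
      ((quadraticTerms Q w').map fun w'' => transferAux Q ι π h (n + 1) w'').sum).sum

/-- The family `π_∞ = (πₙ)ₙ` produced by homological perturbation theory, for a dg algebra with
`A_∞` structure `Q` (so `Qₙ = 0` for `n ≥ 3`) and contraction data `ι, π, h`. -/
def transfer (Q : List (V₀ × V₁) → V₀ × V₁) (ι : W₀ × W₁ → V₀ × V₁) (π : V₀ × V₁ → W₀ × W₁)
    (h : V₀ × V₁ → V₀ × V₁) (w : List (V₀ × V₁)) : W₀ × W₁ :=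
  transferAux Q ι π h w.length w

end Structures

/-! ## Functions on the interval: polynomial and smooth -/

/-- The operations of calculus on an algebra `A` of functions on `[0,1]`: the coordinate function,
the derivative, the primitive `f ↦ (t ↦ ∫₀ᵗ f)`, and the evaluations at `0` and `1`. -/
structure Calculus (k A : Type*) [Field k] [CommRing A] [Algebra k A] where
  t : A
  D : A →ₗ[k] A
  prim : A →ₗ[k] A
  ev0 : A →ₐ[k] k
  ev1 : A →ₐ[k] k
  leibniz : ∀ f g, D (f * g) = f * D g + g * D f
  D_t : D t = 1
  ev0_t : ev0 t = 0
  ev1_t : ev1 t = 1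
  D_prim : ∀ f, D (prim f) = f
  prim_D : ∀ f, prim (D f) = f - algebraMap k A (ev0 f)

open Polynomial in
/-- Polynomial functions `𝕜[t]`. -/
noncomputable def polyCalculus (k : Type*) [Field k] [CharZero k] : Calculus k k[X] where
  t := X
  D := derivative
  prim := lsum fun n => (monomial (n + 1)).comp (LinearMap.lsmul k k ((n + 1 : k)⁻¹))
  ev0 := aeval 0
  ev1 := aeval 1
  leibniz f g := by rw [derivative_mul]; ring
  D_t := derivative_X
  ev0_t := by simp
  ev1_t := by simp
  D_prim f := by
    induction f using Polynomial.induction_on' with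
    | add p q hp hq => simp only [map_add, hp, hq]
    | monomial n a =>
      have : (n + 1 : k) ≠ 0 := by exact_mod_cast n.succ_ne_zero
      simp [lsum_apply, sum_monomial_index]
      congr 1
      field_simp
  prim_D f := by
    induction f using Polynomial.induction_on' with
    | add p q hp hq => simp only [map_add, hp, hq]; ring
    | monomial n a =>
      rcases n with _ | n
      · simp
      · have : (n + 1 : k) ≠ 0 := by exact_mod_cast n.succ_ne_zero
        simp [lsum_apply, sum_monomial_index]
        congr 1
        field_simp

open Set in
open scoped ContDiff in
/-- Smooth real functions on the closed interval `[0,1]`. -/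
noncomputable def SmoothFun : Subalgebra ℝ (Icc (0 : ℝ) 1 → ℝ) where
  carrier := {f | ContDiffOn ℝ ∞ (IccExtend zero_le_one f) (Icc 0 1)}
  mul_mem' hf hg := ContDiffOn.mul hf hg
  add_mem' hf hg := ContDiffOn.add hf hg
  algebraMap_mem' c := contDiffOn_const (c := c)

section Smooth

open Set
open scoped ContDiff

theorem SmoothFun.contDiffOn (f : SmoothFun) :
    ContDiffOn ℝ ∞ (IccExtend zero_le_one f.1) (Icc 0 1) := f.2

theorem SmoothFun.continuous (f : SmoothFun) : Continuous (IccExtend zero_le_one f.1) := by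
  have h := (SmoothFun.contDiffOn f).continuousOn.domRestrict
  have : (Icc (0 : ℝ) 1).domRestrict (IccExtend zero_le_one f.1) = f.1 := by
    ext x; exact IccExtend_val _ _ x
  rw [this] at h
  exact h.Icc_extend'

/-- The derivative, one-sided at the endpoints. -/
noncomputable def SmoothFun.D (f : SmoothFun) : SmoothFun :=
  ⟨fun x => derivWithin (IccExtend zero_le_one f.1) (Icc 0 1) x, by
    refine ContDiffOn.congr ((SmoothFun.contDiffOn f).derivWithin (m := ∞) (uniqueDiffOn_Icc zero_lt_one)
      (by simp)) fun x hx => ?_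
    rw [IccExtend_of_mem _ _ hx]⟩

theorem SmoothFun.hasDerivWithinAt_integral (f : SmoothFun) (x : ℝ) :
    HasDerivWithinAt (fun y => ∫ s in (0 : ℝ)..y, IccExtend zero_le_one f.1 s)
      (IccExtend zero_le_one f.1 x) (Icc 0 1) x :=
  (intervalIntegral.integral_hasDerivAt_right ((SmoothFun.continuous f).intervalIntegrable _ _)
    ((SmoothFun.continuous f).stronglyMeasurableAtFilter _ _)
    (SmoothFun.continuous f).continuousAt).hasDerivWithinAt

/-- The primitive vanishing at `0`. -/
noncomputable def SmoothFun.prim (f : SmoothFun) : SmoothFun :=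
  ⟨fun x => ∫ s in (0 : ℝ)..x, IccExtend zero_le_one f.1 s, by
    have hu : UniqueDiffOn ℝ (Icc (0 : ℝ) 1) := uniqueDiffOn_Icc zero_lt_one
    have key : ContDiffOn ℝ ∞ (fun y : ℝ => ∫ s in (0 : ℝ)..y, IccExtend zero_le_one f.1 s)
        (Icc 0 1) := by
      rw [contDiffOn_infty_iff_derivWithin hu]
      refine ⟨fun x _ => ((SmoothFun.hasDerivWithinAt_integral f x)).differentiableWithinAt,
        (SmoothFun.contDiffOn f).congr fun x hx => ((SmoothFun.hasDerivWithinAt_integral f x)).derivWithin (hu x hx)⟩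
    refine ContDiffOn.congr key fun x hx => ?_
    rw [IccExtend_of_mem _ _ hx]⟩

theorem SmoothFun.differentiableWithinAt (f : SmoothFun) (x : Icc (0 : ℝ) 1) :
    DifferentiableWithinAt ℝ (IccExtend zero_le_one f.1) (Icc 0 1) x :=
  (SmoothFun.contDiffOn f).differentiableOn (by simp) x x.2

/-- Smooth functions on `[0,1]` with the usual derivative and integral. -/
noncomputable def smoothCalculus : Calculus ℝ SmoothFun where
  t := ⟨fun x => x, contDiffOn_id.congr fun x hx => by rw [IccExtend_of_mem _ _ hx]; rfl⟩
  D :=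
    { toFun := SmoothFun.D
      map_add' := fun f g => by
        ext x
        exact derivWithin_add ((SmoothFun.differentiableWithinAt f x)) ((SmoothFun.differentiableWithinAt g x))
      map_smul' := fun c f => by
        ext x
        exact derivWithin_const_smul c ((SmoothFun.differentiableWithinAt f x)) }
  prim :=
    { toFun := SmoothFun.prim
      map_add' := fun f g => by
        ext x
        exact intervalIntegral.integral_add ((SmoothFun.continuous f).intervalIntegrable _ _)
          ((SmoothFun.continuous g).intervalIntegrable _ _)
      map_smul' := fun c f => by
        ext x
        exact intervalIntegral.integral_smul c _ }
  ev0 := (Pi.evalAlgHom ℝ (fun _ : Icc (0 : ℝ) 1 => ℝ) ⟨0, by simp⟩).comp SmoothFun.val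
  ev1 := (Pi.evalAlgHom ℝ (fun _ : Icc (0 : ℝ) 1 => ℝ) ⟨1, by simp⟩).comp SmoothFun.val
  leibniz f g := by
    ext x
    have := derivWithin_mul ((SmoothFun.differentiableWithinAt f x)) ((SmoothFun.differentiableWithinAt g x))
    refine Eq.trans this ?_
    simp only [IccExtend_val]
    change _ = f.1 x * derivWithin _ _ _ + g.1 x * derivWithin _ _ _
    ring
  D_t := by
    ext x
    change derivWithin _ _ _ = 1
    rw [derivWithin_congr (f := fun y => y) (fun y hy => by rw [IccExtend_of_mem _ _ hy])
      (by rw [IccExtend_val])]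
    exact derivWithin_id _ _ (uniqueDiffOn_Icc zero_lt_one x x.2)
  ev0_t := rfl
  ev1_t := rfl
  D_prim f := by
    ext x
    change derivWithin _ _ _ = f.1 x
    rw [derivWithin_congr (f := fun y => ∫ s in (0 : ℝ)..y, IccExtend zero_le_one f.1 s)
      (fun y hy => by rw [IccExtend_of_mem _ _ hy]; rfl) (by rw [IccExtend_val]; rfl),
      ((SmoothFun.hasDerivWithinAt_integral f x)).derivWithin (uniqueDiffOn_Icc zero_lt_one x x.2),
      IccExtend_val]
  prim_D f := by
    ext x
    change (∫ s in (0 : ℝ)..x, IccExtend zero_le_one (SmoothFun.D f).1 s) = f.1 x - f.1 ⟨0, by simp⟩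
    rw [intervalIntegral.integral_eq_sub_of_hasDerivAt_of_le
      (f := IccExtend zero_le_one f.1) x.2.1 (SmoothFun.continuous f).continuousOn ?_
      ((SmoothFun.continuous (SmoothFun.D f)).intervalIntegrable _ _)]
    · rw [IccExtend_val, IccExtend_of_mem _ _ (by simp : (0 : ℝ) ∈ Icc (0 : ℝ) 1)]
    · intro y hy
      have hy' : y ∈ Icc (0 : ℝ) 1 := ⟨hy.1.le, hy.2.le.trans x.2.2⟩
      rw [IccExtend_of_mem _ _ hy']
      exact ((SmoothFun.differentiableWithinAt f) ⟨y, hy'⟩).hasDerivWithinAt.hasDerivAt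
        (Icc_mem_nhds hy.1 (hy.2.trans_le x.2.2))

end Smooth

/-! ## Differential forms, Whitney forms, and the morphisms between them -/

section Forms

variable {k A : Type*} [Field k] [CharZero k] [CommRing A] [Algebra k A] (c : Calculus k A)

/-- Differential forms: `(f, a)` stands for `f + a dt`. -/
abbrev Forms (A : Type*) : Type _ := A × A

/-- Whitney forms: `((a, b), r)` stands for `a t + b (1 - t) + r dt`. -/
abbrev Whitney (k : Type*) : Type _ := (k × k) × k

/-- The `A_∞` structure of the dg algebra of forms, with de Rham differential and wedge product. -/
def formsStr : List (Forms A) → Forms A :=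
  ofDGAlgebra (fun x => (0, c.D x.1)) (fun x y => (x.1 * y.1, x.1 * y.2 + x.2 * y.1))

/-- The `A_∞` structure of the dg algebra of Whitney forms with the cup product: `1` is a unit,
`t ∪ t = t`, `t ∪ dt = 0`, `dt ∪ t = dt`, `dt ∪ dt = 0`. -/
def cupStr (k : Type*) [Field k] : List (Whitney k) → Whitney k :=
  ofDGAlgebra (fun x => ((0, 0), x.1.1 - x.1.2))
    (fun x y => ((x.1.1 * y.1.1, x.1.2 * y.1.2), x.1.2 * y.2 + x.2 * y.1.1))

/-- `∑ᵢ coeff i · τ(xᵢ) ∏_{j ≠ i} rⱼ`, where `rⱼ` is the coefficient of `dt` in `xⱼ` and `τ(xᵢ)` is the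
coefficient of `t` of the function part of `xᵢ` in the basis `1, t`.  It is the multilinear map that
vanishes unless precisely one letter is a function, vanishes if this function is `1`, and takes the
value `coeff i` on `dt^{⊗ i} ⊗ t ⊗ dt^{⊗ n-i}`. -/
def oneFunction (coeff : ℕ → k) (w : List (Whitney k)) : k :=
  ∑ i : Fin w.length, coeff i * ((w[i].1.1 - w[i].1.2) * ∏ j ∈ Finset.univ.erase i, w[j].2)

/-- The `C_∞` structure on Whitney forms: the maps `m₁ = - d`, `m₂` unital with
`m₂ (t, t) = t`, `m₂ (t, dt) = dt / 2`, `m₂ (dt, t) = - dt / 2`, and for `n ≥ 2`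
`mₙ₊₁ (dt^{⊗ i} ⊗ t ⊗ dt^{⊗ n-i}) = (-1)^{i+1} (n choose i) (Bₙ / n!) dt`. -/
noncomputable def whitneyStr (k : Type*) [Field k] [CharZero k] : List (Whitney k) → Whitney k
  | [] => 0
  | [x] => ((0, 0), -(x.1.1 - x.1.2))
  | [x, y] => ((x.1.1 * y.1.1, x.1.2 * y.1.2),
      (x.1.1 + x.1.2) / 2 * y.2 - x.2 * ((y.1.1 + y.1.2) / 2))
  | w => ((0, 0), oneFunction (fun i => (-1) ^ (i + 1) * ((w.length - 1).choose i : k) *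
      (((bernoulli (w.length - 1) : ℚ) : k) / ((w.length - 1).factorial : k))) w)

/-- Inclusion of Whitney forms into forms. -/
def incl (x : Whitney k) : Forms A :=
  (x.1.1 • c.t + x.1.2 • (1 - c.t), algebraMap k A x.2)

/-- `f ↦ f(1) t + f(0) (1 - t)`, `a dt ↦ (∫₀¹ a) dt`. -/
def proj (x : Forms A) : Whitney k :=
  ((c.ev1 x.1, c.ev0 x.1), c.ev1 (c.prim x.2))

/-- Dupont's homotopy `a dt ↦ t ∫₀¹ a - ∫₀ᵗ a`. -/
def homotopy (x : Forms A) : Forms A :=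
  (c.ev1 (c.prim x.2) • c.t - c.prim x.2, 0)

/-- The iterated integral `∫_{0 ≤ t₁ ≤ ⋯ ≤ tₙ ≤ s} a₁(t₁) ⋯ aₙ(tₙ) dt₁ ⋯ dtₙ`, as a function of `s`. -/
def iteratedIntegral (as : List A) : A :=
  as.foldl (fun J a => c.prim (J * a)) 1

/-- Gugenheim's morphism `λ` from forms to Whitney forms with the cup product: `λ₁ = π`, and `λₙ` is
the iterated integral of the one-form components for `n ≥ 2`. -/
def gugenheim : List (Forms A) → Whitney k
  | [] => 0
  | [x] => proj c x
  | w => ((0, 0), c.ev1 (iteratedIntegral c (w.map Prod.snd)))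

/-- The morphism `μ` from Whitney forms to forms: `μ₁` is the inclusion, and for `n ≥ 1` the map
`μₙ₊₁` is the unital one with `μₙ₊₁ (dt^{⊗ i} ⊗ t ⊗ dt^{⊗ n-i}) =
(-1)^i (n choose i) (Bₙ₊₁(t) - Bₙ₊₁) / (n+1)!`, where `n + 1` is the length of the word. -/
noncomputable def muMap : List (Whitney k) → Forms A
  | [] => 0
  | [x] => incl c x
  | w => (oneFunction (fun i => (-1) ^ i * ((w.length - 1).choose i : k) /
        (w.length.factorial : k)) w •
      (Polynomial.aeval c.t ((Polynomial.bernoulli w.length).map (algebraMap ℚ k)) -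
        algebraMap k A ((bernoulli w.length : ℚ) : k)), 0)

/-- `exp = λ ∘ μ`. -/
noncomputable def expMap : List (Whitney k) → Whitney k := comp (gugenheim c) (muMap c)

/-- `log = exp⁻¹`. -/
noncomputable def logMap : List (Whitney k) → Whitney k := compInv (expMap c)

/-- `φ = log ∘ λ`. -/
noncomputable def phi : List (Forms A) → Whitney k := comp (logMap c) (gugenheim c)

/-- The morphism `π_∞` obtained from homological perturbation theory along Dupont's contraction. -/
noncomputable def dupontTransfer : List (Forms A) → Whitney k :=
  transfer (formsStr c) (incl c) (proj c) (homotopy c)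

end Forms

end AInf

/-! Everything takes place in the ring of functionals on words under convolution, i.e.
noncommutative power series. For n ≥ 2 the values of μ_n are functions vanishing at 0 and 1, because
B_n(0) = B_n(1), and λ kills every word containing such a function. Hence exp is just λ on words of
Whitney forms; the iterated integral of n copies of dt is the volume 1/n! of a simplex, so exp is
the series e^x - 1 in the dt-component and log is the series log(1 + x). The one-form component of φ
is therefore the convolution logarithm of the holonomy functional, the functional that sends a word
of one-forms to its iterated integral over [0,1] (`phi_eq`).

Logarithms are handled through integer powers. For g without constant term, (1 + g)^m evaluated at a
fixed word is a polynomial in m, and its linear coefficient is log(1 + g). An identity proved for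
all natural numbers m is an identity of polynomials, and the coefficient of m can be read off.
Applied to the multiplicativity of iterated integrals on shuffles, this shows that φ vanishes on
shuffles.

The morphism equation reduces to words with exactly one function f, with one-forms u on its left and
v on its right. Stokes' formula (`Calculus.del_hol`) says that inserting df and merging f with its
neighbours changes the holonomy only by boundary terms in f(0) and f(1). This operation is a
derivation for convolution, so on the m-th power of the holonomy H it produces the sums of H^i(u)
H^(m-i)(v). Writing H = exp(L), these become the sums of i^a (m-i)^b, whose linear coefficient in m
is (-1)^a B_{a+b} (`Conv.faulhaber₂_coeff_one`). Those are the coefficients of the structure on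
Whitney forms (`comp_whitneyStr_phi_snd_middle`).

The A_∞ relations on Whitney forms need no further Bernoulli identity. Since φ restricted to Whitney
forms is the identity morphism (`phi_map_incl`), they are inherited from the dg algebra of forms
(`compCoder_whitneyStr`). Vanishing on shuffles holds because each higher m_{n+1} is a multiple of
an iterated commutator.

Finally φ satisfies the recursion defining the transferred morphism. It kills words containing a
value of h, since such values vanish at both endpoints. The morphism equation on a word with -h(x)
in place of x then exchanges x for ιπ(x), up to quadratic terms. Summing over positions telescopes
(`sum_homotopyTerms`), and induction on the length gives equality. -/

namespace AInf

/-! ## Sums over cuts and over decompositions into blocks -/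

section Cuts

variable {α β M N : Type*} [AddCommMonoid M] [AddCommMonoid N]

/-- The sum of `g a b` over all ways to write a word as `a ++ b`. -/
def cutSum (g : List α → List α → M) : List α → M
  | [] => g [] []
  | x :: w => g [] (x :: w) + cutSum (fun a b => g (x :: a) b) w

@[simp] theorem cutSum_nil (g : List α → List α → M) : cutSum g [] = g [] [] := rfl

theorem cutSum_cons (g : List α → List α → M) (x : α) (w : List α) :
    cutSum g (x :: w) = g [] (x :: w) + cutSum (fun a b => g (x :: a) b) w := rfl

theorem cutSum_congr {g g' : List α → List α → M} {w : List α}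
    (h : ∀ a b, a ++ b = w → g a b = g' a b) : cutSum g w = cutSum g' w := by
  induction w generalizing g g' with
  | nil => exact h _ _ rfl
  | cons x w ih =>
    rw [cutSum_cons, cutSum_cons, h [] _ rfl, ih fun a b e => h _ _ (by simp [e])]

theorem cutSum_zero (w : List α) : cutSum (fun _ _ => (0 : M)) w = 0 := by
  induction w with
  | nil => rfl
  | cons x w ih => rw [cutSum_cons, ih, add_zero]

theorem cutSum_eq_zero {g : List α → List α → M} {w : List α}
    (h : ∀ a b, a ++ b = w → g a b = 0) : cutSum g w = 0 :=
  (cutSum_congr h).trans (cutSum_zero w)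

theorem cutSum_add (g g' : List α → List α → M) (w : List α) :
    cutSum (fun a b => g a b + g' a b) w = cutSum g w + cutSum g' w := by
  induction w generalizing g g' with
  | nil => rfl
  | cons x w ih => simp only [cutSum_cons, ih]; abel

theorem map_cutSum (f : M →+ N) (g : List α → List α → M) (w : List α) :
    f (cutSum g w) = cutSum (fun a b => f (g a b)) w := by
  induction w generalizing g with
  | nil => rfl
  | cons x w ih => simp only [cutSum_cons, map_add, ih]

theorem cutSum_sum {ι : Type*} (s : Finset ι) (g : ι → List α → List α → M) (w : List α) :
    cutSum (fun a b => ∑ i ∈ s, g i a b) w = ∑ i ∈ s, cutSum (g i) w := by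
  induction w generalizing g with
  | nil => rfl
  | cons x w ih => simp only [cutSum_cons, ih, Finset.sum_add_distrib]

theorem cutSum_mul_left {R : Type*} [Semiring R] (r : R) (g : List α → List α → R) (w : List α) :
    cutSum (fun a b => r * g a b) w = r * cutSum g w :=
  (map_cutSum (AddMonoidHom.mulLeft r) g w).symm

theorem cutSum_mul_right {R : Type*} [Semiring R] (r : R) (g : List α → List α → R) (w : List α) :
    cutSum (fun a b => g a b * r) w = cutSum g w * r :=
  (map_cutSum (AddMonoidHom.mulRight r) g w).symm

theorem cutSum_smul {R : Type*} [Semiring R] [Module R M] (r : R) (g : List α → List α → M)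
    (w : List α) : cutSum (fun a b => r • g a b) w = r • cutSum g w :=
  (map_cutSum (DistribSMul.toAddMonoidHom M r) g w).symm

theorem cutSum_neg {G : Type*} [AddCommGroup G] (g : List α → List α → G) (w : List α) :
    cutSum (fun a b => -g a b) w = -cutSum g w :=
  (map_cutSum (-AddMonoidHom.id G) g w).symm

theorem cutSum_map (f : α → β) (g : List β → List β → M) (w : List α) :
    cutSum g (w.map f) = cutSum (fun a b => g (a.map f) (b.map f)) w := by
  induction w generalizing g with
  | nil => rfl
  | cons x w ih => simp only [List.map_cons, cutSum_cons, ih, List.map_nil]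

theorem cutSum_append_cons (g : List α → List α → M) (u : List α) (x : α) (v : List α) :
    cutSum g (u ++ x :: v) =
      cutSum (fun a b => g a (b ++ x :: v)) u + cutSum (fun a b => g (u ++ x :: a) b) v := by
  induction u generalizing g with
  | nil => rfl
  | cons y u ih => simp only [List.cons_append, cutSum_cons, ih, add_assoc]

/-- Coassociativity of deconcatenation; it gives associativity of convolution and every later
rearrangement of nested cuts. -/
theorem cutSum_assoc (g : List α → List α → List α → M) (w : List α) :
    cutSum (fun a bc => cutSum (fun b c => g a b c) bc) w =
      cutSum (fun ab c => cutSum (fun a b => g a b c) ab) w := by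
  induction w generalizing g with
  | nil => rfl
  | cons x w ih =>
    simp only [cutSum_cons, ih, cutSum_add, cutSum_nil, add_assoc]

theorem cutSum_comm (g : List α → List α → List β → List β → M) (u : List α) (v : List β) :
    cutSum (fun a b => cutSum (fun c d => g a b c d) v) u =
      cutSum (fun c d => cutSum (fun a b => g a b c d) u) v := by
  induction u generalizing g with
  | nil => rfl
  | cons x w ih => simp only [cutSum_cons, ih, cutSum_add]

theorem cutSum_eq_left {g : List α → List α → M} {w : List α}
    (h : ∀ a b, a ++ b = w → b ≠ [] → g a b = 0) : cutSum g w = g w [] := by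
  induction w generalizing g with
  | nil => rfl
  | cons x w ih =>
    rw [cutSum_cons, h [] _ rfl (by simp), zero_add, ih fun a b e hb => h _ _ (by simp [e]) hb]

theorem cutSum_eq_right {g : List α → List α → M} {w : List α}
    (h : ∀ a b, a ++ b = w → a ≠ [] → g a b = 0) : cutSum g w = g [] w := by
  cases w with
  | nil => rfl
  | cons x w =>
    rw [cutSum_cons, cutSum_eq_zero fun a b e => h _ _ (by simp [e]) (by simp), add_zero]

theorem cutSum_eq_sum_range (g : List α → List α → M) (w : List α) :
    cutSum g w = ∑ i ∈ Finset.range (w.length + 1), g (w.take i) (w.drop i) := by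
  induction w generalizing g with
  | nil => simp
  | cons x w ih =>
    rw [cutSum_cons, ih, List.length_cons, Finset.sum_range_succ' _ (w.length + 1), add_comm]
    simp

/-- The sum of `g a b c` over all ways to write a word as `a ++ b ++ c`. -/
def tripleSum (g : List α → List α → List α → M) (w : List α) : M :=
  cutSum (fun a bc => cutSum (fun b c => g a b c) bc) w

theorem tripleSum_congr {g g' : List α → List α → List α → M} {w : List α}
    (h : ∀ a b c, a ++ b ++ c = w → g a b c = g' a b c) : tripleSum g w = tripleSum g' w :=
  cutSum_congr fun _ _ e => cutSum_congr fun _ _ e' => h _ _ _ (by rw [List.append_assoc, e', e])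

theorem tripleSum_eq_zero {g : List α → List α → List α → M} {w : List α}
    (h : ∀ a b c, a ++ b ++ c = w → g a b c = 0) : tripleSum g w = 0 :=
  cutSum_eq_zero fun _ _ e => cutSum_eq_zero fun _ _ e' => h _ _ _ (by rw [List.append_assoc, e', e])

theorem map_tripleSum (f : M →+ N) (g : List α → List α → List α → M) (w : List α) :
    f (tripleSum g w) = tripleSum (fun a b c => f (g a b c)) w := by
  simp only [tripleSum, map_cutSum]

theorem tripleSum_add (g g' : List α → List α → List α → M) (w : List α) :
    tripleSum (fun a b c => g a b c + g' a b c) w = tripleSum g w + tripleSum g' w := by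
  simp only [tripleSum, cutSum_add]

theorem tripleSum_append_cons (g : List α → List α → List α → M) (u : List α) (x : α)
    (v : List α) : tripleSum g (u ++ x :: v) =
      tripleSum (fun a b c => g a b (c ++ x :: v)) u +
      cutSum (fun a b => cutSum (fun c d => g a (b ++ x :: c) d) v) u +
      tripleSum (fun a b c => g (u ++ x :: a) b c) v := by
  simp only [tripleSum, cutSum_append_cons, cutSum_add]

/-- Passes from windows grouped by length, as in `compCoder`, to unrestricted cuts into three
pieces, which are easier to reassociate. The cuts with empty middle are extra, and `hg` makes them
harmless. -/
theorem sum_windows (g : List α → List α → List α → M) (hg : ∀ a c, g a [] c = 0) (w : List α) :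
    ∑ j ∈ Finset.Icc 1 w.length, ((windows j w).map fun p => g p.1 p.2.1 p.2.2).sum =
      tripleSum g w := by
  have h1 : ∀ j, ((windows j w).map fun p => g p.1 p.2.1 p.2.2).sum =
      ∑ i ∈ Finset.range (w.length + 1 - j),
        g (w.take i) ((w.drop i).take j) (w.drop (i + j)) := by
    intro j
    rw [windows, List.map_map, Finset.sum_eq_multiset_sum, Finset.range_val, ← Multiset.coe_range,
      Multiset.map_coe, Multiset.sum_coe]
    rfl
  simp only [h1, tripleSum, cutSum_eq_sum_range]
  have h2 : ∑ j ∈ Finset.Icc 1 w.length, ∑ i ∈ Finset.range (w.length + 1 - j),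
        g (w.take i) ((w.drop i).take j) (w.drop (i + j)) =
      ∑ j ∈ Finset.range (w.length + 1), ∑ i ∈ Finset.range (w.length + 1 - j),
        g (w.take i) ((w.drop i).take j) (w.drop (i + j)) := by
    refine Finset.sum_subset (fun j hj => ?_) fun j hj hj' => ?_
    · simp only [Finset.mem_Icc, Finset.mem_range] at *; omega
    · obtain rfl : j = 0 := by simp only [Finset.mem_Icc, Finset.mem_range] at *; omega
      simp [hg]
  rw [h2, Finset.sum_comm' (t' := Finset.range (w.length + 1))
    (s' := fun i => Finset.range ((w.drop i).length + 1))]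
  · simp only [List.drop_drop]
  · intro i j
    simp only [Finset.mem_range, List.length_drop]
    omega

end Cuts

/-! ### Decompositions of a word into non-empty blocks. -/

section Splits

variable {α β M N : Type*} [AddCommMonoid M] [AddCommMonoid N]

/-- The sum of `h us` over all ways to cut a word into consecutive non-empty blocks. -/
def splitSum (h : List (List α) → M) (w : List α) : M := ((splits w).map h).sum

@[simp] theorem splitSum_nil (h : List (List α) → M) : splitSum h [] = h [] := by
  simp [splitSum, splits]

theorem splitSum_congr {h h' : List (List α) → M} {w : List α}
    (H : ∀ us ∈ splits w, h us = h' us) : splitSum h w = splitSum h' w := by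
  rw [splitSum, splitSum, List.map_congr_left H]

theorem splitSum_eq_zero {h : List (List α) → M} {w : List α}
    (H : ∀ us ∈ splits w, h us = 0) : splitSum h w = 0 := by
  rw [splitSum, List.map_congr_left H]; simp

theorem map_splitSum (f : M →+ N) (h : List (List α) → M) (w : List α) :
    f (splitSum h w) = splitSum (fun us => f (h us)) w := by
  simp [splitSum, map_list_sum, Function.comp_def]

theorem splitSum_add (h h' : List (List α) → M) (w : List α) :
    splitSum (fun us => h us + h' us) w = splitSum h w + splitSum h' w := by
  simp [splitSum, List.sum_map_add]

/-- The contribution of the decompositions whose first block is enlarged by a given function. -/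
def headSum (h : List α → List (List α) → M) (w : List α) : M :=
  ((splits w).map fun us => match us with
    | [] => 0
    | u :: us' => h u us').sum

theorem splitSum_cons_eq_add (h : List (List α) → M) (x : α) (w : List α) :
    splitSum h (x :: w) =
      splitSum (fun us => h ([x] :: us)) w + headSum (fun u us => h ((x :: u) :: us)) w := by
  rw [splitSum, splits, List.map_flatMap, List.flatMap_def, List.sum_flatten, List.map_map, splitSum, headSum, ← List.sum_map_add]
  congr 1
  refine List.map_congr_left fun us _ => ?_
  cases us <;> simp

theorem headSum_cons (h : List α → List (List α) → M) (x : α) (w : List α) :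
    headSum h (x :: w) = splitSum (fun us => h [x] us) w + headSum (fun u us => h (x :: u) us) w := by
  rw [headSum, splits, List.map_flatMap, List.flatMap_def, List.sum_flatten, List.map_map, splitSum, headSum, ← List.sum_map_add]
  congr 1
  refine List.map_congr_left fun us _ => ?_
  cases us <;> simp

theorem headSum_cons_eq_cutSum (h : List α → List (List α) → M) (x : α) (w : List α) :
    headSum h (x :: w) = cutSum (fun a b => splitSum (fun us => h (x :: a) us) b) w := by
  induction w generalizing h x with
  | nil => simp [headSum, splits]
  | cons y w ih => rw [headSum_cons, ih, cutSum_cons]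

/-- Decompositions into blocks, sorted by their first block. -/
theorem splitSum_cons (h : List (List α) → M) (x : α) (w : List α) :
    splitSum h (x :: w) =
      cutSum (fun a b => splitSum (fun us => h ((x :: a) :: us)) b) w := by
  rw [splitSum_cons_eq_add]
  cases w with
  | nil => simp [headSum, splits]
  | cons y w => rw [headSum_cons_eq_cutSum, cutSum_cons]

/-- The induction that fits `splitSum_cons`: removing the first block leaves an arbitrary suffix,
not only the tail. -/
theorem splitSum_induction {P : List α → Prop} (nil : P [])
    (cons : ∀ x w, (∀ a b, a ++ b = w → P b) → P (x :: w)) (w : List α) : P w := by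
  induction hn : w.length using Nat.strong_induction_on generalizing w with
  | _ n ih =>
    cases w with
    | nil => exact nil
    | cons x w =>
      refine cons x w fun a b e => ih b.length ?_ b rfl
      subst hn e
      simp

/-- Decompositions of `u ++ x :: v` into blocks, sorted by the block that contains `x`. -/
theorem splitSum_append_cons (h : List (List α) → M) (u : List α) (x : α) (v : List α) :
    splitSum h (u ++ x :: v) =
      cutSum (fun a b => splitSum (fun A => cutSum (fun c d =>
        splitSum (fun C => h (A ++ (b ++ x :: c) :: C)) d) v) a) u := by
  induction u using splitSum_induction generalizing h with
  | nil => simp [splitSum_cons]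
  | cons y u ih =>
    rw [List.cons_append, splitSum_cons, cutSum_append_cons, cutSum_cons, add_comm]
    congr 1
    · simp
    · rw [cutSum_congr (fun a b e => ih a b e _), cutSum_assoc]
      simp only [splitSum_cons, List.cons_append]

theorem splitSum_map (f : α → β) (h : List (List β) → M) (w : List α) :
    splitSum h (w.map f) = splitSum (fun us => h (us.map (List.map f))) w := by
  induction w using splitSum_induction generalizing h with
  | nil => simp
  | cons x w ih =>
    rw [List.map_cons, splitSum_cons, splitSum_cons, cutSum_map]
    exact cutSum_congr fun a b e => by rw [ih a b e]; rfl

/-- Cutting a list of blocks in two amounts to choosing the block boundary in the word first and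
then decomposing each side. -/
theorem splitSum_cutSum (h : List (List α) → List (List α) → M) (w : List α) :
    splitSum (fun us => cutSum h us) w =
      cutSum (fun a b => splitSum (fun A => splitSum (fun B => h A B) b) a) w := by
  induction w using splitSum_induction generalizing h with
  | nil => simp
  | cons x w ih =>
    simp only [splitSum_cons, cutSum_cons, splitSum_nil, splitSum_add, cutSum_add]
    congr 1
    rw [cutSum_congr (fun a b e => ih a b e _), cutSum_assoc]

theorem mem_splits_cons {x : α} {w : List α} {us : List (List α)} (h : us ∈ splits (x :: w)) :
    (∃ us', us = [x] :: us' ∧ us' ∈ splits w) ∨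
      ∃ u us', us = (x :: u) :: us' ∧ u :: us' ∈ splits w := by
  rw [splits, List.mem_flatMap] at h
  obtain ⟨vs, hvs, h⟩ := h
  cases vs with
  | nil => left; exact ⟨[], by simpa using h, hvs⟩
  | cons v vs =>
    simp only [List.mem_cons, List.not_mem_nil, or_false] at h
    rcases h with rfl | rfl
    · exact Or.inl ⟨_, rfl, hvs⟩
    · exact Or.inr ⟨_, _, rfl, hvs⟩

theorem flatten_of_mem_splits {w : List α} {us : List (List α)} (h : us ∈ splits w) :
    us.flatten = w := by
  induction w generalizing us with
  | nil => simp [splits] at h; simp [h]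
  | cons x w ih =>
    rcases mem_splits_cons h with ⟨us', rfl, h'⟩ | ⟨u, us', rfl, h'⟩
    · simp [ih h']
    · simpa using ih h'

theorem ne_nil_of_mem_splits {w : List α} {us : List (List α)} (h : us ∈ splits w) {u : List α}
    (hu : u ∈ us) : u ≠ [] := by
  induction w generalizing us u with
  | nil => simp [splits] at h; simp [h] at hu
  | cons x w ih =>
    rcases mem_splits_cons h with ⟨us', rfl, h'⟩ | ⟨v, us', rfl, h'⟩
    · rcases List.mem_cons.1 hu with rfl | hu
      · simp
      · exact ih h' hu
    · rcases List.mem_cons.1 hu with rfl | hu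
      · simp
      · exact ih h' (List.mem_cons_of_mem _ hu)

/-- A function of decompositions that vanishes on blocks of length at least two. -/
theorem splitSum_eq_singletons {h : List (List α) → M} {w : List α}
    (H : ∀ us ∈ splits w, ∀ u ∈ us, 2 ≤ u.length → h us = 0) :
    splitSum h w = h (w.map fun x => [x]) := by
  induction w generalizing h with
  | nil => simp
  | cons x w ih =>
    have hs : ∀ us ∈ splits w, [x] :: us ∈ splits (x :: w) := by
      intro us hus
      rw [splits, List.mem_flatMap]
      refine ⟨us, hus, ?_⟩
      cases us <;> simp
    have hs' : ∀ u us, u :: us ∈ splits w → (x :: u) :: us ∈ splits (x :: w) := by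
      intro u us hus
      rw [splits, List.mem_flatMap]
      exact ⟨_, hus, by simp⟩
    rw [splitSum_cons_eq_add, ih fun us hus u hu hl => H _ (hs us hus) u (by simp [hu]) hl]
    have : headSum (fun u us => h ((x :: u) :: us)) w = 0 := by
      refine List.sum_eq_zero fun m hm => ?_
      obtain ⟨us, hus, rfl⟩ := List.mem_map.1 hm
      cases us with
      | nil => rfl
      | cons u us =>
        refine H _ (hs' u us hus) (x :: u) (by simp) ?_
        have := List.length_pos_iff.2 (ne_nil_of_mem_splits hus (List.mem_cons_self))
        simp; omega
    rw [this, add_zero]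
    rfl

/-- A function of decompositions that vanishes if there are at least two blocks. -/
theorem splitSum_eq_single {h : List (List α) → M} {w : List α} (hw : w ≠ [])
    (H : ∀ us, 2 ≤ us.length → h us = 0) : splitSum h w = h [w] := by
  obtain ⟨x, w, rfl⟩ := List.exists_cons_of_ne_nil hw
  rw [splitSum_cons, cutSum_eq_left, splitSum_nil]
  intro a b _ hb
  refine splitSum_eq_zero fun us hus => H _ ?_
  have : us ≠ [] := by
    rintro rfl
    exact hb (flatten_of_mem_splits hus).symm
  have := List.length_pos_iff.2 this
  simp; omega

end Splits

/-! ## The convolution algebra of functionals on words -/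

/-- Functionals on words with the convolution product `(f * g) w = ∑_{w = a ++ b} f a * g b`. -/
@[ext] structure Conv (α R : Type*) where
  /-- The underlying function. -/
  toFun : List α → R

namespace Conv

variable {α β R : Type*} [CommRing R]

instance : CoeFun (Conv α R) fun _ => List α → R := ⟨toFun⟩

theorem ext_apply {f g : Conv α R} (h : ∀ w, f w = g w) : f = g := Conv.ext (funext h)

instance : Zero (Conv α R) := ⟨⟨fun _ => 0⟩⟩
instance : Add (Conv α R) := ⟨fun f g => ⟨fun w => f w + g w⟩⟩
instance : Neg (Conv α R) := ⟨fun f => ⟨fun w => -f w⟩⟩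
instance : Sub (Conv α R) := ⟨fun f g => ⟨fun w => f w - g w⟩⟩
instance : SMul ℕ (Conv α R) := ⟨fun n f => ⟨fun w => n • f w⟩⟩
instance : SMul ℤ (Conv α R) := ⟨fun n f => ⟨fun w => n • f w⟩⟩

instance : AddCommGroup (Conv α R) :=
  Function.Injective.addCommGroup (fun f : Conv α R => (f.toFun : List α → R))
    (fun _ _ h => Conv.ext h) rfl (fun _ _ => rfl) (fun _ => rfl) (fun _ _ => rfl)
    (fun _ _ => rfl) fun _ _ => rfl

instance : Mul (Conv α R) := ⟨fun f g => ⟨fun w => cutSum (fun a b => f a * g b) w⟩⟩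

/-- The functional that is `1` on the empty word. -/
instance : One (Conv α R) := ⟨⟨fun w => if w = [] then 1 else 0⟩⟩

theorem mul_apply (f g : Conv α R) (w : List α) : (f * g) w = cutSum (fun a b => f a * g b) w := rfl

theorem add_apply (f g : Conv α R) (w : List α) : (f + g) w = f w + g w := rfl

theorem sub_apply (f g : Conv α R) (w : List α) : (f - g) w = f w - g w := rfl

theorem nsmul_apply (n : ℕ) (f : Conv α R) (w : List α) : (n • f) w = n • f w := rfl

/-- Evaluation at a word. -/
def evalHom (w : List α) : Conv α R →+ R where
  toFun f := f w
  map_zero' := rfl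
  map_add' _ _ := rfl

theorem sum_apply {ι : Type*} (s : Finset ι) (f : ι → Conv α R) (w : List α) :
    (∑ i ∈ s, f i) w = ∑ i ∈ s, f i w :=
  map_sum (evalHom w) f s

theorem one_apply (w : List α) : (1 : Conv α R) w = if w = [] then 1 else 0 := rfl

@[simp] theorem one_nil : (1 : Conv α R) [] = 1 := by simp [one_apply]

@[simp] theorem one_cons (x : α) (w : List α) : (1 : Conv α R) (x :: w) = 0 := by simp [one_apply]

theorem mul_nil (f g : Conv α R) : (f * g) [] = f [] * g [] := rfl

theorem mul_cons (f g : Conv α R) (x : α) (w : List α) : (f * g) (x :: w) =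
    f [] * g (x :: w) + cutSum (fun a b => f (x :: a) * g b) w := rfl

theorem one_of_ne {w : List α} (h : w ≠ []) : (1 : Conv α R) w = 0 := by simp [one_apply, h]

protected theorem mul_assoc' (f g h : Conv α R) : f * g * h = f * (g * h) := by
  refine ext_apply fun w => ?_
  simp only [mul_apply, ← cutSum_mul_right, ← cutSum_mul_left, mul_assoc]
  exact (cutSum_assoc (fun a b c => f a * (g b * h c)) w).symm

protected theorem one_mul' (f : Conv α R) : 1 * f = f := by
  refine ext_apply fun w => ?_
  rw [mul_apply, cutSum_eq_right (fun a b _ ha => by rw [one_of_ne ha, zero_mul]), one_nil, one_mul]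

protected theorem mul_one' (f : Conv α R) : f * 1 = f := by
  refine ext_apply fun w => ?_
  rw [mul_apply, cutSum_eq_left (fun a b _ hb => by rw [one_of_ne hb, mul_zero]), one_nil, mul_one]

/-- This is the ring of noncommutative formal power series in the letters, each series being
recorded by its coefficients on words. -/
instance : Ring (Conv α R) :=
  { (inferInstance : AddCommGroup (Conv α R)) with
    mul_assoc := Conv.mul_assoc'
    one_mul := Conv.one_mul'
    mul_one := Conv.mul_one'
    left_distrib := fun f g h => by
      refine ext_apply fun w => ?_
      simp only [mul_apply, add_apply, mul_add, cutSum_add]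
    right_distrib := fun f g h => by
      refine ext_apply fun w => ?_
      simp only [mul_apply, add_apply, add_mul, cutSum_add]
    zero_mul := fun f => by
      refine ext_apply fun w => ?_
      exact cutSum_eq_zero fun a b _ => zero_mul _
    mul_zero := fun f => by
      refine ext_apply fun w => ?_
      exact cutSum_eq_zero fun a b _ => mul_zero _ }

/-- Pullback of functionals along a map of alphabets. -/
def pullback (f : α → β) (g : Conv β R) : Conv α R := ⟨fun w => g (w.map f)⟩

omit [CommRing R] in
theorem pullback_apply (f : α → β) (g : Conv β R) (w : List α) :
    pullback f g w = g (w.map f) := rfl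

theorem pullback_pow (f : α → β) (g : Conv β R) (n : ℕ) :
    pullback f g ^ n = pullback f (g ^ n) := by
  induction n with
  | zero => refine ext_apply fun w => ?_; cases w <;> simp [pullback_apply]
  | succ n ih =>
    refine ext_apply fun w => ?_
    rw [pow_succ, pow_succ, ih, pullback_apply, mul_apply, mul_apply, cutSum_map]
    rfl

/-- Each of the n factors must consume at least one letter. This makes every power series in `f` a
finite sum on each word. -/
theorem pow_eq_zero_of_length_lt {f : Conv α R} (hf : f [] = 0) {n : ℕ} {w : List α}
    (h : w.length < n) : (f ^ n) w = 0 := by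
  induction n generalizing w with
  | zero => simp at h
  | succ n ih =>
    rw [pow_succ', mul_apply]
    refine cutSum_eq_zero fun a b e => ?_
    cases a with
    | nil => rw [hf, zero_mul]
    | cons x a => rw [ih (by subst e; simp at h; omega), mul_zero]

/-- Sums over decompositions into blocks in terms of convolution powers. -/
theorem splitSum_prod {g : Conv α R} (hg : g [] = 0) (c : ℕ → R) {N : ℕ} {w : List α}
    (hw : w.length ≤ N) :
    splitSum (fun us => c us.length * (us.map g).prod) w =
      ∑ r ∈ Finset.range (N + 1), c r * (g ^ r) w := by
  induction w using splitSum_induction generalizing c N with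
  | nil =>
    rw [Finset.sum_eq_single 0]
    · rw [splitSum_nil, pow_zero, one_nil]; simp
    · intro r _ hr
      rw [pow_eq_zero_of_length_lt hg (by simp; omega), mul_zero]
    · simp
  | cons x w ih =>
    obtain ⟨N, rfl⟩ : ∃ M, N = M + 1 := ⟨N - 1, by simp at hw; omega⟩
    have hN : w.length ≤ N := by simpa using hw
    -- The first block accounts for one factor of `g`, so the induction hypothesis is used with the
    -- coefficients shifted by one.
    have : ∀ a b, a ++ b = w →
        splitSum (fun us => c ((x :: a) :: us).length * (((x :: a) :: us).map g).prod) b =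
          ∑ r ∈ Finset.range (N + 1), c (r + 1) * (g (x :: a) * (g ^ r) b) := by
      intro a b e
      have hb : b.length ≤ N := by subst e; simp at hN; omega
      have h1 := congrArg (AddMonoidHom.mulLeft (g (x :: a))) (ih a b e (fun r => c (r + 1)) hb)
      rw [map_splitSum, map_sum] at h1
      refine (splitSum_congr fun us _ => ?_).trans
        (Eq.trans h1 (Finset.sum_congr rfl fun r _ => mul_left_comm _ _ _))
      exact mul_left_comm _ _ _
    rw [splitSum_cons, cutSum_congr this, cutSum_sum, Finset.sum_range_succ' _ (N + 1)]
    simp only [cutSum_mul_left, pow_zero, one_cons, mul_zero, add_zero]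
    refine Finset.sum_congr rfl fun r _ => ?_
    rw [pow_succ', mul_cons, hg, zero_mul, zero_add]

end Conv

/-! ## Powers with polynomial exponent and the logarithm -/

section Log

open Polynomial hiding bernoulli

variable {α β k : Type*} [Field k] [CharZero k]

/-- The natural numbers are infinite in characteristic zero. This principle turns identities between
integer powers into identities between logarithms, by comparing linear coefficients in the exponent.
-/
theorem _root_.Polynomial.eq_of_eval_natCast {p q : k[X]} (h : ∀ m : ℕ, p.eval (m : k) = q.eval (m : k)) :
    p = q := by
  refine Polynomial.eq_of_infinite_eval_eq p q (Set.Infinite.mono ?_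
    (Set.infinite_range_of_injective (Nat.cast_injective (R := k))))
  rintro _ ⟨m, rfl⟩
  exact h m

/-- The binomial coefficient `X choose r` as a polynomial. -/
noncomputable def binomPoly (k : Type*) [Field k] (r : ℕ) : k[X] :=
  C ((r.factorial : k)⁻¹) * descPochhammer k r

theorem binomPoly_eval (r m : ℕ) : (binomPoly k r).eval (m : k) = (m.choose r : k) := by
  rw [binomPoly, eval_mul, eval_C, descPochhammer_eval_eq_descFactorial,
    Nat.descFactorial_eq_factorial_mul_choose, Nat.cast_mul, inv_mul_cancel_left₀]
  exact_mod_cast r.factorial_ne_zero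

/-- The coefficients of the power series `log (1 + x)`. -/
noncomputable def logCoeff (k : Type*) [Field k] (r : ℕ) : k := (binomPoly k r).coeff 1

omit [CharZero k] in
theorem logCoeff_zero : logCoeff k 0 = 0 := by simp [logCoeff, binomPoly, coeff_one]

omit [CharZero k] in
theorem logCoeff_one : logCoeff k 1 = 1 := by simp [logCoeff, binomPoly]

namespace Conv

/-- The polynomial in `m` whose values are those of `(1 + g) ^ m`. -/
noncomputable def powPoly (g : Conv α k) (w : List α) : k[X] :=
  ∑ r ∈ Finset.range (w.length + 1), C ((g ^ r) w) * binomPoly k r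

/-- The logarithm of `1 + g`. -/
noncomputable def log (g : Conv α k) : Conv α k := ⟨fun w => (powPoly g w).coeff 1⟩

omit [CharZero k] in
theorem log_apply (g : Conv α k) (w : List α) :
    log g w = ∑ r ∈ Finset.range (w.length + 1), logCoeff k r * (g ^ r) w := by
  simp [log, powPoly, finsetSum_coeff, logCoeff, mul_comm]

variable {g : Conv α k}

theorem eval_powPoly (hg : g [] = 0) (w : List α) (m : ℕ) :
    (powPoly g w).eval (m : k) = ((1 + g) ^ m) w := by
  rw [add_comm, (Commute.one_right g).add_pow, sum_apply, powPoly, eval_finsetSum]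
  simp only [one_pow, mul_one, eval_mul, eval_C, binomPoly_eval, ← nsmul_eq_mul', nsmul_apply]
  -- The two sums have different ranges: terms beyond the length of the word vanish because `g` has
  -- no constant term, terms beyond `m` because the binomial coefficient is zero.
  rcases le_total w.length m with h | h
  · refine Finset.sum_subset (fun i hi => by simp at *; omega) fun r _ hr => ?_
    rw [pow_eq_zero_of_length_lt hg (by simpa [Nat.lt_succ_iff] using hr), nsmul_zero]
  · refine (Finset.sum_subset (fun i hi => by simp at *; omega) fun r _ hr => ?_).symm
    rw [Nat.choose_eq_zero_of_lt (by simpa [Nat.lt_succ_iff] using hr), zero_nsmul]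

theorem powPoly_coeff_zero (hg : g [] = 0) (w : List α) : (powPoly g w).coeff 0 = (1 : Conv α k) w := by
  rw [coeff_zero_eq_eval_zero, ← Nat.cast_zero, eval_powPoly hg, pow_zero]

theorem eval_cutSum (x : k) (h : List α → List α → k[X]) (w : List α) :
    (cutSum h w).eval x = cutSum (fun a b => (h a b).eval x) w :=
  map_cutSum (evalRingHom x).toAddMonoidHom h w

/-- The coefficient of n in (1 + g)^(n + m) = (1 + g)^n (1 + g)^m is the derivative in m on the
left, and on the right it is the logarithm times the m-th power. -/
theorem derivative_powPoly (hg : g [] = 0) (w : List α) :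
    derivative (powPoly g w) = cutSum (fun a b => C (log g a) * powPoly g b) w := by
  refine eq_of_eval_natCast fun m => ?_
  have key : taylor (m : k) (powPoly g w) =
      cutSum (fun a b => powPoly g a * C ((powPoly g b).eval (m : k))) w := by
    refine eq_of_eval_natCast fun n => ?_
    rw [taylor_eval, ← Nat.cast_add, eval_powPoly hg, pow_add, mul_apply, eval_cutSum]
    simp [eval_powPoly hg]
  have := congrArg (fun p : k[X] => p.coeff 1) key
  simp only [taylor_coeff_one] at this
  rw [this, ← lcoeff_apply, ← LinearMap.toAddMonoidHom_coe, map_cutSum, eval_cutSum]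
  simp [log]

/-- The coefficientwise form of (1 + g)^m = exp(m log(1 + g)), obtained by solving the differential
equation `derivative_powPoly` degree by degree. -/
theorem powPoly_coeff (hg : g [] = 0) (w : List α) (a : ℕ) :
    (powPoly g w).coeff a = (log g ^ a) w / a.factorial := by
  induction a generalizing w with
  | zero => simp [powPoly_coeff_zero hg]
  | succ a ih =>
    have := congrArg (fun p : k[X] => p.coeff a) (derivative_powPoly hg w)
    simp only [coeff_derivative] at this
    rw [← lcoeff_apply (R := k) a (cutSum _ w), ← LinearMap.toAddMonoidHom_coe, map_cutSum] at this
    simp only [LinearMap.toAddMonoidHom_coe, lcoeff_apply, coeff_C_mul, ih, div_eq_mul_inv,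
      ← mul_assoc, cutSum_mul_right] at this
    rw [pow_succ', mul_apply, Nat.factorial_succ]
    have h1 : (a + 1 : k) ≠ 0 := by exact_mod_cast a.succ_ne_zero
    have h2 : (a.factorial : k) ≠ 0 := by exact_mod_cast a.factorial_ne_zero
    push_cast
    field_simp
    field_simp at this
    exact this

theorem log_nil : log g [] = 0 := by
  simp [log_apply, logCoeff_zero]

theorem eval_powPoly_eq_sum (hg : g [] = 0) (w : List α) (x : k) :
    (powPoly g w).eval x =
      ∑ a ∈ Finset.range (w.length + 1), (log g ^ a) w / a.factorial * x ^ a := by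
  simp only [← powPoly_coeff hg]
  refine eval_eq_sum_range' (Nat.lt_succ_iff.2 (natDegree_le_iff_coeff_eq_zero.2 fun a ha => ?_)) x
  rw [powPoly_coeff hg, pow_eq_zero_of_length_lt log_nil ha, zero_div]

/-- The exponential of the logarithm. -/
theorem sum_log_pow (hg : g [] = 0) (w : List α) :
    ∑ a ∈ Finset.range (w.length + 1), (log g ^ a) w / a.factorial = (1 + g) w := by
  have := eval_powPoly_eq_sum hg w 1
  simp only [one_pow, mul_one] at this
  rw [← this, ← Nat.cast_one, eval_powPoly hg, pow_one]

/-- The polynomial `m ↦ ∑_{i=1}^m i^p`. -/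
noncomputable def faulhaber (p : ℕ) : ℚ[X] :=
  ∑ i ∈ Finset.range (p + 1), C (bernoulli' i * (p + 1).choose i / (p + 1)) * X ^ (p + 1 - i)

theorem faulhaber_eval (p m : ℕ) :
    (faulhaber p).eval (m : ℚ) = ∑ i ∈ Finset.Ico 1 (m + 1), (i : ℚ) ^ p := by
  rw [sum_Ico_pow, faulhaber, eval_finsetSum]
  refine Finset.sum_congr rfl fun i _ => ?_
  simp
  ring

theorem faulhaber_coeff_zero (p : ℕ) : (faulhaber p).coeff 0 = 0 := by
  rw [coeff_zero_eq_eval_zero, ← Nat.cast_zero, faulhaber_eval]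
  simp

theorem faulhaber_coeff_one (p : ℕ) : (faulhaber p).coeff 1 = bernoulli' p := by
  rw [faulhaber, finsetSum_coeff, Finset.sum_eq_single p]
  · have : (p + 1 : ℚ) ≠ 0 := by exact_mod_cast p.succ_ne_zero
    simp [Nat.choose_succ_self_right]
    field_simp
  · intro i hi hne
    rw [coeff_C_mul, coeff_X_pow, if_neg (by simp at hi; omega), mul_zero]
  · simp

/-- The polynomial `m ↦ ∑_{i=1}^m i^a (m-i)^b`. -/
noncomputable def faulhaber₂ (a b : ℕ) : ℚ[X] :=
  ∑ j ∈ Finset.range (b + 1), C ((-1) ^ j * (b.choose j : ℚ)) * (faulhaber (a + j) * X ^ (b - j))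

theorem faulhaber₂_eval (a b m : ℕ) : (faulhaber₂ a b).eval (m : ℚ) =
    ∑ i ∈ Finset.Ico 1 (m + 1), (i : ℚ) ^ a * ((m - i : ℕ) : ℚ) ^ b := by
  have : ∀ i ∈ Finset.Ico 1 (m + 1), (i : ℚ) ^ a * ((m - i : ℕ) : ℚ) ^ b =
      ∑ j ∈ Finset.range (b + 1), (-1) ^ j * (b.choose j : ℚ) * ((i : ℚ) ^ (a + j) * (m : ℚ) ^ (b - j)) := by
    intro i hi
    rw [Nat.cast_sub (by simp at hi; omega), sub_eq_neg_add, add_pow, Finset.mul_sum]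
    refine Finset.sum_congr rfl fun j _ => ?_
    rw [neg_pow, pow_add]
    ring
  rw [Finset.sum_congr rfl this, Finset.sum_comm, faulhaber₂, eval_finsetSum]
  refine Finset.sum_congr rfl fun j _ => ?_
  simp only [eval_mul, eval_C, eval_pow, eval_X, faulhaber_eval, ← Finset.mul_sum, ← Finset.sum_mul]

/-- Only j = b contributes, since Faulhaber polynomials have no constant term. Sums starting at i =
1 produce the convention B_1 = 1/2, and B'_n = (-1)^n B_n turns the sign (-1)^b into (-1)^a. This is
the source of the Bernoulli numbers in m_{n+1}. -/
theorem faulhaber₂_coeff_one (a b : ℕ) :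
    (faulhaber₂ a b).coeff 1 = (-1) ^ a * bernoulli (a + b) := by
  rw [faulhaber₂, finsetSum_coeff, Finset.sum_eq_single b]
  · rw [coeff_C_mul, Nat.sub_self, pow_zero, mul_one, faulhaber_coeff_one, bernoulli'_eq_bernoulli,
      Nat.choose_self, Nat.cast_one, mul_one, ← mul_assoc, ← pow_add,
      show b + (a + b) = a + (b + b) by ring, pow_add, (Even.add_self b).neg_one_pow, mul_one]
  · intro j hj hne
    obtain ⟨d, hd⟩ : ∃ d, b - j = d + 1 := ⟨b - j - 1, by simp at hj; omega⟩
    rw [coeff_C_mul, hd, pow_succ, ← mul_assoc, show (1 : ℕ) = 0 + 1 from rfl, coeff_mul_X,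
      mul_coeff_zero, faulhaber_coeff_zero, zero_mul, mul_zero]
  · simp

/-- The linear coefficient of the polynomial `m ↦ ∑_{i=1}^m (1 + g)^i u (1 + g)^{m-i} v`. -/
theorem exists_powSum_polynomial (hg : g [] = 0) (u v : List α) : ∃ S : k[X],
    (∀ m : ℕ, S.eval (m : k) =
      ∑ i ∈ Finset.Ico 1 (m + 1), ((1 + g) ^ i) u * ((1 + g) ^ (m - i)) v) ∧
    S.coeff 1 = ∑ a ∈ Finset.range (u.length + 1), ∑ b ∈ Finset.range (v.length + 1),
      (-1) ^ a * ((bernoulli (a + b) : ℚ) : k) / (a.factorial * b.factorial) *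
        ((log g ^ a) u * (log g ^ b) v) := by
  -- Both powers are expanded as exponentials of the logarithm, in powers i^a and (m-i)^b; summing
  -- over i then gives `faulhaber₂`.
  refine ⟨∑ a ∈ Finset.range (u.length + 1), ∑ b ∈ Finset.range (v.length + 1),
      C ((log g ^ a) u / a.factorial * ((log g ^ b) v / b.factorial)) *
        (faulhaber₂ a b).map (algebraMap ℚ k), fun m => ?_, ?_⟩
  · have e : ∀ a b, ((faulhaber₂ a b).map (algebraMap ℚ k)).eval (m : k) =
        ∑ i ∈ Finset.Ico 1 (m + 1), (i : k) ^ a * ((m - i : ℕ) : k) ^ b := by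
      intro a b
      rw [← map_natCast (algebraMap ℚ k), eval_map_algebraMap, aeval_algebraMap_apply,
        coe_aeval_eq_eval, faulhaber₂_eval]
      simp
    simp only [eval_finsetSum, eval_mul, eval_C, e, ← eval_powPoly hg, eval_powPoly_eq_sum hg,
      Finset.mul_sum, Finset.sum_mul]
    symm
    rw [Finset.sum_comm]
    refine (Finset.sum_congr rfl fun a _ => Finset.sum_comm).trans ?_
    rw [Finset.sum_comm]
    refine Finset.sum_congr rfl fun a _ => Finset.sum_congr rfl fun b _ =>
      Finset.sum_congr rfl fun i _ => ?_
    ring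
  · rw [finsetSum_coeff]
    refine Finset.sum_congr rfl fun a _ => ?_
    rw [finsetSum_coeff]
    refine Finset.sum_congr rfl fun b _ => ?_
    rw [coeff_C_mul, coeff_map, faulhaber₂_coeff_one]
    simp
    field_simp

end Conv

end Log

/-! ## Shuffles -/

section Shuffles

variable {α M : Type*}

/-- The sum of `h` over the shuffles of two words, without signs. -/
def shuffleSum [AddCommMonoid M] (h : List α → M) : List α → List α → M
  | [], v => h v
  | x :: u, [] => h (x :: u)
  | x :: u, y :: v =>
      shuffleSum (fun w => h (x :: w)) u (y :: v) + shuffleSum (fun w => h (y :: w)) (x :: u) v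
  termination_by u v => u.length + v.length

section

variable [AddCommMonoid M]

@[simp] theorem shuffleSum_nil_left (h : List α → M) (v : List α) : shuffleSum h [] v = h v := by
  rw [shuffleSum]

@[simp] theorem shuffleSum_nil_right (h : List α → M) (u : List α) : shuffleSum h u [] = h u := by
  cases u <;> rw [shuffleSum]

theorem shuffleSum_cons_cons (h : List α → M) (x : α) (u : List α) (y : α) (v : List α) :
    shuffleSum h (x :: u) (y :: v) =
      shuffleSum (fun w => h (x :: w)) u (y :: v) +
        shuffleSum (fun w => h (y :: w)) (x :: u) v := by
  rw [shuffleSum]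

/-- Induction along the recursive definition of the shuffles of two words. -/
theorem shuffle_induction {P : List α → List α → Prop} (left : ∀ v, P [] v) (right : ∀ u, P u [])
    (cons : ∀ x u y v, P u (y :: v) → P (x :: u) v → P (x :: u) (y :: v)) (u v : List α) :
    P u v := by
  induction hn : u.length + v.length using Nat.strong_induction_on generalizing u v with
  | _ n ih =>
    subst hn
    match u, v with
    | [], v => exact left v
    | u, [] => exact right u
    | x :: u, y :: v =>
      exact cons x u y v (ih _ (by simp) _ _ rfl) (ih _ (by simp) _ _ rfl)

theorem map_shuffleSum {N : Type*} [AddCommMonoid N] (f : M →+ N) (h : List α → M)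
    (u v : List α) : f (shuffleSum h u v) = shuffleSum (fun w => f (h w)) u v := by
  induction u, v using shuffle_induction generalizing h with
  | left v => simp
  | right u => simp
  | cons x u y v h1 h2 => simp only [shuffleSum_cons_cons, map_add, h1, h2]

theorem shuffleSum_add (h h' : List α → M) (u v : List α) :
    shuffleSum (fun w => h w + h' w) u v = shuffleSum h u v + shuffleSum h' u v := by
  induction u, v using shuffle_induction generalizing h h' with
  | left v => simp
  | right u => simp
  | cons x u y v h1 h2 => simp only [shuffleSum_cons_cons, h1, h2]; abel

theorem shuffleSum_congr {h h' : List α → M} {u v : List α}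
    (H : ∀ w, w.length = u.length + v.length → h w = h' w) :
    shuffleSum h u v = shuffleSum h' u v := by
  induction u, v using shuffle_induction generalizing h h' with
  | left v => simp [H]
  | right u => simp [H]
  | cons x u y v h1 h2 =>
    rw [shuffleSum_cons_cons, shuffleSum_cons_cons,
      h1 fun w hw => H _ (by simp [hw]; omega), h2 fun w hw => H _ (by simp [hw]; omega)]

end

/-- If no sign can occur, the signed shuffles are the unsigned ones. -/
theorem sum_shuffle [AddCommGroup M] (F : List α → M) (u v : List (ℤ × α))
    (H : ∀ x ∈ u, ∀ y ∈ v, x.1 * y.1 = 0) :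
    ((shuffle u v).map fun p => (p.1 : ℤ) • F (p.2.map Prod.snd)).sum =
      shuffleSum F (u.map Prod.snd) (v.map Prod.snd) := by
  induction u, v using shuffle_induction generalizing F with
  | left v => simp [shuffle]
  | right u => cases u <;> simp [shuffle]
  | cons x u y v h1 h2 =>
    have hs : y.1 * ((x :: u).map Prod.fst).sum = 0 := by
      rw [← List.sum_map_mul_left]
      refine List.sum_eq_zero fun z hz => ?_
      obtain ⟨a, ha, rfl⟩ := List.mem_map.1 hz
      exact (mul_comm _ _).trans (H a ha y (by simp))
    have e1 := h1 (fun w => F (x.2 :: w)) fun a ha => H a (by simp [ha])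
    have e2 := h2 (fun w => F (y.2 :: w)) fun a ha b hb => H a ha b (by simp [hb])
    rw [List.map_cons, List.map_cons, shuffleSum_cons_cons, ← List.map_cons, ← List.map_cons,
      ← e1, ← e2, shuffle, List.map_append, List.sum_append, List.map_map, List.map_map]
    simp only [List.map_cons] at hs
    simp only [Function.comp_def, hs, Int.negOnePow_zero, one_mul, List.map_cons]

theorem perm_of_mem_shuffle {u v : List (ℤ × α)} {p : ℤˣ × List (ℤ × α)} (hp : p ∈ shuffle u v) :
    p.2.Perm (u ++ v) := by
  induction u, v using shuffle_induction generalizing p with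
  | left v => simp [shuffle] at hp; simp [hp]
  | right u => cases u <;> (simp [shuffle] at hp; simp [hp])
  | cons x u y v h1 h2 =>
    rw [shuffle, List.mem_append, List.mem_map, List.mem_map] at hp
    rcases hp with ⟨q, hq, rfl⟩ | ⟨q, hq, rfl⟩
    · exact (h1 hq).cons x
    · exact ((h2 hq).cons y).trans (List.perm_middle (l₁ := x :: u)).symm

namespace Conv

variable {R : Type*} [CommRing R]

/-- Convolution is compatible with shuffles. -/
theorem shuffleSum_mul (f g : Conv α R) (u v : List α) :
    shuffleSum (f * g) u v = cutSum (fun u₁ u₂ => cutSum (fun v₁ v₂ =>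
      shuffleSum f u₁ v₁ * shuffleSum g u₂ v₂) v) u := by
  induction u, v using shuffle_induction generalizing f with
  | left v => simp [mul_apply]
  | right u => simp [mul_apply]
  | cons x u y v h1 h2 =>
    -- Either the left factor receives the empty word or its word begins with z; the second
    -- contribution is again a convolution, so the induction hypothesis applies to it.
    have key : ∀ z, (fun w => (f * g) (z :: w)) = fun w =>
        AddMonoidHom.mulLeft (f []) (g (z :: w)) + ((⟨fun w => f (z :: w)⟩ : Conv α R) * g) w :=
      fun z => rfl
    rw [shuffleSum_cons_cons, key x, key y, shuffleSum_add, shuffleSum_add, ← map_shuffleSum,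
      ← map_shuffleSum, h1, h2]
    simp only [cutSum_cons, cutSum_add, shuffleSum_cons_cons, shuffleSum_nil_left,
      shuffleSum_nil_right, mul_add, add_mul, AddMonoidHom.coe_mulLeft]
    abel

/-- A functional is a character if it is multiplicative on shuffles. -/
theorem shuffleSum_pow {f : Conv α R} (hf : ∀ u v, shuffleSum f u v = f u * f v) (m : ℕ)
    (u v : List α) : shuffleSum (f ^ m) u v = (f ^ m) u * (f ^ m) v := by
  induction m generalizing u v with
  | zero =>
    rw [pow_zero]
    induction u, v using shuffle_induction with
    | left v => simp
    | right u => simp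
    | cons x u y v _ _ =>
      rw [one_cons, zero_mul]
      have : ∀ w : List α, w.length = (x :: u).length + (y :: v).length →
          (1 : Conv α R) w = (fun _ => 0) w :=
        fun w hw => one_of_ne (by rintro rfl; simp at hw)
      rw [shuffleSum_congr this, ← map_zero (0 : R →+ R)]
      exact (map_shuffleSum (0 : R →+ R) (fun _ => 0) _ _).symm
  | succ m ih =>
    rw [pow_succ, shuffleSum_mul, mul_apply, mul_apply, ← cutSum_mul_right]
    refine cutSum_congr fun _ _ _ => ?_
    rw [← cutSum_mul_left]
    refine cutSum_congr fun _ _ _ => ?_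
    rw [ih, hf]
    ring

/-- The only surviving cuts give one whole word to each factor. The result is symmetric in `f` and
`g`, which is why commutators of such functionals again vanish on shuffles. -/
theorem shuffleSum_mul_of_primitive {f g : Conv α R}
    (hf : ∀ u v, u ≠ [] → v ≠ [] → shuffleSum f u v = 0)
    (hg : ∀ u v, u ≠ [] → v ≠ [] → shuffleSum g u v = 0) {u v : List α} (hu : u ≠ [])
    (hv : v ≠ []) : shuffleSum (f * g) u v = f u * g v + f v * g u := by
  obtain ⟨x, u, rfl⟩ := List.exists_cons_of_ne_nil hu
  rw [shuffleSum_mul, cutSum_cons, add_comm, cutSum_eq_left (w := v), shuffleSum_nil_left,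
    shuffleSum_nil_right]
  · congr 1
    rw [cutSum_eq_left (w := u), cutSum_eq_right (w := v), shuffleSum_nil_left, shuffleSum_nil_right]
    · intro a b _ ha
      rw [hf _ _ (by simp) ha, zero_mul]
    · intro a b _ hb
      refine cutSum_eq_zero fun c d e => ?_
      by_cases hc : c = []
      · rw [hg b d hb (by rintro rfl; simp [hc] at e; exact hv e), mul_zero]
      · rw [hf _ _ (by simp) hc, zero_mul]
  · intro a b _ hb
    rw [hg _ _ (by simp) hb, mul_zero]

theorem shuffleSum_commutator {f g : Conv α R}
    (hf : ∀ u v, u ≠ [] → v ≠ [] → shuffleSum f u v = 0)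
    (hg : ∀ u v, u ≠ [] → v ≠ [] → shuffleSum g u v = 0) {u v : List α} (hu : u ≠ [])
    (hv : v ≠ []) : shuffleSum (f * g - g * f) u v = 0 := by
  have e : (f * g - g * f : Conv α R).toFun =
      fun w => (f * g) w + (-AddMonoidHom.id R) ((g * f) w) := by
    funext w; rw [sub_apply, sub_eq_add_neg]; rfl
  rw [e, shuffleSum_add, ← map_shuffleSum, shuffleSum_mul_of_primitive hf hg hu hv,
    shuffleSum_mul_of_primitive hg hf hu hv]
  simp only [AddMonoidHom.neg_apply, AddMonoidHom.id_apply]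
  ring

open Polynomial in
/-- The logarithm of a character vanishes on shuffles. -/
theorem shuffleSum_log {k : Type*} [Field k] [CharZero k] {g : Conv α k} (hg : g [] = 0)
    (hc : ∀ u v, shuffleSum (1 + g : Conv α k).toFun u v = (1 + g : Conv α k) u * (1 + g : Conv α k) v)
    {u v : List α} (hu : u ≠ []) (hv : v ≠ []) : shuffleSum (log g) u v = 0 := by
  -- Every natural power of a character is a character. In the linear coefficient of the product
  -- nothing is left, because both factors have zero constant term on non-empty words.
  have key : shuffleSum (powPoly g) u v = powPoly g u * powPoly g v := by
    refine eq_of_eval_natCast fun m => ?_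
    have := map_shuffleSum (evalRingHom (m : k)).toAddMonoidHom (powPoly g) u v
    refine Eq.trans this ?_
    simp only [RingHom.toAddMonoidHom_eq_coe, AddMonoidHom.coe_coe, coe_evalRingHom,
      eval_powPoly hg, eval_mul]
    exact shuffleSum_pow hc m u v
  refine Eq.trans (map_shuffleSum (lcoeff k 1).toAddMonoidHom (powPoly g) u v).symm ?_
  rw [key]
  simp [mul_coeff_one, powPoly_coeff_zero hg, one_of_ne hu, one_of_ne hv]

end Conv

end Shuffles

/-! ## Inserting a function between one-forms -/

section Del

variable {A k : Type*} [CommRing A] [Field k]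

/-- The values of `φ` on the words obtained by multiplying `f` with its right neighbour. -/
def mergeRight {M : Type*} [AddCommGroup M] (f : A) (φ : List A → M) : List A → M
  | [] => 0
  | a :: v => φ (f * a :: v)

/-- The alternating sum of the values of `φ` on the words obtained from `u`, `f`, `v` by inserting the
derivative `f'` of `f`, and by multiplying `f` with its neighbours. -/
def del {M : Type*} [AddCommGroup M] (f f' : A) (φ : List A → M) : List A → List A → M
  | [], v => φ (f' :: v) - mergeRight f φ v
  | [x], v => φ (x :: f' :: v) - mergeRight f (fun w => φ (x :: w)) v + φ (x * f :: v)
  | x :: y :: u, v => del f f' (fun w => φ (x :: w)) (y :: u) v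

section

variable {M N : Type*} [AddCommGroup M] [AddCommGroup N]

/-- The word `f v` with `f` multiplied onto the preceding letter `x`, if `u` is empty. -/
def mergeLeft (x f : A) (φ : List A → M) : List A → List A → M
  | [], v => φ (x * f :: v)
  | _ :: _, _ => 0

theorem del_nil (f f' : A) (φ : List A → M) (v : List A) :
    del f f' φ [] v = φ (f' :: v) - mergeRight f φ v := rfl

theorem del_cons (f f' : A) (φ : List A → M) (x : A) (u v : List A) :
    del f f' φ (x :: u) v = del f f' (fun w => φ (x :: w)) u v + mergeLeft x f φ u v := by
  cases u <;> simp [del, mergeLeft]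

theorem map_mergeRight (F : M →+ N) (f : A) (φ : List A → M) (v : List A) :
    F (mergeRight f φ v) = mergeRight f (fun w => F (φ w)) v := by
  cases v <;> simp [mergeRight]

theorem map_del (F : M →+ N) (f f' : A) (φ : List A → M) (u v : List A) :
    F (del f f' φ u v) = del f f' (fun w => F (φ w)) u v := by
  induction u generalizing φ with
  | nil => rw [del_nil, map_sub, map_mergeRight, del_nil]
  | cons x u ih => rw [del_cons, map_add, ih, del_cons]; cases u <;> simp [mergeLeft]

theorem del_add (f f' : A) (φ ψ : List A → M) (u v : List A) :
    del f f' (fun w => φ w + ψ w) u v = del f f' φ u v + del f f' ψ u v := by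
  induction u generalizing φ ψ with
  | nil => cases v <;> simp [del_nil, mergeRight]; abel
  | cons x u ih => rw [del_cons, ih, del_cons, del_cons]; cases u <;> simp [mergeLeft]; abel

end

/-! ### The insertion operator on powers and on the logarithm. -/

namespace Conv

/-- `del` is a derivation. -/
theorem del_mul (f f' : A) (φ ψ : Conv A k) (u v : List A) : del f f' (φ * ψ) u v =
    cutSum (fun v₁ v₂ => del f f' φ u v₁ * ψ v₂) v +
      cutSum (fun u₁ u₂ => φ u₁ * del f f' ψ u₂ v) u := by
  induction u generalizing φ with
  | nil =>
    cases v with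
    | nil => simp [del_nil, mergeRight, mul_cons]; ring
    | cons a v =>
      simp only [del_nil, mergeRight, mul_cons, cutSum_cons, cutSum_nil, add_mul, sub_eq_add_neg,
        cutSum_add, neg_mul, cutSum_neg]
      ring
  | cons x u ih =>
    have key : (fun w => (φ * ψ) (x :: w)) = fun w =>
        AddMonoidHom.mulLeft (φ []) (ψ (x :: w)) + ((⟨fun w => φ (x :: w)⟩ : Conv A k) * ψ) w := rfl
    rw [del_cons, key, del_add, ← map_del, ih]
    simp only [del_cons, cutSum_cons, add_mul, cutSum_add, mul_add, AddMonoidHom.coe_mulLeft]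
    cases u with
    | nil => simp only [mergeLeft, mul_cons]; ring
    | cons y u => simp only [mergeLeft, zero_mul, cutSum_zero, mul_zero]; ring

/-- The derivation hits each of the m factors in turn. By `hL` the factor it hits is given entirely
to the left word, with weight e₁, or entirely to the right word, with weight -e₀. -/
theorem del_pow {f f' : A} {L : Conv A k} {e₀ e₁ : k}
    (hL : ∀ u v, del f f' L u v = e₁ * (L u * (1 : Conv A k) v) - e₀ * ((1 : Conv A k) u * L v))
    (m : ℕ) (u v : List A) : del f f' (L ^ m) u v =
      ∑ i ∈ Finset.range m, (e₁ * ((L ^ (i + 1)) u * (L ^ (m - 1 - i)) v) -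
        e₀ * ((L ^ i) u * (L ^ (m - i)) v)) := by
  induction m generalizing u v with
  | zero =>
    rw [pow_zero, Finset.sum_range_zero]
    induction u with
    | nil => cases v <;> simp [del_nil, mergeRight]
    | cons x u _ =>
      have : (fun w => (1 : Conv A k) (x :: w)) = fun w => (0 : k →+ k) 0 := by
        funext w; rw [one_cons]; rfl
      rw [del_cons, this, ← map_del]
      cases u <;> simp [mergeLeft]
  | succ m ih =>
    rw [pow_succ, del_mul, Finset.sum_range_succ]
    congr 1
    · simp only [ih, Finset.sum_mul, cutSum_sum]
      refine Finset.sum_congr rfl fun i hi => ?_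
      have h1 : m + 1 - 1 - i = m - 1 - i + 1 := by simp at hi; omega
      have h2 : m + 1 - i = m - i + 1 := by simp at hi; omega
      rw [h1, h2, pow_succ L (m - 1 - i), pow_succ L (m - i), mul_apply, mul_apply]
      simp only [add_mul, sub_eq_add_neg, cutSum_add, neg_mul, cutSum_neg, mul_assoc,
        cutSum_mul_left]
    · have h1 : m + 1 - 1 - m = 0 := by omega
      have h2 : m + 1 - m = 1 := by omega
      rw [h1, h2, pow_zero, pow_one, pow_succ]
      simp only [hL, mul_add, sub_eq_add_neg, cutSum_add, mul_neg, cutSum_neg]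
      congr 1
      · rw [mul_apply, ← cutSum_mul_right, ← cutSum_mul_left]
        exact cutSum_congr fun _ _ _ => by ring
      · congr 1
        rw [cutSum_eq_left, one_nil]
        · ring
        · intro a b _ hb
          rw [one_of_ne hb]; ring

open Polynomial in
/-- The value of `del` on the logarithm of a functional with known boundary behaviour. -/
theorem del_log [CharZero k] {f f' : A} {g : Conv A k} (hg : g [] = 0) {e₀ e₁ : k}
    (hL : ∀ u v, del f f' (1 + g : Conv A k) u v =
      e₁ * ((1 + g : Conv A k) u * (1 : Conv A k) v) -
        e₀ * ((1 : Conv A k) u * (1 + g : Conv A k) v)) (u v : List A) :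
    del f f' (log g) u v =
      (e₁ - e₀) * ∑ a ∈ Finset.range (u.length + 1), ∑ b ∈ Finset.range (v.length + 1),
        (-1) ^ a * ((_root_.bernoulli (a + b) : ℚ) : k) / (a.factorial * b.factorial) *
          ((log g ^ a) u * (log g ^ b) v) +
      e₀ * (log g u * (1 : Conv A k) v - (1 : Conv A k) u * log g v) := by
  obtain ⟨S, hS, hS1⟩ := exists_powSum_polynomial hg u v
  have key : del f f' (powPoly g) u v = C (e₁ - e₀) * S +
      C e₀ * (powPoly g u * C ((1 : Conv A k) v) - C ((1 : Conv A k) u) * powPoly g v) := by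
    refine eq_of_eval_natCast fun m => ?_
    refine (map_del (evalRingHom (m : k)).toAddMonoidHom f f' (powPoly g) u v).trans ?_
    simp only [RingHom.toAddMonoidHom_eq_coe, AddMonoidHom.coe_coe, coe_evalRingHom,
      eval_powPoly hg, eval_mul, eval_add, eval_sub, eval_C, hS]
    refine (del_pow hL m u v).trans ?_
    have h1 : ∑ i ∈ Finset.range m, ((1 + g) ^ (i + 1)) u * ((1 + g) ^ (m - 1 - i)) v =
        ∑ i ∈ Finset.Ico 1 (m + 1), ((1 + g) ^ i) u * ((1 + g) ^ (m - i)) v := by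
      rw [Finset.sum_Ico_eq_sum_range]
      refine Finset.sum_congr (by simp) fun i hi => ?_
      rw [add_comm 1 i, Nat.sub_add_eq, Nat.sub_right_comm]
    -- The e₀-sum runs over 0 ≤ i < m and the e₁-sum over 1 ≤ i ≤ m. Putting both on the second
    -- range costs the boundary terms i = 0 and i = m, which become the last summand of the formula.
    have h2 : ∑ i ∈ Finset.range m, ((1 + g) ^ i) u * ((1 + g) ^ (m - i)) v +
          ((1 + g) ^ m) u * (1 : Conv A k) v =
        ∑ i ∈ Finset.Ico 1 (m + 1), ((1 + g) ^ i) u * ((1 + g) ^ (m - i)) v +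
          (1 : Conv A k) u * ((1 + g) ^ m) v := by
      have e1 := Finset.sum_range_succ (fun i => ((1 + g) ^ i) u * ((1 + g) ^ (m - i)) v) m
      have e2 := Finset.sum_eq_sum_Ico_succ_bot (Nat.succ_pos m)
        (fun i => ((1 + g) ^ i) u * ((1 + g) ^ (m - i)) v)
      rw [← Finset.range_eq_Ico] at e2
      simp only [pow_zero, Nat.sub_self, Nat.sub_zero, zero_add, Nat.succ_eq_add_one] at e1 e2
      rw [← e1, e2, add_comm]
    rw [Finset.sum_sub_distrib, ← Finset.mul_sum, ← Finset.mul_sum, h1]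
    linear_combination -e₀ * h2
  have := congrArg (fun p : k[X] => p.coeff 1) key
  refine ((map_del (lcoeff k 1).toAddMonoidHom f f' (powPoly g) u v).symm.trans this).trans ?_
  simp only [coeff_add, coeff_C_mul, coeff_sub, coeff_mul_C, hS1]
  rfl

end Conv

end Del

/-! ## Iterated integrals -/

namespace Calculus

variable {k A : Type*} [Field k] [CommRing A] [Algebra k A] (c : Calculus k A)

theorem D_algebraMap (r : k) : c.D (algebraMap k A r) = 0 := by
  have h := c.leibniz 1 1
  have h1 : c.D 1 = 0 := by simpa using h
  rw [Algebra.algebraMap_eq_smul_one, map_smul, h1, smul_zero]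

/-- Not among the axioms of `Calculus`, but forced by the two that relate `D` and `prim`. -/
theorem ev0_prim (f : A) : c.ev0 (c.prim f) = 0 := by
  have h := congrArg c.ev0 (c.prim_D (c.prim f))
  rw [c.D_prim, map_sub, AlgHom.commutes, Algebra.algebraMap_self_apply, sub_self] at h
  exact h

theorem ev1_prim_D (f : A) : c.ev1 (c.prim (c.D f)) = c.ev1 f - c.ev0 f := by
  rw [c.prim_D, map_sub, AlgHom.commutes, Algebra.algebraMap_self_apply]

theorem eq_of_D_eq {f g : A} (h : c.D f = c.D g) (h1 : c.ev1 f = c.ev1 g) : f = g := by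
  have h2 := c.prim_D (f - g)
  rw [map_sub, h, sub_self, map_zero] at h2
  have h3 : f - g = algebraMap k A (c.ev0 (f - g)) := (sub_eq_zero.1 h2.symm)
  have h4 := congrArg c.ev1 h3
  rw [map_sub, h1, sub_self, AlgHom.commutes, Algebra.algebraMap_self_apply] at h4
  rw [← h4, map_zero] at h3
  exact sub_eq_zero.1 h3

theorem D_t_pow (n : ℕ) : c.D (c.t ^ (n + 1)) = (n + 1 : k) • c.t ^ n := by
  induction n with
  | zero => simp [c.D_t]
  | succ n ih =>
    rw [pow_succ, c.leibniz, ih, c.D_t]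
    push_cast
    simp only [Algebra.smul_def, map_add, map_natCast, map_one]
    ring

theorem prim_t_pow [CharZero k] (n : ℕ) : c.prim (c.t ^ n) = (n + 1 : k)⁻¹ • c.t ^ (n + 1) := by
  have h : (n + 1 : k) ≠ 0 := by exact_mod_cast n.succ_ne_zero
  have := c.prim_D (c.t ^ (n + 1))
  rw [c.D_t_pow, map_smul, map_pow c.ev0, c.ev0_t, zero_pow n.succ_ne_zero, map_zero, sub_zero] at this
  rw [← this, smul_smul, inv_mul_cancel₀ h, one_smul]

/-- The iterated integral over `[0,1]` with an additional inner integrand. -/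
noncomputable def holFrom : List A → A →ₗ[k] k
  | [] => c.ev1.toLinearMap
  | a :: w => holFrom w ∘ₗ c.prim ∘ₗ LinearMap.mulRight k a

@[simp] theorem holFrom_nil (J : A) : c.holFrom [] J = c.ev1 J := rfl

@[simp] theorem holFrom_cons (a : A) (w : List A) (J : A) :
    c.holFrom (a :: w) J = c.holFrom w (c.prim (J * a)) := rfl

theorem ev1_foldl (w : List A) (J : A) :
    c.ev1 (w.foldl (fun J a => c.prim (J * a)) J) = c.holFrom w J := by
  induction w generalizing J with
  | nil => rfl
  | cons a w ih => exact ih _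

/-- The holonomy functional: the iterated integral of a word over `[0,1]`. -/
noncomputable def hol : Conv A k := ⟨fun w => c.holFrom w 1⟩

theorem hol_apply (w : List A) : c.hol w = c.holFrom w 1 := rfl

theorem ev1_iteratedIntegral (w : List A) : c.ev1 (iteratedIntegral c w) = c.hol w :=
  c.ev1_foldl w 1

/-- The holonomy functional without its constant term. -/
noncomputable def holRed : Conv A k := c.hol - 1

theorem holRed_nil : c.holRed [] = 0 := by
  rw [holRed, Conv.sub_apply, Conv.one_nil, hol_apply, holFrom_nil, map_one, sub_self]

theorem one_add_holRed : 1 + c.holRed = c.hol := add_sub_cancel _ _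

theorem holRed_of_ne {w : List A} (h : w ≠ []) : c.holRed w = c.hol w := by
  rw [holRed, Conv.sub_apply, Conv.one_of_ne h, sub_zero]

/-- Integration by parts, with a general inner integrand `J` so that letters can be peeled off from
the left. The term with `c.D J` is the merge of f with its left neighbour; the next letter peeled
off makes it cancel against `mergeLeft`, and the boundary term at 0 disappears because primitives
vanish there. -/
theorem del_holFrom (f : A) (u v : List A) (J : A) :
    del f (c.D f) (fun w => c.holFrom w J) u v =
      c.holFrom u J * c.ev1 f * (1 : Conv A k) v -
        (1 : Conv A k) u * (c.ev0 (J * f) * c.hol v + c.holFrom v (c.prim (c.D J * f))) := by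
  induction u generalizing J with
  | nil =>
    have hJ : c.prim (J * c.D f) =
        J * f - algebraMap k A (c.ev0 (J * f)) - c.prim (c.D J * f) := by
      rw [← c.prim_D, c.leibniz, map_add, mul_comm f, add_sub_cancel_right]
    rw [del_nil, holFrom_cons, hJ]
    cases v with
    | nil =>
      simp only [mergeRight, holFrom_nil, map_sub, map_mul, AlgHom.commutes, Conv.one_nil, hol_apply,
        map_one, Algebra.algebraMap_self_apply]
      ring
    | cons a v =>
      simp only [mergeRight, holFrom_cons, hol_apply, map_sub, Conv.one_cons, Conv.one_nil,
        one_mul, mul_zero, ← Algebra.smul_def, map_smul, smul_eq_mul, mul_assoc]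
      ring
  | cons x u ih =>
    rw [del_cons]
    simp only [holFrom_cons, ih, map_mul, ev0_prim, c.D_prim, zero_mul, zero_add]
    cases u with
    | nil => simp [mergeLeft, mul_assoc]
    | cons y u => simp [mergeLeft]

/-- Stokes' formula for iterated integrals. -/
theorem del_hol (f : A) (u v : List A) : del f (c.D f) c.hol u v =
    c.ev1 f * (c.hol u * (1 : Conv A k) v) - c.ev0 f * ((1 : Conv A k) u * c.hol v) := by
  have h := c.del_holFrom f u v 1
  have h1 : c.D 1 = 0 := by simpa using c.D_algebraMap 1
  rw [h1, one_mul, zero_mul, map_zero, map_zero, add_zero] at h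
  refine Eq.trans h ?_
  rw [← hol_apply]
  ring

/-- The primitive of `-a` vanishing at `1`. -/
noncomputable def coprim (a : A) : A := algebraMap k A (c.ev1 (c.prim a)) - c.prim a

theorem D_coprim (a : A) : c.D (c.coprim a) = -a := by
  rw [coprim, map_sub, D_algebraMap, c.D_prim, zero_sub]

theorem ev1_coprim (a : A) : c.ev1 (c.coprim a) = 0 := by
  rw [coprim, map_sub, AlgHom.commutes, Algebra.algebraMap_self_apply, sub_self]

/-- The iterated integral over the region `s ≤ t₁ ≤ ⋯ ≤ tₙ ≤ 1`, as a function of `s`. -/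
noncomputable def backIntegral : List A → A
  | [] => 1
  | a :: w => c.coprim (a * backIntegral w)

/-- Integration by parts reverses the order of integration. It is needed because shuffles recurse on
the first letter, which is innermost in `holFrom` but is the one exposed by differentiating
`backIntegral`. -/
theorem holFrom_eq_backIntegral (w : List A) (J : A) :
    c.holFrom w J = c.ev0 J * c.ev0 (c.backIntegral w) +
      c.ev1 (c.prim (c.D J * c.backIntegral w)) := by
  induction w generalizing J with
  | nil => rw [backIntegral, mul_one, ev1_prim_D]; simp
  | cons a w ih =>
    have h := c.ev1_prim_D (J * c.backIntegral (a :: w))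
    rw [c.leibniz, backIntegral, D_coprim, map_mul, map_mul, ev1_coprim, map_add, map_add, mul_neg,
      map_neg, map_neg, ← backIntegral] at h
    rw [holFrom_cons, ih, ev0_prim, zero_mul, zero_add, c.D_prim, mul_assoc, mul_comm (c.D J)]
    linear_combination -h

theorem hol_eq_backIntegral (w : List A) : c.hol w = c.ev0 (c.backIntegral w) := by
  have h1 : c.D 1 = 0 := by simpa using c.D_algebraMap 1
  rw [hol_apply, holFrom_eq_backIntegral, h1]
  simp

/-- Both sides have the same derivative, by the Leibniz rule and the recursion for shuffles, and for
non-empty words both vanish at 1. -/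
theorem shuffleSum_backIntegral (u v : List A) :
    shuffleSum c.backIntegral u v = c.backIntegral u * c.backIntegral v := by
  induction u, v using shuffle_induction with
  | left v => simp [backIntegral]
  | right u => simp [backIntegral]
  | cons x u y v h1 h2 =>
    have e : ∀ (z : A) (u v : List A), shuffleSum (fun w => c.backIntegral (z :: w)) u v =
        c.coprim (z * shuffleSum c.backIntegral u v) := fun z u v =>
      (map_shuffleSum (⟨⟨fun a => c.coprim (z * a), by simp [coprim]⟩, fun a b => by
        simp only [coprim, mul_add, map_add]; ring⟩ : A →+ A) c.backIntegral u v).symm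
    rw [shuffleSum_cons_cons, e, e, h1, h2]
    refine c.eq_of_D_eq ?_ ?_
    · rw [map_add, D_coprim, D_coprim, c.leibniz, backIntegral, D_coprim, backIntegral, D_coprim]
      ring
    · rw [map_add, ev1_coprim, ev1_coprim, map_mul, backIntegral, ev1_coprim]
      ring

/-- Iterated integrals are multiplicative on shuffles. -/
theorem shuffleSum_hol (u v : List A) : shuffleSum c.hol u v = c.hol u * c.hol v := by
  have := map_shuffleSum (c.ev0 : A →+* k).toAddMonoidHom c.backIntegral u v
  rw [shuffleSum_backIntegral] at this
  simp only [hol_eq_backIntegral]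
  rw [← map_mul]
  refine Eq.trans ?_ this.symm
  congr 1
  funext w
  exact c.hol_eq_backIntegral w

/-- Repeated integration of powers of t; the case i = 0 gives the volume of the simplex. -/
theorem holFrom_algebraMap [CharZero k] (w : List k) (i : ℕ) :
    c.holFrom (w.map (algebraMap k A)) (c.t ^ i) =
      w.prod * (i.factorial : k) / ((i + w.length).factorial : k) := by
  induction w generalizing i with
  | nil =>
    have : (i.factorial : k) ≠ 0 := by exact_mod_cast i.factorial_ne_zero
    simp [c.ev1_t, this]
  | cons r w ih =>
    have h : (i + 1 : k) ≠ 0 := by exact_mod_cast i.succ_ne_zero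
    rw [List.map_cons, holFrom_cons, mul_comm, ← Algebra.smul_def, map_smul, prim_t_pow, map_smul,
      map_smul, ih, List.prod_cons, List.length_cons, Nat.factorial_succ, smul_eq_mul, smul_eq_mul,
      show i + (w.length + 1) = i + 1 + w.length by ring]
    push_cast
    field_simp

theorem hol_algebraMap [CharZero k] (w : List k) :
    c.hol (w.map (algebraMap k A)) = w.prod / (w.length.factorial : k) := by
  have := c.holFrom_algebraMap w 0
  rw [hol_apply, ← pow_zero c.t, this]
  simp

end Calculus

/-! ## Families that are linear in every letter -/

section Multilinear

variable {k V W : Type*} [Field k] [AddCommGroup V] [Module k V] [AddCommGroup W] [Module k W]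

/-- `F` is linear in every letter. -/
def LinearInLetters (k : Type*) [Field k] {V W : Type*} [AddCommGroup V] [Module k V]
    [AddCommGroup W] [Module k W] (F : List V → W) : Prop :=
  ∀ (u v : List V) (x y : V) (c : k),
    F (u ++ (x + c • y) :: v) = F (u ++ x :: v) + c • F (u ++ y :: v)

variable {F : List V → W}

theorem LinearInLetters.map_zero (hF : LinearInLetters k F) (u v : List V) :
    F (u ++ 0 :: v) = 0 := by
  have := hF u v 0 0 1
  simpa using this

theorem LinearInLetters.map_of_mem (hF : LinearInLetters k F) {w : List V} (h : 0 ∈ w) :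
    F w = 0 := by
  obtain ⟨u, v, rfl⟩ := List.append_of_mem h
  exact hF.map_zero u v

theorem LinearInLetters.map_neg (hF : LinearInLetters k F) (u v : List V) (x : V) :
    F (u ++ (-x) :: v) = -F (u ++ x :: v) := by
  have := hF u v 0 x (-1)
  rw [hF.map_zero] at this
  simpa using this

theorem LinearInLetters.map_add (hF : LinearInLetters k F) (u v : List V) (x y : V) :
    F (u ++ (x + y) :: v) = F (u ++ x :: v) + F (u ++ y :: v) := by
  have := hF u v x y 1
  simpa using this

theorem LinearInLetters.cons (hF : LinearInLetters k F) (x : V) :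
    LinearInLetters k fun w => F (x :: w) := fun u v y z c => hF (x :: u) v y z c

theorem LinearInLetters.comp_linear {U : Type*} [AddCommGroup U] [Module k U] (f : W →ₗ[k] U)
    (hF : LinearInLetters k F) : LinearInLetters k fun w => f (F w) := fun u v x y c => by
  simp only [hF u v, _root_.map_add, map_smul]

theorem LinearInLetters.comp_map {U : Type*} [AddCommGroup U] [Module k U] (f : U →ₗ[k] V)
    (hF : LinearInLetters k F) : LinearInLetters k fun w => F (w.map f) := fun u v x y c => by
  simp only [List.map_append, List.map_cons, _root_.map_add, map_smul]
  rw [hF]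

theorem LinearInLetters.sum {ι : Type*} (s : Finset ι) {F : ι → List V → W}
    (hF : ∀ i ∈ s, LinearInLetters k (F i)) : LinearInLetters k fun w => ∑ i ∈ s, F i w :=
  fun u v x y c => by
    rw [Finset.smul_sum, ← Finset.sum_add_distrib]
    exact Finset.sum_congr rfl fun i hi => hF i hi u v x y c

theorem Conv.linearInLetters_one : LinearInLetters k (1 : Conv V k) := fun u v x y c => by
  simp [Conv.one_of_ne]

theorem Conv.linearInLetters_mul {f g : Conv V k} (hf : LinearInLetters k f)
    (hg : LinearInLetters k g) : LinearInLetters k (f * g : Conv V k) := fun u v x y c => by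
  simp only [Conv.mul_apply, cutSum_append_cons, smul_eq_mul, mul_add, ← cutSum_mul_left]
  rw [add_add_add_comm, ← cutSum_add, ← cutSum_add]
  congr 1
  · refine cutSum_congr fun a b _ => ?_
    rw [hg, smul_eq_mul]; ring
  · refine cutSum_congr fun a b _ => ?_
    rw [hf, smul_eq_mul]; ring

theorem Conv.linearInLetters_pow {f : Conv V k} (hf : LinearInLetters k f) (n : ℕ) :
    LinearInLetters k (f ^ n : Conv V k) := by
  induction n with
  | zero => rw [pow_zero]; exact linearInLetters_one
  | succ n ih => rw [pow_succ]; exact linearInLetters_mul ih hf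

theorem Conv.linearInLetters_log {f : Conv V k} (hf : LinearInLetters k f) :
    LinearInLetters k (log f) := fun u v x y c => by
  simp only [log_apply, List.length_append, List.length_cons]
  exact LinearInLetters.sum (Finset.range (u.length + (v.length + 1) + 1))
    (F := fun r w => logCoeff k r * (f ^ r) w)
    (fun r _ => (linearInLetters_pow hf r).comp_linear (LinearMap.mulLeft k (logCoeff k r))) u v x y c

end Multilinear

namespace Calculus

variable {k A : Type*} [Field k] [CommRing A] [Algebra k A] (c : Calculus k A)

theorem linearInLetters_holFrom (J : A) : LinearInLetters k fun w => c.holFrom w J := by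
  intro u v x y r
  induction u generalizing J with
  | nil => simp [mul_add]
  | cons z u ih => simpa using ih _

theorem linearInLetters_holRed : LinearInLetters k c.holRed := by
  intro u v x y r
  rw [holRed_of_ne _ (by simp), holRed_of_ne _ (by simp), holRed_of_ne _ (by simp)]
  exact c.linearInLetters_holFrom 1 u v x y r

end Calculus

/-! ## The morphisms `exp`, `log` and `φ` in closed form -/

section Families

variable {k : Type*} [Field k] {U V W : Type*} [AddCommGroup V] [AddCommGroup W]

theorem comp_eq_splitSum (F : List V → W) (G : List U → V) (w : List U) :
    comp F G w = splitSum (fun us => F (us.map G)) w := rfl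

/-- Since the linear part of `F` is the identity, isolating the one-block decomposition in `comp F G
= idFamily` yields the very recursion that defines `compInvAux`. -/
theorem compInvAux_eq {F G : List V → V} (h : comp F G = idFamily) (hF : F [] = 0)
    (hF1 : ∀ x, F [x] = x) (hG : G [] = 0) (N : ℕ) {w : List V} (hw : w.length ≤ N) :
    compInvAux F N w = G w := by
  induction N generalizing w with
  | zero => rw [List.length_eq_zero_iff.1 (Nat.le_zero.1 hw), compInvAux, hG]
  | succ N ih =>
    have hs : ((splits w).filter fun us => decide (2 ≤ us.length)).map
          (fun us => F (us.map (compInvAux F N))) =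
        ((splits w).filter fun us => decide (2 ≤ us.length)).map (fun us => F (us.map G)) := by
      refine List.map_congr_left fun us hus => ?_
      rw [List.mem_filter, decide_eq_true_iff] at hus
      congr 1
      refine List.map_congr_left fun u hu => ih ?_
      -- With at least two non-empty blocks, each block is strictly shorter than the word, so the
      -- induction hypothesis covers it.
      have h1 := congrArg List.length (flatten_of_mem_splits hus.1)
      obtain ⟨A, B, rfl⟩ := List.append_of_mem hu
      obtain ⟨v, hv, hne⟩ : ∃ v ∈ A ++ B, v ≠ [] := by
        have : A ++ B ≠ [] := by
          rintro e
          have := hus.2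
          simp at this e
          simp [e] at this
        obtain ⟨v, hv⟩ := List.exists_mem_of_ne_nil _ this
        exact ⟨v, hv, ne_nil_of_mem_splits hus.1 (by simp at hv ⊢; tauto)⟩
      have h2 := List.length_pos_iff.2 hne
      have h3 : v.length ≤ (A ++ B).flatten.length := by
        rw [List.length_flatten]
        exact List.single_le_sum (by simp) _ (List.mem_map_of_mem hv)
      simp at h1 h3
      omega
    have h2 : idFamily w = (((splits w).filter fun us => decide (2 ≤ us.length)).map
          (fun us => F (us.map G))).sum + G w := by
      rw [← h, comp_eq_splitSum]
      rcases eq_or_ne w [] with rfl | hne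
      · simp [splits, hF, hG]
      have e : ∀ us : List (List V), F (us.map G) =
          (if 2 ≤ us.length then F (us.map G) else 0) +
            (if 2 ≤ us.length then 0 else F (us.map G)) := by
        intro us; split_ifs <;> simp
      rw [splitSum_congr fun us _ => e us, splitSum_add]
      congr 1
      · rw [splitSum, List.sum_map_ite]
        simp
      · rw [splitSum_eq_single hne fun us hus => if_pos hus]
        simp [hF1]
    rw [compInvAux, hs, h2]
    abel

theorem compInv_eq {F G : List V → V} (h : comp F G = idFamily) (hF : F [] = 0)
    (hF1 : ∀ x, F [x] = x) (hG : G [] = 0) : compInv F = G :=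
  funext fun _ => compInvAux_eq h hF hF1 hG _ le_rfl

end Families

/-! ### Morphisms given by power series in the one-form component. -/

section Series

variable {k : Type*} [Field k] {U : Type*}

/-- The family that is the identity on letters, and multiplies the one-form components of longer
words. -/
def seriesFamily (c : ℕ → k) : List (Whitney k) → Whitney k
  | [] => 0
  | [x] => x
  | x :: y :: w => (0, c (w.length + 2) * ((x :: y :: w).map Prod.snd).prod)

theorem seriesFamily_of_two_le (c : ℕ → k) {w : List (Whitney k)} (hw : 2 ≤ w.length) :
    seriesFamily c w = (0, c w.length * (w.map Prod.snd).prod) := by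
  match w, hw with
  | x :: y :: w, _ => rfl

theorem seriesFamily_snd {c : ℕ → k} (h0 : c 0 = 0) (h1 : c 1 = 1) (w : List (Whitney k)) :
    (seriesFamily c w).2 = c w.length * (w.map Prod.snd).prod := by
  match w with
  | [] => simp [seriesFamily, h0]
  | [x] => simp [seriesFamily, h1]
  | x :: y :: w => rfl

/-- Several blocks only contribute the product of their one-form components. Composition thus
substitutes the one-form component of `G` into the power series with coefficients `c`, and leaves
the function component untouched. -/
theorem comp_seriesFamily {c : ℕ → k} (h0 : c 0 = 0) (h1 : c 1 = 1) {G : List U → Whitney k}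
    (hG : G [] = 0) (w : List U) : comp (seriesFamily c) G w =
      ((G w).1, ∑ r ∈ Finset.range (w.length + 1),
        c r * ((⟨fun w => (G w).2⟩ : Conv U k) ^ r) w) := by
  refine Prod.ext ?_ ?_
  · refine (map_splitSum (AddMonoidHom.fst (k × k) k) _ w).trans ?_
    rcases eq_or_ne w [] with rfl | hw
    · simp [seriesFamily, hG]
    · rw [splitSum_eq_single hw fun us hus => ?_]
      · rfl
      · rw [seriesFamily_of_two_le _ (by simpa using hus)]
        rfl
  · refine (map_splitSum (AddMonoidHom.snd (k × k) k) _ w).trans ?_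
    rw [← Conv.splitSum_prod (by simp [hG]) c le_rfl]
    refine splitSum_congr fun us _ => ?_
    refine (seriesFamily_snd h0 h1 _).trans ?_
    rw [List.length_map, List.map_map]
    rfl

end Series

/-! ### Identification of exp, log and φ with convolution exponentials and logarithms. -/

section ExpLog

variable {k A : Type*} [Field k] [CharZero k] [CommRing A] [Algebra k A] (c : Calculus k A)

/-- The coefficients of the power series `exp x - 1`. -/
def expCoeff (k : Type*) [Field k] : ℕ → k
  | 0 => 0
  | n + 1 => ((n + 1).factorial : k)⁻¹

omit [CharZero k] in
theorem expCoeff_of_ne {n : ℕ} (h : n ≠ 0) : expCoeff k n = (n.factorial : k)⁻¹ := by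
  cases n
  · exact (h rfl).elim
  · rfl

/-- The functional picking the one-form component of words of length one. -/
def letter (k : Type*) [Field k] : Conv (Whitney k) k := ⟨fun w => (idFamily w).2⟩

omit [CharZero k] in
@[simp] theorem letter_nil : letter k [] = 0 := rfl

omit [CharZero k] in
@[simp] theorem letter_singleton (x : Whitney k) : letter k [x] = x.2 := rfl

omit [CharZero k] in
@[simp] theorem letter_cons_cons (x y : Whitney k) (w : List (Whitney k)) :
    letter k (x :: y :: w) = 0 := rfl

omit [CharZero k] in
theorem letter_mul_cons (f : Conv (Whitney k) k) (x : Whitney k) (w : List (Whitney k)) :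
    (letter k * f) (x :: w) = x.2 * f w := by
  rw [Conv.mul_cons, letter_nil, zero_mul, zero_add, cutSum_eq_right, letter_singleton]
  intro a b _ ha
  obtain ⟨y, a, rfl⟩ := List.exists_cons_of_ne_nil ha
  rw [letter_cons_cons, zero_mul]

omit [CharZero k] in
theorem letter_pow (n : ℕ) (w : List (Whitney k)) :
    (letter k ^ n) w = if w.length = n then (w.map Prod.snd).prod else 0 := by
  induction n generalizing w with
  | zero => cases w <;> simp
  | succ n ih =>
    cases w with
    | nil => rw [pow_succ', Conv.mul_nil]; simp
    | cons x w => rw [pow_succ', letter_mul_cons, ih]; simp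

theorem log_letter (w : List (Whitney k)) :
    Conv.log (letter k) w = (seriesFamily (logCoeff k) w).2 := by
  rw [seriesFamily_snd logCoeff_zero logCoeff_one, Conv.log_apply,
    Finset.sum_eq_single w.length, letter_pow, if_pos rfl]
  · intro r _ hr
    rw [letter_pow, if_neg hr.symm, mul_zero]
  · simp

/-- The identity exp(log(1 + x)) = 1 + x, with x the functional `letter`. -/
theorem comp_exp_log :
    comp (seriesFamily (expCoeff k)) (seriesFamily (logCoeff k)) = idFamily := by
  funext w
  have e : (⟨fun w => (seriesFamily (logCoeff k) w).2⟩ : Conv (Whitney k) k) =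
      Conv.log (letter k) := Conv.ext_apply fun w => (log_letter w).symm
  rw [comp_seriesFamily rfl (by simp [expCoeff]) rfl, e]
  refine Prod.ext ?_ ?_
  · match w with
    | [] => rfl
    | [x] => rfl
    | x :: y :: w => rfl
  · have h := Conv.sum_log_pow letter_nil w
    rw [Finset.sum_range_succ', Conv.add_apply] at h
    rw [Finset.sum_range_succ']
    simp only [pow_zero, Nat.factorial_zero, Nat.cast_one, div_one, add_comm ((1 : Conv _ k) w),
      add_left_inj] at h
    simp only [expCoeff, zero_mul, add_zero]
    refine Eq.trans (Finset.sum_congr rfl fun r _ => ?_) h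
    rw [div_eq_inv_mul]

/-- The functional `exp - 1`. -/
noncomputable def expRed (k : Type*) [Field k] : Conv (Whitney k) k :=
  ⟨fun w => (seriesFamily (expCoeff k) w).2⟩

omit [CharZero k] in
theorem expRed_apply (w : List (Whitney k)) :
    expRed k w = expCoeff k w.length * (w.map Prod.snd).prod :=
  seriesFamily_snd rfl (by simp [expCoeff]) w

omit [CharZero k] in
theorem one_add_expRed (w : List (Whitney k)) :
    (1 + expRed k) w = (w.map Prod.snd).prod * (w.length.factorial : k)⁻¹ := by
  cases w with
  | nil => simp [Conv.add_apply, expRed_apply, expCoeff]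
  | cons x w => rw [Conv.add_apply, expRed_apply, Conv.one_cons, expCoeff_of_ne (by simp), zero_add, mul_comm]

/-- The identity (e^x)^m = e^(mx), which on a word of given length is the binomial theorem for (m +
1)^n. -/
theorem one_add_expRed_pow (m : ℕ) (w : List (Whitney k)) :
    ((1 + expRed k) ^ m) w =
      (w.map Prod.snd).prod * (w.length.factorial : k)⁻¹ * (m : k) ^ w.length := by
  induction m generalizing w with
  | zero => cases w <;> simp
  | succ m ih =>
    rw [pow_succ, Conv.mul_apply, cutSum_eq_sum_range, Nat.cast_succ, add_pow, Finset.mul_sum]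
    refine Finset.sum_congr rfl fun i hi => ?_
    have hi' : i ≤ w.length := by simp at hi; omega
    rw [ih, one_add_expRed, List.length_take, List.length_drop, min_eq_left hi',
      Nat.cast_choose k hi']
    have h := List.prod_take_mul_prod_drop (w.map Prod.snd) i
    rw [← List.map_take, ← List.map_drop] at h
    rw [← h]
    have : (w.length.factorial : k) ≠ 0 := by exact_mod_cast w.length.factorial_ne_zero
    field_simp
    simp

open Polynomial in
-- The power polynomial is a monomial in m whose degree is the length of the word, so only words of
-- one letter have a linear coefficient.
theorem log_expRed : Conv.log (expRed k) = letter k := by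
  refine Conv.ext_apply fun w => ?_
  have : Conv.powPoly (expRed k) w =
      C ((w.map Prod.snd).prod * (w.length.factorial : k)⁻¹) * X ^ w.length := by
    refine eq_of_eval_natCast fun m => ?_
    rw [Conv.eval_powPoly rfl, one_add_expRed_pow]
    simp
  refine (congrArg (fun p : k[X] => p.coeff 1) this).trans ?_
  simp only [coeff_C_mul, coeff_X_pow]
  match w with
  | [] => simp
  | [x] => simp
  | x :: y :: w => simp

theorem comp_log_exp :
    comp (seriesFamily (logCoeff k)) (seriesFamily (expCoeff k)) = idFamily := by
  funext w
  rw [comp_seriesFamily logCoeff_zero logCoeff_one rfl]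
  refine Prod.ext ?_ ?_
  · match w with
    | [] => rfl
    | [x] => rfl
    | x :: y :: w => rfl
  · refine (Conv.log_apply (expRed k) w).symm.trans ?_
    rw [log_expRed]
    rfl

/-- A letter that is a function vanishing at both endpoints. -/
def IsNullFunction (x : Forms A) : Prop := c.ev0 x.1 = 0 ∧ c.ev1 x.1 = 0 ∧ x.2 = 0

omit [CharZero k] in
theorem gugenheim_of_two_le {w : List (Forms A)} (hw : 2 ≤ w.length) :
    gugenheim c w = (0, c.holRed (w.map Prod.snd)) := by
  match w, hw with
  | x :: y :: w, _ =>
    rw [gugenheim, c.ev1_iteratedIntegral, c.holRed_of_ne (by simp)]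
    · rfl
    all_goals simp

omit [CharZero k] in
theorem gugenheim_singleton (x : Forms A) : gugenheim c [x] = proj c x := rfl

omit [CharZero k] in
theorem gugenheim_snd (w : List (Forms A)) : (gugenheim c w).2 = c.holRed (w.map Prod.snd) := by
  match w with
  | [] => exact c.holRed_nil.symm
  | [x] =>
    rw [c.holRed_of_ne (by simp), c.hol_apply]
    simp [gugenheim, proj]
  | x :: y :: w => rw [gugenheim_of_two_le c (by simp)]

omit [CharZero k] in
theorem gugenheim_of_isNullFunction {w : List (Forms A)} {x : Forms A} (hx : x ∈ w)
    (h : IsNullFunction c x) : gugenheim c w = 0 := by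
  have h2 : (gugenheim c w).2 = 0 := by
    rw [gugenheim_snd]
    refine c.linearInLetters_holRed.map_of_mem ?_
    rw [← h.2.2]
    exact List.mem_map_of_mem hx
  refine Prod.ext ?_ h2
  match w with
  | [] => rfl
  | [y] =>
    obtain rfl : x = y := by simpa using hx
    exact Prod.ext h.2.1 h.1
  | y :: z :: w => rw [gugenheim_of_two_le c (by simp)]; rfl

/-- The Bernoulli polynomial B_n takes the value B_n at 0 and, for n ≠ 1, also at 1. -/
theorem isNullFunction_muMap {w : List (Whitney k)} (hw : 2 ≤ w.length) :
    IsNullFunction c (muMap c w) := by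
  have hB0 : ((Polynomial.bernoulli w.length).map (algebraMap ℚ k)).eval 0 =
      ((bernoulli w.length : ℚ) : k) := by
    rw [← (algebraMap ℚ k).map_zero, Polynomial.eval_map_algebraMap,
      Polynomial.aeval_algebraMap_apply, Polynomial.coe_aeval_eq_eval,
      Polynomial.bernoulli_eval_zero]
    simp
  have hB1 : ((Polynomial.bernoulli w.length).map (algebraMap ℚ k)).eval 1 =
      ((bernoulli w.length : ℚ) : k) := by
    rw [← (algebraMap ℚ k).map_one, Polynomial.eval_map_algebraMap,
      Polynomial.aeval_algebraMap_apply, Polynomial.coe_aeval_eq_eval,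
      Polynomial.bernoulli_eval_one, ← bernoulli_eq_bernoulli'_of_ne_one (by omega)]
    simp
  match w, hw with
  | x :: y :: w, hw =>
    refine ⟨?_, ?_, rfl⟩
    · rw [muMap]
      · simp only [map_smul, map_sub, AlgHom.commutes, ← Polynomial.aeval_algHom_apply, c.ev0_t,
          Polynomial.coe_aeval_eq_eval, hB0]
        simp
      all_goals simp
    · rw [muMap]
      · simp only [map_smul, map_sub, AlgHom.commutes, ← Polynomial.aeval_algHom_apply, c.ev1_t,
          Polynomial.coe_aeval_eq_eval, hB1]
        simp
      all_goals simp

omit [CharZero k] in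
-- Whitney one-forms have constant coefficients, so their iterated integral is the product of these
-- with the volume 1/n! of the simplex.
theorem gugenheim_map_incl (w : List (Whitney k)) [CharZero k] :
    gugenheim c (w.map (incl c)) = seriesFamily (expCoeff k) w := by
  have h2 : (gugenheim c (w.map (incl c))).2 = (seriesFamily (expCoeff k) w).2 := by
    rcases eq_or_ne w [] with rfl | hw
    · rfl
    have e : (w.map (incl c)).map Prod.snd = (w.map Prod.snd).map (algebraMap k A) := by
      simp [incl]
    rw [gugenheim_snd, c.holRed_of_ne (by simpa), e, c.hol_algebraMap,
      seriesFamily_snd rfl (by simp [expCoeff]), expCoeff_of_ne (by simpa), List.length_map,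
      div_eq_inv_mul]
  refine Prod.ext ?_ h2
  match w with
  | [] => rfl
  | [x] => simp [gugenheim, proj, incl, seriesFamily, c.ev0_t, c.ev1_t]
  | x :: y :: w => rw [gugenheim_of_two_le c (by simp)]; rfl

/-- A block of length at least two is sent by μ to a function vanishing at the endpoints, which λ
kills. Only the decomposition into single letters survives. -/
theorem expMap_eq : expMap c = seriesFamily (expCoeff k) := by
  funext w
  rw [expMap, comp_eq_splitSum, splitSum_eq_singletons, List.map_map, ← gugenheim_map_incl c]
  · rfl
  · intro us _ u hu hl
    exact gugenheim_of_isNullFunction c (List.mem_map_of_mem hu) (isNullFunction_muMap c hl)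

theorem logMap_eq : logMap c = seriesFamily (logCoeff k) := by
  rw [logMap, expMap_eq]
  exact compInv_eq comp_exp_log rfl (fun _ => rfl) rfl

/-- The logarithm of the holonomy functional. -/
noncomputable def logHol : Conv A k := Conv.log c.holRed

/-- Composing with the family log substitutes the holonomy into the series log(1 + x). All later
statements about φ rest on this formula. -/
theorem phi_eq (w : List (Forms A)) :
    phi c w = ((gugenheim c w).1, logHol c (w.map Prod.snd)) := by
  have e : (⟨fun w => (gugenheim c w).2⟩ : Conv (Forms A) k) =
      Conv.pullback Prod.snd c.holRed := Conv.ext_apply fun w => gugenheim_snd c w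
  rw [phi, logMap_eq, comp_seriesFamily logCoeff_zero logCoeff_one rfl, e, logHol, Conv.log_apply,
    List.length_map]
  simp only [Conv.pullback_pow, Conv.pullback_apply]

omit [CharZero k] in
theorem linearInLetters_logHol : LinearInLetters k (logHol c) :=
  Conv.linearInLetters_log c.linearInLetters_holRed

theorem phi_of_two_le {w : List (Forms A)} (hw : 2 ≤ w.length) :
    phi c w = (0, logHol c (w.map Prod.snd)) := by
  rw [phi_eq, gugenheim_of_two_le c hw]

theorem phi_nil : phi c [] = 0 := by
  rw [phi_eq]
  exact Prod.ext rfl Conv.log_nil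

theorem phi_singleton (x : Forms A) : phi c [x] = proj c x := by
  rw [phi_eq, gugenheim_singleton]
  refine Prod.ext rfl ?_
  simp [logHol, Conv.log_apply, Finset.sum_range_succ, logCoeff_zero, logCoeff_one,
    c.holRed_of_ne, c.hol_apply, proj]

theorem phi_snd_of_mem {w : List (Forms A)} {x : Forms A} (hx : x ∈ w) (h : x.2 = 0) :
    (phi c w).2 = 0 := by
  rw [phi_eq]
  refine (linearInLetters_logHol c).map_of_mem ?_
  rw [← h]
  exact List.mem_map_of_mem hx

theorem phi_of_mem {w : List (Forms A)} (hw : 2 ≤ w.length) {x : Forms A} (hx : x ∈ w)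
    (h : x.2 = 0) : phi c w = 0 :=
  Prod.ext (by rw [phi_of_two_le c hw]; rfl) (phi_snd_of_mem c hx h)

theorem phi_of_isNullFunction {w : List (Forms A)} {x : Forms A} (hx : x ∈ w)
    (h : IsNullFunction c x) : phi c w = 0 := by
  refine Prod.ext ?_ (phi_snd_of_mem c hx h.2.2)
  rw [phi_eq, gugenheim_of_isNullFunction c hx h]

theorem logHol_const (w : List (Whitney k)) :
    logHol c (w.map fun x => algebraMap k A x.2) = letter k w := by
  have e : Conv.pullback (fun x : Whitney k => algebraMap k A x.2) c.holRed = expRed k := by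
    refine Conv.ext_apply fun w => ?_
    rw [Conv.pullback_apply]
    refine Eq.trans ?_ (congrArg Prod.snd (gugenheim_map_incl c w))
    rw [gugenheim_snd, List.map_map]
    rfl
  rw [← log_expRed, ← e, logHol, Conv.log_apply, Conv.log_apply, List.length_map]
  simp only [Conv.pullback_pow, Conv.pullback_apply]

/-- On Whitney one-forms the holonomy is exp of the functional `letter`, and its logarithm is
`letter` again. So φ restricts to the identity morphism, with no higher components. -/
theorem phi_map_incl (w : List (Whitney k)) : phi c (w.map (incl c)) = idFamily w := by
  rw [phi_eq, gugenheim_map_incl, List.map_map]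
  refine Prod.ext ?_ (logHol_const c w)
  match w with
  | [] => rfl
  | [x] => rfl
  | x :: y :: w => rfl

end ExpLog

/-! ## Composition with coderivations -/

section Sums

variable {α β M : Type*} [AddCommMonoid M]

theorem tripleSum_map (f : α → β) (g : List β → List β → List β → M) (w : List α) :
    tripleSum g (w.map f) = tripleSum (fun a b c => g (a.map f) (b.map f) (c.map f)) w := by
  simp only [tripleSum, cutSum_map]

theorem splitSum_smul {R : Type*} [Semiring R] [Module R M] (r : R) (h : List (List α) → M)
    (w : List α) : splitSum (fun us => r • h us) w = r • splitSum h w :=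
  (map_splitSum (DistribSMul.toAddMonoidHom M r) h w).symm

theorem splitSum_cutSum_comm (g : List (List α) → List β → List β → M) (u : List α) (v : List β) :
    splitSum (fun us => cutSum (g us) v) u = cutSum (fun c d => splitSum (fun us => g us c d) u) v := by
  induction v generalizing g with
  | nil => rfl
  | cons x v ih => simp only [cutSum_cons, splitSum_add, ih]

theorem splitSum_comm (g : List (List α) → List (List β) → M) (u : List α) (v : List β) :
    splitSum (fun us => splitSum (g us) v) u = splitSum (fun vs => splitSum (fun us => g us vs) u) v := by
  induction u using splitSum_induction generalizing g with
  | nil => simp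
  | cons x u ih =>
    simp only [splitSum_cons, splitSum_cutSum_comm]
    exact cutSum_congr fun a b e => ih a b e _

theorem splitSum_tripleSum (h : List (List α) → List (List α) → List (List α) → M) (w : List α) :
    splitSum (fun us => tripleSum h us) w = tripleSum (fun a b c =>
      splitSum (fun A => splitSum (fun C => splitSum (fun B => h A B C) b) c) a) w := by
  simp only [tripleSum, splitSum_cutSum, splitSum_cutSum_comm]
  refine cutSum_congr fun a bc _ => cutSum_congr fun b c _ => ?_
  exact splitSum_congr fun A _ => splitSum_comm _ _ _

/-- The sum over all ways to write a word as a concatenation of five words. -/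
def quintSum (g : List α → List α → List α → List α → List α → M) (w : List α) : M :=
  cutSum (fun a r => cutSum (fun b r => cutSum (fun c r => cutSum (fun d e => g a b c d e) r) r) r) w

variable (g : List α → List α → List α → List α → List α → M) (w : List α)

/-- This and the next three bring the possible relative positions of two successive windows, nested
or disjoint, to a common form in which they can be compared. -/
theorem tripleSum_middle :
    tripleSum (fun a b c => tripleSum (fun b₁ b₂ b₃ => g a b₁ b₂ b₃ c) b) w = quintSum g w := by
  refine cutSum_congr fun a bc _ => ?_
  refine (cutSum_assoc (fun b₁ b₂₃ c => cutSum (fun b₂ b₃ => g a b₁ b₂ b₃ c) b₂₃) bc).symm.trans ?_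
  refine cutSum_congr fun b₁ r _ => ?_
  exact (cutSum_assoc (fun b₂ b₃ c => g a b₁ b₂ b₃ c) r).symm

theorem tripleSum_outer :
    tripleSum (fun a b c => cutSum (fun a₁ a₂ => cutSum (fun c₁ c₂ => g a₁ a₂ b c₁ c₂) c) a) w =
      quintSum g w := by
  refine (cutSum_congr fun a bc _ => cutSum_comm (fun b c a₁ a₂ =>
    cutSum (fun c₁ c₂ => g a₁ a₂ b c₁ c₂) c) bc a).trans ?_
  exact (cutSum_assoc (fun a₁ a₂ bc => cutSum (fun b c =>
    cutSum (fun c₁ c₂ => g a₁ a₂ b c₁ c₂) c) bc) w).symm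

theorem tripleSum_left :
    tripleSum (fun a b c => tripleSum (fun a₁ a₂ a₃ => g a₁ a₂ a₃ b c) a) w = quintSum g w := by
  refine (cutSum_congr fun a bc _ => ?_ : _ = cutSum (fun a bc => cutSum (fun a₁ a₂₃ =>
    cutSum (fun a₂ a₃ => cutSum (fun b c => g a₁ a₂ a₃ b c) bc) a₂₃) a) w).trans ?_
  · refine (cutSum_comm (fun b c a₁ a₂₃ => cutSum (fun a₂ a₃ => g a₁ a₂ a₃ b c) a₂₃) bc a).trans ?_
    exact cutSum_congr fun a₁ a₂₃ _ => cutSum_comm (fun b c a₂ a₃ => g a₁ a₂ a₃ b c) bc a₂₃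
  · refine (cutSum_assoc (fun a₁ a₂₃ bc =>
      cutSum (fun a₂ a₃ => cutSum (fun b c => g a₁ a₂ a₃ b c) bc) a₂₃) w).symm.trans ?_
    refine cutSum_congr fun a₁ r _ => ?_
    exact (cutSum_assoc (fun a₂ a₃ bc => cutSum (fun b c => g a₁ a₂ a₃ b c) bc) r).symm

theorem tripleSum_right :
    tripleSum (fun a b c => tripleSum (fun c₁ c₂ c₃ => g a b c₁ c₂ c₃) c) w = quintSum g w := rfl

end Sums

/-! ### Morphisms and squares of coderivations in terms of Taylor coefficients. -/

section Structures

variable {k : Type*} [Field k]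
variable {V₀ V₁ W₀ W₁ X₀ X₁ : Type*} [AddCommGroup V₀] [Module k V₀] [AddCommGroup V₁] [Module k V₁]
  [AddCommGroup W₀] [Module k W₀] [AddCommGroup W₁] [Module k W₁]
  [AddCommGroup X₀] [Module k X₀] [AddCommGroup X₁] [Module k X₁]

omit [Module k V₀] [Module k V₁] in
theorem sgn_sgn (x : V₀ × V₁) : sgn (sgn x) = x := by simp [sgn]

theorem map_sgn_map_sgn (w : List (V₀ × V₁)) : (w.map sgn).map sgn = w := by
  rw [List.map_map]
  exact (List.map_congr_left fun x _ => sgn_sgn x).trans (List.map_id w)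

theorem compCoder_eq {F : List (V₀ × V₁) → W₀ × W₁} {Q : List (V₀ × V₁) → V₀ × V₁}
    (hF : LinearInLetters k F) (hQ : Q [] = 0) (w : List (V₀ × V₁)) :
    compCoder F Q w = tripleSum (fun a b c => F (a.map sgn ++ Q b :: c)) w :=
  sum_windows (fun a b c => F (a.map sgn ++ Q b :: c)) (fun a c => by rw [hQ, hF.map_zero]) w

theorem LinearInLetters.comp {U V W : Type*} [AddCommGroup U] [Module k U] [AddCommGroup V]
    [Module k V] [AddCommGroup W] [Module k W] {F : List V → W} {G : List U → V}
    (hF : LinearInLetters k F) (hG : LinearInLetters k G) :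
    LinearInLetters k (AInf.comp F G) := fun u v x y r => by
  simp only [comp_eq_splitSum, splitSum_append_cons, List.map_append, List.map_cons,
    hG _ _ x y r, hF _ _ _ _ r, splitSum_add, cutSum_add, splitSum_smul, cutSum_smul]

theorem LinearInLetters.compCoder {F : List (V₀ × V₁) → W₀ × W₁}
    {Q : List (V₀ × V₁) → V₀ × V₁} (hF : LinearInLetters k F) (hQ0 : Q [] = 0)
    (hQ : LinearInLetters k Q) : LinearInLetters k (AInf.compCoder F Q) := fun u v x y r => by
  have h1 : ∀ a z b (x : V₀ × V₁) d, F (a ++ z :: (b ++ x :: d)) = F ((a ++ z :: b) ++ x :: d) := by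
    intro a z b x d; simp
  have h2 : sgn (x + r • y) = sgn x + r • sgn y := by
    simp [sgn, add_comm]
  have h3 : ∀ a (x : V₀ × V₁) b z d, F ((a ++ x :: b) ++ z :: d) = F (a ++ x :: (b ++ z :: d)) := by
    intro a x b z d; simp
  simp only [compCoder_eq hF hQ0, tripleSum_append_cons]
  rw [smul_add, smul_add]
  have e1 : ∀ x, tripleSum (fun a b c => F (a.map sgn ++ Q b :: (c ++ x :: v))) u =
      tripleSum (fun a b c => F ((a.map sgn ++ Q b :: c) ++ x :: v)) u := by
    intro x; simp only [h1]
  have e3 : ∀ x, tripleSum (fun a b c => F ((u ++ x :: a).map sgn ++ Q b :: c)) v =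
      tripleSum (fun a b c => F (u.map sgn ++ sgn x :: (a.map sgn ++ Q b :: c))) v := by
    intro x; simp only [List.map_append, List.map_cons, h3]
  have a1 : ∀ (g : List (V₀ × V₁) → List (V₀ × V₁) → List (V₀ × V₁) → W₀ × W₁) w,
      r • tripleSum g w = tripleSum (fun a b c => r • g a b c) w := fun g w =>
    map_tripleSum (DistribSMul.toAddMonoidHom (W₀ × W₁) r) g w
  simp only [e1, e3, a1, h2, hQ _ _ x y r, hF _ _ _ _ r, tripleSum_add, cutSum_add, cutSum_smul]
  abel

/-- Families that are linear in every letter are determined by their values on words whose letters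
are homogeneous. -/
theorem LinearInLetters.ext {F G : List (V₀ × V₁) → W₀ × W₁} (hF : LinearInLetters k F)
    (hG : LinearInLetters k G)
    (h : ∀ w, (∀ x ∈ w, x.1 = 0 ∨ x.2 = 0) → F w = G w) : F = G := by
  suffices ∀ v u : List (V₀ × V₁), (∀ x ∈ u, x.1 = 0 ∨ x.2 = 0) → F (u ++ v) = G (u ++ v) from
    funext fun w => this w [] (by simp)
  intro v
  induction v with
  | nil => intro u hu; rw [List.append_nil]; exact h u hu
  | cons x v ih =>
    intro u hu
    have e : ∀ z : V₀ × V₁, u ++ z :: v = (u ++ [z]) ++ v := by simp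
    have hz : ∀ z : V₀ × V₁, z.1 = 0 ∨ z.2 = 0 → F (u ++ z :: v) = G (u ++ z :: v) := by
      intro z hz
      rw [e]
      refine ih _ fun y hy => ?_
      rcases List.mem_append.1 hy with hy | hy
      · exact hu y hy
      · rw [List.mem_singleton.1 hy]; exact hz
    have hx : x = (x.1, 0) + (0, x.2) := by simp
    rw [hx, hF.map_add, hG.map_add, hz _ (Or.inr rfl), hz _ (Or.inl rfl)]

/-- Substitution of a letter, as an additive map. -/
def LinearInLetters.letterHom {V W : Type*} [AddCommGroup V] [Module k V] [AddCommGroup W]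
    [Module k W] {F : List V → W} (hF : LinearInLetters k F) (u v : List V) : V →+ W where
  toFun x := F (u ++ x :: v)
  map_zero' := hF.map_zero u v
  map_add' x y := hF.map_add u v x y

/-- If `φ` intertwines `Q` and `R`, then `F ∘ R̂ ∘ φ̂ = F ∘ φ̂ ∘ Q̂`. -/
theorem comp_compCoder {F : List (W₀ × W₁) → X₀ × X₁} {R : List (W₀ × W₁) → W₀ × W₁}
    {Q : List (V₀ × V₁) → V₀ × V₁} {φ : List (V₀ × V₁) → W₀ × W₁} (hF : LinearInLetters k F)
    (hR : R [] = 0) (hQ : Q [] = 0) (hφ : LinearInLetters k φ)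
    (hsgn : ∀ w, sgn (φ w) = φ (w.map sgn)) (h : comp R φ = compCoder φ Q) :
    comp (compCoder F R) φ = compCoder (comp F φ) Q := by
  funext w
  rw [compCoder_eq (hF.comp hφ) hQ, comp_eq_splitSum]
  simp only [compCoder_eq hF hR, tripleSum_map]
  rw [splitSum_tripleSum]
  -- By `h`, applying R to a stretch of consecutive φ-blocks and summing over its decompositions
  -- equals φ of that stretch with Q inserted.
  have e1 : ∀ a b c, splitSum (fun A => splitSum (fun C => splitSum (fun B =>
        F ((A.map φ).map sgn ++ R (B.map φ) :: C.map φ)) b) c) a =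
      tripleSum (fun b₁ b₂ b₃ => splitSum (fun A => splitSum (fun C =>
        F ((A.map φ).map sgn ++ φ (b₁.map sgn ++ Q b₂ :: b₃) :: C.map φ)) c) a) b := by
    intro a b c
    have : ∀ A C : List (List (V₀ × V₁)), splitSum (fun B => F ((A.map φ).map sgn ++ R (B.map φ) :: C.map φ)) b =
        tripleSum (fun b₁ b₂ b₃ =>
          F ((A.map φ).map sgn ++ φ (b₁.map sgn ++ Q b₂ :: b₃) :: C.map φ)) b := by
      intro A C
      refine (map_splitSum (hF.letterHom ((A.map φ).map sgn) (C.map φ))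
        (fun B => R (B.map φ)) b).symm.trans ?_
      rw [← comp_eq_splitSum, h, compCoder_eq hφ hQ]
      exact map_tripleSum _ _ _
    simp only [this]
    simp only [tripleSum, splitSum_cutSum_comm]
  -- On the other side, decompositions are sorted by the block that contains the inserted letter.
  have e2 : ∀ w₁ w₂ w₃, comp F φ (w₁.map sgn ++ Q w₂ :: w₃) =
      cutSum (fun a b₁ => cutSum (fun b₃ c => splitSum (fun A => splitSum (fun C =>
        F ((A.map φ).map sgn ++ φ (b₁.map sgn ++ Q w₂ :: b₃) :: C.map φ)) c) a) w₃) w₁ := by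
    intro w₁ w₂ w₃
    rw [comp_eq_splitSum, splitSum_append_cons, cutSum_map]
    refine cutSum_congr fun a b _ => ?_
    rw [splitSum_map, ← splitSum_cutSum_comm]
    refine splitSum_congr fun A _ => cutSum_congr fun c d _ => splitSum_congr fun C _ => ?_
    have : (A.map (List.map sgn)).map φ = (A.map φ).map sgn := by
      simp only [List.map_map]
      exact List.map_congr_left fun u _ => (hsgn u).symm
    rw [List.map_append, this, List.map_cons]
  simp only [e1, e2]
  rw [tripleSum_middle, tripleSum_outer (fun a b₁ b₂ b₃ c => splitSum (fun A => splitSum (fun C =>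
        F ((A.map φ).map sgn ++ φ (b₁.map sgn ++ Q b₂ :: b₃) :: C.map φ)) c) a)]

/-- The square of an odd coderivation is a coderivation. -/
theorem compCoder_compCoder {F : List (V₀ × V₁) → W₀ × W₁} {Q : List (V₀ × V₁) → V₀ × V₁}
    (hF : LinearInLetters k F) (hQ0 : Q [] = 0) (hQ : LinearInLetters k Q)
    (hsgn : ∀ w, sgn (Q w) = -Q (w.map sgn)) (h : ∀ w, compCoder Q Q w = 0) (w : List (V₀ × V₁)) :
    compCoder (compCoder F Q) Q w = 0 := by
  rw [compCoder_eq (hF.compCoder hQ0 hQ) hQ0]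
  simp only [compCoder_eq hF hQ0, tripleSum_append_cons, tripleSum_add]
  simp only [tripleSum_map, cutSum_map, map_sgn_map_sgn, List.map_append, List.map_cons, hsgn]
  -- Nested insertions assemble into the coderivation square of Q, which is zero. Of the disjoint
  -- ones, each pair of windows occurs in both orders, with opposite signs because Q is odd.
  have e1 : tripleSum (fun a b c => cutSum (fun a₁ a₂ => cutSum (fun c₁ c₂ =>
      F (a₁ ++ Q (a₂.map sgn ++ Q b :: c₁) :: c₂)) c) a) w = 0 := by
    rw [tripleSum_outer (fun a₁ a₂ b c₁ c₂ => F (a₁ ++ Q (a₂.map sgn ++ Q b :: c₁) :: c₂)),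
      ← tripleSum_middle]
    refine tripleSum_eq_zero fun a b c _ => ?_
    refine (map_tripleSum (hF.letterHom a c) (fun b₁ b₂ b₃ => Q (b₁.map sgn ++ Q b₂ :: b₃)) b).symm.trans ?_
    rw [← compCoder_eq hQ hQ0, h, map_zero]
  rw [e1, add_zero, tripleSum_left (fun a₁ a₂ a₃ b c =>
      F (a₁ ++ Q (a₂.map sgn) :: (a₃.map sgn ++ Q b :: c))),
    tripleSum_right (fun a b c₁ c₂ c₃ => F (a ++ -Q (b.map sgn) :: c₁.map sgn ++ Q c₂ :: c₃))]
  simp only [List.append_assoc, List.cons_append, hF.map_neg, quintSum, cutSum_neg, add_neg_cancel]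

end Structures

/-! ## The dg algebra of forms -/

section FormsStr

variable {k A : Type*} [Field k] [CommRing A] [Algebra k A] (c : Calculus k A)

@[simp] theorem formsStr_nil : formsStr c [] = 0 := rfl

@[simp] theorem formsStr_singleton (x : Forms A) : formsStr c [x] = (0, -c.D x.1) := by
  simp [formsStr, ofDGAlgebra]

@[simp] theorem formsStr_pair (x y : Forms A) :
    formsStr c [x, y] = (x.1 * y.1, x.1 * y.2 - x.2 * y.1) := by
  simp [formsStr, ofDGAlgebra, sub_eq_add_neg]

@[simp] theorem formsStr_cons₃ (x y z : Forms A) (w : List (Forms A)) :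
    formsStr c (x :: y :: z :: w) = 0 := rfl

theorem formsStr_of_three_le {w : List (Forms A)} (hw : 3 ≤ w.length) : formsStr c w = 0 := by
  match w, hw with
  | x :: y :: z :: w, _ => rfl

theorem linearInLetters_formsStr : LinearInLetters k (formsStr c) := by
  intro u v x y r
  by_cases h : 3 ≤ u.length + 1 + v.length
  · rw [formsStr_of_three_le, formsStr_of_three_le, formsStr_of_three_le, smul_zero, add_zero] <;>
      simp <;> omega
  · match u, v with
    | [], [] => simp; ring
    | [], [z] => simp [add_mul, smul_sub]; ring
    | [z], [] => simp [mul_add, smul_sub]; ring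
    | [], _ :: _ :: _ => simp at h; omega
    | _ :: _ :: _, _ => simp at h; omega
    | [_], _ :: _ => simp at h; omega

theorem hasDegree_formsStr : HasDegree 1 (formsStr c) := by
  intro ds w h
  match w, ds, h with
  | [], _, _ => simp [IsHomog]
  | [x], [d], h =>
    simp only [List.forall₂_cons, IsHomog] at h
    refine ⟨fun _ => by simp, fun hd => ?_⟩
    have := h.1.1 (by simp at hd; omega)
    simp [this]
  | [x, y], [d, e], h =>
    simp only [List.forall₂_cons, IsHomog] at h
    obtain ⟨⟨h1, h2⟩, ⟨h3, h4⟩, _⟩ := h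
    simp only [formsStr_pair, List.sum_cons, List.sum_nil]
    refine ⟨fun hd => ?_, fun hd => ?_⟩
    · by_cases hx : d = -1
      · rw [h3 (by omega), mul_zero]
      · rw [h1 hx, zero_mul]
    · have e1 : x.1 * y.2 = 0 := by
        by_cases hx : d = -1
        · rw [h4 (by omega), mul_zero]
        · rw [h1 hx, zero_mul]
      have e2 : x.2 * y.1 = 0 := by
        by_cases hx : d = 0
        · rw [h3 (by omega), mul_zero]
        · rw [h2 hx, zero_mul]
      simp only [e1, e2, sub_zero]
  | x :: y :: z :: w, _, _ => simp [IsHomog]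

/-- Length two is the Leibniz rule and length three is associativity; longer words always involve a
vanishing operation of arity at least three. -/
theorem compCoder_formsStr (w : List (Forms A)) :
    compCoder (formsStr c) (formsStr c) w = 0 := by
  rw [compCoder_eq (linearInLetters_formsStr c) rfl]
  match w with
  | [] => simp [tripleSum]
  | [x] => simp [tripleSum, cutSum_cons]
  | [x, y] =>
    simp [tripleSum, cutSum_cons, sgn, c.leibniz]
    ring
  | [x, y, z] =>
    simp [tripleSum, cutSum_cons, sgn]
    ring_nf
    simp
  | x :: y :: z :: t :: w =>
    refine tripleSum_eq_zero fun a b d e => ?_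
    by_cases hb : 3 ≤ b.length
    · rw [formsStr_of_three_le c hb, (linearInLetters_formsStr c).map_zero]
    · refine formsStr_of_three_le c ?_
      have := congrArg List.length e
      simp at this ⊢
      omega

/-- Graded commutativity of the product, since beyond two letters the structure is zero. -/
theorem vanishesOnShuffles_formsStr : VanishesOnShuffles (formsStr c) := by
  intro u v hu hv hhu hhv
  match u, v with
  | [x], [y] =>
    have hx := hhu x (by simp)
    have hy := hhv y (by simp)
    simp only [IsHomog] at hx hy
    simp [shuffle]
    by_cases h1 : x.1 = -1
    · have hx2 := hx.2 (by omega)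
      by_cases h2 : y.1 = -1
      · have hy2 := hy.2 (by omega)
        simp [h1, h2, hx2, hy2, mul_comm]
      · have hy1 := hy.1 h2
        by_cases h3 : y.1 = 0
        · simp [h3, hx2, hy1, mul_comm]
        · refine Prod.ext ?_ ?_ <;> simp [hy1, hy.2 h3]
    · have hx1 := hx.1 h1
      by_cases h3 : x.1 = 0
      · by_cases h2 : y.1 = -1
        · have hy2 := hy.2 (by omega)
          simp [h3, hx1, hy2, mul_comm]
        · refine Prod.ext ?_ ?_ <;> simp [hx1, hy.1 h2]
      · refine Prod.ext ?_ ?_ <;> simp [hx1, hx.2 h3]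
  | x :: x' :: u, y :: v =>
    refine List.sum_eq_zero fun m hm => ?_
    obtain ⟨p, hp, rfl⟩ := List.mem_map.1 hm
    have := (perm_of_mem_shuffle hp).length_eq
    rw [formsStr_of_three_le, smul_zero]
    simp [this]
    omega
  | [x], y :: y' :: v =>
    refine List.sum_eq_zero fun m hm => ?_
    obtain ⟨p, hp, rfl⟩ := List.mem_map.1 hm
    have := (perm_of_mem_shuffle hp).length_eq
    rw [formsStr_of_three_le, smul_zero]
    simp [this]

theorem isCInfAlgebra_formsStr : IsCInfAlgebra k (formsStr c) :=
  ⟨⟨⟨rfl, linearInLetters_formsStr c⟩, hasDegree_formsStr c, compCoder_formsStr c⟩,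
    vanishesOnShuffles_formsStr c⟩

theorem sgn_formsStr (w : List (Forms A)) :
    sgn (formsStr c w) = -formsStr c (w.map sgn) := by
  match w with
  | [] => simp [sgn]
  | [x] => simp [sgn]
  | [x, y] => simp [sgn]; ring
  | x :: y :: z :: w => simp [sgn]

end FormsStr

/-! ## The structure on Whitney forms -/

section WhitneyStr

variable {k : Type*} [Field k]

theorem oneFunction_nil (coeff : ℕ → k) : oneFunction coeff [] = 0 := by
  simp [oneFunction]

theorem oneFunction_cons (coeff : ℕ → k) (x : Whitney k) (w : List (Whitney k)) :
    oneFunction coeff (x :: w) = coeff 0 * ((x.1.1 - x.1.2) * (w.map Prod.snd).prod) +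
      x.2 * oneFunction (fun i => coeff (i + 1)) w := by
  have e : ∀ (w : List (Whitney k)) (i : Fin w.length),
      ∏ j ∈ Finset.univ.erase i, w[j].2 = ∏ j : Fin w.length, if j ≠ i then w[j].2 else 1 := by
    intro w i
    rw [← Finset.prod_filter, Finset.filter_ne']
  simp only [oneFunction, e]
  refine (Fin.sum_univ_succ (n := w.length) _).trans ?_
  congr 1
  · congr 2
    refine (Fin.prod_univ_succ (n := w.length) _).trans ?_
    simp only [ne_eq, not_true_eq_false, if_false, one_mul]
    rw [← List.prod_ofFn]
    congr 1
    refine List.ext_getElem (by simp) fun i h1 h2 => ?_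
    simp
  · rw [Finset.mul_sum]
    refine Finset.sum_congr rfl fun i _ => ?_
    refine (congrArg (fun p => coeff (i.succ : Fin (w.length + 1)) *
      (((x :: w)[i.succ].1.1 - (x :: w)[i.succ].1.2) * p))
      (Fin.prod_univ_succ (n := w.length) _)).trans ?_
    simp [Fin.succ_inj, (Fin.succ_ne_zero i).symm]
    ring

theorem linearInLetters_prod : LinearInLetters k fun w : List (Whitney k) => (w.map Prod.snd).prod := by
  intro u v x y r
  simp
  ring

theorem linearInLetters_oneFunction (coeff : ℕ → k) : LinearInLetters k (oneFunction coeff) := by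
  intro u v x y r
  induction u generalizing coeff with
  | nil => simp [oneFunction_cons]; ring
  | cons z u ih =>
    have := linearInLetters_prod u v x y r
    simp only [List.cons_append, oneFunction_cons, ih, this, smul_eq_mul]
    ring

theorem oneFunction_eq_zero (coeff : ℕ → k) {w : List (Whitney k)} (h : ∀ x ∈ w, x.1 = 0) :
    oneFunction coeff w = 0 := by
  induction w generalizing coeff with
  | nil => exact oneFunction_nil _
  | cons x w ih =>
    rw [oneFunction_cons, ih _ fun y hy => h y (by simp [hy]), h x (by simp)]
    simp

theorem oneFunction_middle (coeff : ℕ → k) {u v : List (Whitney k)} {z : Whitney k}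
    (hu : ∀ x ∈ u, x.1 = 0) (hv : ∀ x ∈ v, x.1 = 0) :
    oneFunction coeff (u ++ z :: v) = coeff u.length * (z.1.1 - z.1.2) *
      ((u.map Prod.snd).prod * (v.map Prod.snd).prod) := by
  induction u generalizing coeff with
  | nil => simp [oneFunction_cons, oneFunction_eq_zero _ hv]; ring
  | cons x u ih =>
    rw [List.cons_append, oneFunction_cons, ih _ fun y hy => hu y (by simp [hy]), hu x (by simp)]
    simp
    ring

variable {V₀ V₁ : Type*} [AddCommGroup V₁]

open Classical in
/-- The number of letters without one-form component. -/
noncomputable def functionCount (w : List (V₀ × V₁)) : ℕ := w.countP fun x => x.2 = 0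

@[simp] theorem functionCount_nil : functionCount ([] : List (V₀ × V₁)) = 0 := rfl

theorem functionCount_cons_of_eq {x : V₀ × V₁} (w : List (V₀ × V₁)) (h : x.2 = 0) :
    functionCount (x :: w) = functionCount w + 1 := by
  simp [functionCount, h]

theorem functionCount_cons_of_ne {x : V₀ × V₁} (w : List (V₀ × V₁)) (h : x.2 ≠ 0) :
    functionCount (x :: w) = functionCount w := by
  simp [functionCount, h]

theorem functionCount_append (u v : List (V₀ × V₁)) :
    functionCount (u ++ v) = functionCount u + functionCount v := by
  simp [functionCount]

theorem functionCount_perm {u v : List (V₀ × V₁)} (h : u.Perm v) :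
    functionCount u = functionCount v := h.countP_eq _

theorem functionCount_pos {w : List (V₀ × V₁)} : 0 < functionCount w ↔ ∃ x ∈ w, x.2 = 0 := by
  simp [functionCount, List.countP_pos_iff]

theorem functionCount_le_length (w : List (V₀ × V₁)) : functionCount w ≤ w.length :=
  List.countP_le_length

theorem prod_eq_zero_of_functionCount {w : List (Whitney k)} (h : 0 < functionCount w) :
    (w.map Prod.snd).prod = 0 := by
  obtain ⟨x, hx, h0⟩ := functionCount_pos.1 h
  exact List.prod_eq_zero (h0 ▸ List.mem_map_of_mem hx)

theorem oneFunction_of_functionCount (coeff : ℕ → k) {w : List (Whitney k)}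
    (h : 2 ≤ functionCount w) : oneFunction coeff w = 0 := by
  induction w generalizing coeff with
  | nil => exact oneFunction_nil _
  | cons x w ih =>
    rw [oneFunction_cons]
    by_cases hx : x.2 = 0
    · rw [functionCount_cons_of_eq _ hx] at h
      rw [hx, prod_eq_zero_of_functionCount (by omega)]
      ring
    · rw [functionCount_cons_of_ne _ hx] at h
      rw [ih _ h, prod_eq_zero_of_functionCount (by omega)]
      ring

variable [CharZero k]

/-- The coefficients of `m_{n+1}`. -/
noncomputable def whitneyCoeff (k : Type*) [Field k] [CharZero k] (n i : ℕ) : k :=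
  (-1) ^ (i + 1) * (n.choose i : k) * (((bernoulli n : ℚ) : k) / (n.factorial : k))

theorem whitneyStr_cons₃ (x y z : Whitney k) (w : List (Whitney k)) :
    whitneyStr k (x :: y :: z :: w) =
      (0, oneFunction (whitneyCoeff k (w.length + 2)) (x :: y :: z :: w)) := rfl

theorem whitneyStr_of_three_le {w : List (Whitney k)} (hw : 3 ≤ w.length) :
    whitneyStr k w = (0, oneFunction (whitneyCoeff k (w.length - 1)) w) := by
  match w, hw with
  | x :: y :: z :: w, _ => rfl

theorem linearInLetters_whitneyStr : LinearInLetters k (whitneyStr k) := by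
  intro u v x y r
  by_cases h : 3 ≤ u.length + 1 + v.length
  · have e : ∀ x : Whitney k, (u ++ x :: v).length - 1 = u.length + v.length := by simp
    rw [whitneyStr_of_three_le, whitneyStr_of_three_le, whitneyStr_of_three_le,
      e, e, e, linearInLetters_oneFunction]
    · simp
    all_goals simp; omega
  · match u, v with
    | [], [] => simp [whitneyStr]; ring
    | [], [z] =>
      simp [whitneyStr, add_mul]
      refine ⟨⟨by ring, by ring⟩, by ring⟩
    | [z], [] =>
      simp [whitneyStr, mul_add]
      refine ⟨⟨by ring, by ring⟩, by ring⟩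
    | [], _ :: _ :: _ => simp at h; omega
    | _ :: _ :: _, _ => simp at h; omega
    | [_], _ :: _ => simp at h; omega

theorem oneFunction_eq_zero_of_isHomog (coeff : ℕ → k) {ds : List ℤ} {w : List (Whitney k)}
    (h : List.Forall₂ IsHomog ds w) (hd : ds.sum ≠ -1) : oneFunction coeff w = 0 := by
  induction h generalizing coeff with
  | nil => exact oneFunction_nil _
  | @cons d x ds w hx hw ih =>
    rw [oneFunction_cons]
    have hp : ds.sum ≠ 0 → (w.map Prod.snd).prod = 0 := by
      clear ih hd
      induction hw with
      | nil => simp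
      | @cons e y ds w hy hw ih =>
        intro h
        rw [List.map_cons, List.prod_cons]
        by_cases he : e = 0
        · rw [ih (by simpa [he] using h), mul_zero]
        · rw [hy.2 he, zero_mul]
    rw [List.sum_cons] at hd
    have e1 : x.2 * oneFunction (fun i => coeff (i + 1)) w = 0 := by
      by_cases he : d = 0
      · rw [ih _ (by omega), mul_zero]
      · rw [hx.2 he, zero_mul]
    have e2 : (x.1.1 - x.1.2) * (w.map Prod.snd).prod = 0 := by
      by_cases he : d = -1
      · rw [hp (by omega), mul_zero]
      · rw [hx.1 he]; simp
    rw [e1, e2]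
    simp

theorem hasDegree_whitneyStr : HasDegree 1 (whitneyStr k) := by
  intro ds w h
  match w, ds, h with
  | [], _, _ => exact ⟨fun _ => rfl, fun _ => rfl⟩
  | [x], [d], h =>
    simp only [List.forall₂_cons, IsHomog] at h
    refine ⟨fun _ => rfl, fun hd => ?_⟩
    have := h.1.1 (by simp at hd; omega)
    simp [whitneyStr, this]
  | [x, y], [d, e], h =>
    simp only [List.forall₂_cons, IsHomog] at h
    obtain ⟨⟨h1, h2⟩, ⟨h3, h4⟩, _⟩ := h
    simp only [whitneyStr, List.sum_cons, List.sum_nil]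
    refine ⟨fun hd => ?_, fun hd => ?_⟩
    · by_cases hx : d = -1
      · rw [h3 (by omega)]; simp
      · rw [h1 hx]; simp
    · have e1 : (x.1.1 + x.1.2) / 2 * y.2 = 0 := by
        by_cases hx : d = -1
        · rw [h4 (by omega), mul_zero]
        · rw [h1 hx]; simp
      have e2 : x.2 * ((y.1.1 + y.1.2) / 2) = 0 := by
        by_cases hx : d = 0
        · rw [h3 (by omega)]; simp
        · rw [h2 hx, zero_mul]
      simp only [e1, e2, sub_zero]
  | x :: y :: z :: w, ds, h =>
    rw [whitneyStr_cons₃]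
    refine ⟨fun _ => rfl, fun hd => ?_⟩
    exact oneFunction_eq_zero_of_isHomog _ h (by omega)

theorem whitneyStr_snd_of_functionCount {w : List (Whitney k)} (h : 2 ≤ functionCount w) :
    (whitneyStr k w).2 = 0 := by
  match w with
  | [] => rfl
  | [x] => have := functionCount_le_length [x]; simp at this; omega
  | [x, y] =>
    have h1 : x.2 = 0 := by
      by_contra hx
      rw [functionCount_cons_of_ne _ hx] at h
      have := functionCount_le_length [y]; simp at this; omega
    have h2 : y.2 = 0 := by
      by_contra hy
      rw [functionCount_cons_of_eq _ h1, functionCount_cons_of_ne _ hy] at h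
      simp at h
    simp [whitneyStr, h1, h2]
  | x :: y :: z :: w =>
    rw [whitneyStr_cons₃]
    exact oneFunction_of_functionCount _ h

theorem whitneyStr_snd_of_oneForms {w : List (Whitney k)} (h : ∀ x ∈ w, x.1 = 0) :
    (whitneyStr k w).2 = 0 := by
  match w with
  | [] => rfl
  | [x] => simp [whitneyStr, h x]
  | [x, y] => simp [whitneyStr, h x, h y]
  | x :: y :: z :: w =>
    rw [whitneyStr_cons₃]
    exact oneFunction_eq_zero _ h

/-- The values of the structure on words with precisely one function. -/
theorem whitneyStr_snd_middle {u v : List (Whitney k)} {z : Whitney k}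
    (hu : ∀ x ∈ u, x.1 = 0) (hv : ∀ x ∈ v, x.1 = 0) (hz : z.2 = 0) :
    (whitneyStr k (u ++ z :: v)).2 =
      (-((z.1.1 - z.1.2) * ((-1) ^ u.length * ((bernoulli (u.length + v.length) : ℚ) : k) /
        (u.length.factorial * v.length.factorial))) +
      z.1.2 * ((if u.length = 0 ∧ v.length = 1 then 1 else 0) -
        (if u.length = 1 ∧ v.length = 0 then 1 else 0))) *
      ((u.map Prod.snd).prod * (v.map Prod.snd).prod) := by
  by_cases h : 3 ≤ u.length + 1 + v.length
  · rw [whitneyStr_of_three_le (by simp; omega)]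
    simp only
    rw [oneFunction_middle _ hu hv, if_neg (by omega), if_neg (by omega), List.length_append,
      List.length_cons, ← add_assoc, Nat.add_sub_cancel, whitneyCoeff,
      Nat.cast_choose k (Nat.le_add_right _ _), Nat.add_sub_cancel_left]
    have h1 : ((u.length + v.length).factorial : k) ≠ 0 := by
      exact_mod_cast (u.length + v.length).factorial_ne_zero
    field_simp
    ring
  -- In lengths one and two, B_0 = 1 and B_1 = -1/2 reproduce m_1 and m_2. The function z is z(0)·1
  -- + (z(1) - z(0))t, and the unit contributes only to m_2, whence the two indicator terms.
  · match u, v with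
    | [], [] => simp [whitneyStr]
    | [], [y] =>
      simp [whitneyStr, hz]
      left
      ring
    | [y], [] =>
      simp [whitneyStr, hz]
      ring
    | [], _ :: _ :: _ => simp at h; omega
    | _ :: _ :: _, _ => simp at h; omega
    | [_], _ :: _ => simp at h; omega

end WhitneyStr

/-! ## Vanishing on shuffles -/

section WhitneyShuffles

variable {k : Type*} [Field k]

theorem oneFunction_concat (coeff : ℕ → k) (w : List (Whitney k)) (y : Whitney k) :
    oneFunction coeff (w ++ [y]) = oneFunction coeff w * y.2 +
      coeff w.length * ((y.1.1 - y.1.2) * (w.map Prod.snd).prod) := by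
  induction w generalizing coeff with
  | nil => simp [oneFunction_cons, oneFunction_nil]
  | cons x w ih =>
    rw [List.cons_append, oneFunction_cons, ih, oneFunction_cons]
    simp
    ring

theorem oneFunction_sub (f g : ℕ → k) (w : List (Whitney k)) :
    oneFunction (fun i => f i - g i) w = oneFunction f w - oneFunction g w := by
  simp [oneFunction, sub_mul]

theorem oneFunction_mul_right (f : ℕ → k) (r : k) (w : List (Whitney k)) :
    oneFunction (fun i => f i * r) w = oneFunction f w * r := by
  rw [oneFunction, oneFunction, Finset.sum_mul]
  exact Finset.sum_congr rfl fun i _ => by ring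

theorem mul_letter_concat (f : Conv (Whitney k) k) (w : List (Whitney k)) (y : Whitney k) :
    (f * letter k) (w ++ [y]) = f w * y.2 := by
  rw [Conv.mul_apply, cutSum_append_cons, cutSum_nil, letter_nil, mul_zero, add_zero,
    cutSum_eq_left]
  · rfl
  · intro a b _ hb
    obtain ⟨z, b, rfl⟩ := List.exists_cons_of_ne_nil hb
    cases b <;> simp

/-- Iterated commutators of the functional picking the function with the functional picking the
one-form. -/
def adLetter (k : Type*) [Field k] : ℕ → Conv (Whitney k) k
  | 0 => ⟨fun w => (idFamily w).1.1 - (idFamily w).1.2⟩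
  | n + 1 => adLetter k n * letter k - letter k * adLetter k n

/-- An n-fold commutator expands with alternating binomial coefficients, by Pascal's rule. Up to a
scalar these are the coefficients of m_{n+1}. -/
theorem adLetter_apply (n : ℕ) {w : List (Whitney k)} (hw : w.length = n + 1) :
    adLetter k n w = oneFunction (fun i => (-1) ^ i * (n.choose i : k)) w := by
  induction n generalizing w with
  | zero =>
    match w, hw with
    | [x], _ => simp [adLetter, idFamily, oneFunction_cons, oneFunction_nil]
  | succ n ih =>
    have e : (fun i => (-1) ^ i * ((n + 1).choose i : k)) = fun i =>
        (-1) ^ i * (n.choose i : k) -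
          (match i with | 0 => 0 | j + 1 => (-1) ^ j * (n.choose j : k)) := by
      funext i
      cases i with
      | zero => simp
      | succ j => simp only [Nat.choose_succ_succ]; push_cast; ring
    rw [e, oneFunction_sub, adLetter, Conv.sub_apply]
    congr 1
    · obtain ⟨w', y, rfl⟩ : ∃ w' y, w = w' ++ [y] :=
        ⟨_, _, (List.dropLast_append_getLast (by rintro rfl; simp at hw)).symm⟩
      have hw' : w'.length = n + 1 := by simpa using hw
      rw [mul_letter_concat, ih hw', oneFunction_concat, hw']
      simp
    · match w, hw with
      | x :: w, hw =>
        rw [letter_mul_cons, ih (by simpa using hw), oneFunction_cons, zero_mul, zero_add]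

theorem shuffleSum_eq_zero_of_two_le {α M : Type*} [AddCommMonoid M] {F : List α → M}
    (h : ∀ w, 2 ≤ w.length → F w = 0) {u v : List α} (hu : u ≠ []) (hv : v ≠ []) :
    shuffleSum F u v = 0 := by
  have hu := List.length_pos_iff.2 hu
  have hv := List.length_pos_iff.2 hv
  rw [shuffleSum_congr (h' := fun _ => (0 : M →+ M) 0) fun w hw => h w (by omega), ← map_shuffleSum]
  rfl

/-- Functionals supported on single letters vanish on shuffles trivially, and commutators preserve
this. -/
theorem shuffleSum_adLetter (n : ℕ) {u v : List (Whitney k)} (hu : u ≠ []) (hv : v ≠ []) :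
    shuffleSum (adLetter k n) u v = 0 := by
  induction n generalizing u v with
  | zero =>
    refine shuffleSum_eq_zero_of_two_le (fun w hw => ?_) hu hv
    match w, hw with
    | x :: y :: w, _ => simp [adLetter, idFamily]
  | succ n ih =>
    refine Conv.shuffleSum_commutator (fun u v hu hv => ih hu hv) (fun u v hu hv => ?_) hu hv
    refine shuffleSum_eq_zero_of_two_le (fun w hw => ?_) hu hv
    match w, hw with
    | x :: y :: w, _ => rfl

/-- A Koszul sign can only come from two letters of non-zero suspended degree, and these have no
one-form component. Hence signed shuffles concern only words on which the maps vanish anyway. -/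
theorem exists_of_not_forall_mul_eq_zero {V₀ V₁ : Type*} [AddCommGroup V₀] [AddCommGroup V₁]
    {u v : List (ℤ × (V₀ × V₁))}
    (hu : ∀ x ∈ u, IsHomog x.1 x.2) (hv : ∀ x ∈ v, IsHomog x.1 x.2)
    (h : ¬ ∀ x ∈ u, ∀ y ∈ v, x.1 * y.1 = 0) :
    (∃ x ∈ u.map Prod.snd, x.2 = 0) ∧ ∃ x ∈ v.map Prod.snd, x.2 = 0 := by
  push Not at h
  obtain ⟨x, hx, y, hy, hxy⟩ := h
  exact ⟨⟨_, List.mem_map_of_mem hx, (hu x hx).2 (left_ne_zero_of_mul hxy)⟩,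
    ⟨_, List.mem_map_of_mem hy, (hv y hy).2 (right_ne_zero_of_mul hxy)⟩⟩

variable [CharZero k]

/-- In arity at least three the structure is a scalar multiple of `adLetter` if no signs occur, and
is zero on words with two functions otherwise. Two letters are graded commutativity. -/
theorem vanishesOnShuffles_whitneyStr : VanishesOnShuffles (whitneyStr k) := by
  intro u v hu hv hhu hhv
  have hu0 := List.length_pos_iff.2 hu
  have hv0 := List.length_pos_iff.2 hv
  by_cases hlen : 3 ≤ u.length + v.length
  · by_cases h : ∀ x ∈ u, ∀ y ∈ v, x.1 * y.1 = 0
    · rw [sum_shuffle _ _ _ h]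
      set n := u.length + v.length - 1 with hn
      let F : k →+ Whitney k := (AddMonoidHom.inr (k × k) k).comp
        (AddMonoidHom.mulRight (-(((bernoulli n : ℚ) : k) / (n.factorial : k))))
      have e : ∀ w : List (Whitney k),
          w.length = (u.map Prod.snd).length + (v.map Prod.snd).length →
          whitneyStr k w = F (adLetter k n w) := by
        intro w hw
        rw [List.length_map, List.length_map] at hw
        rw [whitneyStr_of_three_le (by omega), adLetter_apply n (by omega), hw, ← hn]
        refine Prod.ext rfl ?_
        refine Eq.trans ?_ (oneFunction_mul_right _ _ _)
        refine congrArg (fun f => oneFunction f w) (funext fun i => ?_)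
        rw [whitneyCoeff]
        ring
      rw [shuffleSum_congr e, ← map_shuffleSum, shuffleSum_adLetter n (by simpa) (by simpa),
        map_zero]
    · obtain ⟨h1, h2⟩ := exists_of_not_forall_mul_eq_zero hhu hhv h
      have h1 := functionCount_pos.2 h1
      have h2 := functionCount_pos.2 h2
      refine List.sum_eq_zero fun m hm => ?_
      obtain ⟨p, hp, rfl⟩ := List.mem_map.1 hm
      have hperm := (perm_of_mem_shuffle hp).map Prod.snd
      have hc := functionCount_perm hperm
      rw [List.map_append, functionCount_append] at hc
      have hl := hperm.length_eq
      simp only [List.length_map, List.length_append] at hl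
      have : whitneyStr k (p.2.map Prod.snd) = 0 :=
        Prod.ext (by rw [whitneyStr_of_three_le (by simp; omega)]; rfl)
          (whitneyStr_snd_of_functionCount (by omega))
      rw [this, smul_zero]
  · match u, v with
    | [x], [y] =>
      have hx := hhu x (by simp)
      have hy := hhv y (by simp)
      simp only [IsHomog] at hx hy
      by_cases h1 : x.1 = -1
      · have hx2 := hx.2 (by omega)
        by_cases h2 : y.1 = -1
        · have hy2 := hy.2 (by omega)
          simp [shuffle, whitneyStr, h1, h2, hx2, hy2, mul_comm]
        · have hy1 := hy.1 h2
          by_cases h3 : y.1 = 0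
          · simp [shuffle, whitneyStr, h3, hx2, hy1, mul_comm]
          · refine Prod.ext (Prod.ext ?_ ?_) ?_ <;> simp [shuffle, whitneyStr, hy1, hy.2 h3]
      · have hx1 := hx.1 h1
        by_cases h3 : x.1 = 0
        · by_cases h2 : y.1 = -1
          · have hy2 := hy.2 (by omega)
            simp [shuffle, whitneyStr, h3, hx1, hy2, mul_comm]
          · refine Prod.ext (Prod.ext ?_ ?_) ?_ <;> simp [shuffle, whitneyStr, hx1, hy.1 h2]
        · refine Prod.ext (Prod.ext ?_ ?_) ?_ <;> simp [shuffle, whitneyStr, hx1, hx.2 h3]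
    | [], _ => exact (hu rfl).elim
    | _, [] => exact (hv rfl).elim
    | _ :: _ :: _, _ :: _ => simp at hlen; omega
    | [_], _ :: _ :: _ => simp at hlen; omega

end WhitneyShuffles

section Phi

variable {k A : Type*} [Field k] [CharZero k] [CommRing A] [Algebra k A] (c : Calculus k A)

theorem shuffleSum_map {α β M : Type*} [AddCommMonoid M] (f : α → β) (h : List β → M)
    (u v : List α) :
    shuffleSum h (u.map f) (v.map f) = shuffleSum (fun w => h (w.map f)) u v := by
  induction u, v using shuffle_induction generalizing h with
  | left v => simp
  | right u => simp
  | cons x u y v h1 h2 =>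
    rw [shuffleSum_cons_cons, List.map_cons, List.map_cons, shuffleSum_cons_cons,
      ← List.map_cons, ← List.map_cons, h1, h2]
    simp

/-- The holonomy is a character for shuffles, so its logarithm vanishes on them; where signs could
occur, a letter without one-form component already annihilates φ. -/
theorem vanishesOnShuffles_phi : VanishesOnShuffles (phi c) := by
  intro u v hu hv hhu hhv
  have hu0 := List.length_pos_iff.2 hu
  have hv0 := List.length_pos_iff.2 hv
  by_cases h : ∀ x ∈ u, ∀ y ∈ v, x.1 * y.1 = 0
  · rw [sum_shuffle _ _ _ h]
    have e : ∀ w : List (Forms A),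
        w.length = (u.map Prod.snd).length + (v.map Prod.snd).length →
        phi c w = AddMonoidHom.inr (k × k) k (logHol c (w.map Prod.snd)) := by
      intro w hw
      rw [List.length_map, List.length_map] at hw
      rw [phi_of_two_le c (by omega)]
      rfl
    rw [shuffleSum_congr e, ← map_shuffleSum, ← shuffleSum_map, logHol,
      Conv.shuffleSum_log c.holRed_nil _ (by simpa) (by simpa), map_zero]
    rw [c.one_add_holRed]
    exact c.shuffleSum_hol
  · obtain ⟨⟨x, hx, h1⟩, -⟩ := exists_of_not_forall_mul_eq_zero hhu hhv h
    refine List.sum_eq_zero fun m hm => ?_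
    obtain ⟨p, hp, rfl⟩ := List.mem_map.1 hm
    have hperm := (perm_of_mem_shuffle hp).map Prod.snd
    have hl := hperm.length_eq
    simp only [List.length_map, List.length_append] at hl
    rw [phi_of_mem c (by simp; omega) (hperm.mem_iff.2 _) h1, smul_zero]
    rw [List.map_append, List.mem_append]
    exact Or.inl hx

/-! ## The morphism `φ` -/

theorem linearInLetters_phi : LinearInLetters k (phi c) := by
  intro u v x y r
  refine Prod.ext ?_ ?_
  · by_cases h : 2 ≤ u.length + 1 + v.length
    · rw [phi_of_two_le, phi_of_two_le, phi_of_two_le]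
      · simp
      all_goals simp; omega
    · match u, v with
      | [], [] => simp [phi_singleton, proj]
      | [], _ :: _ => simp at h
      | _ :: _, _ => simp at h; omega
  · simp only [phi_eq, Prod.snd_add, Prod.smul_snd]
    exact (linearInLetters_logHol c).comp_map (LinearMap.snd k A A) u v x y r

theorem hasDegree_phi : HasDegree 0 (phi c) := by
  intro ds w h
  refine ⟨fun hd => ?_, fun hd => ?_⟩
  · match w, ds, h with
    | [], _, _ => rw [phi_nil]; rfl
    | [x], [d], h =>
      simp only [List.forall₂_cons, IsHomog] at h
      rw [phi_singleton, proj]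
      have := h.1.1 (by simpa using hd)
      simp [this]
    | x :: y :: w, _, _ => rw [phi_of_two_le c (by simp)]
  · suffices ∃ x ∈ w, x.2 = 0 by
      obtain ⟨x, hx, h0⟩ := this
      exact phi_snd_of_mem c hx h0
    rw [add_zero] at hd
    induction h with
    | nil => simp at hd
    | @cons d x ds w hx hw ih =>
      by_cases h0 : d = 0
      · obtain ⟨y, hy, hy0⟩ := ih (by simpa [h0] using hd)
        exact ⟨y, by simp [hy], hy0⟩
      · exact ⟨x, by simp, hx.2 h0⟩

theorem sgn_phi (w : List (Forms A)) : sgn (phi c w) = phi c (w.map sgn) := by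
  match w with
  | [] => simp [phi_nil, sgn]
  | [x] => simp [phi_singleton, proj, sgn]
  | x :: y :: w =>
    rw [phi_of_two_le c (by simp), phi_of_two_le c (by simp)]
    have : ((x :: y :: w).map sgn).map Prod.snd = (x :: y :: w).map Prod.snd := by
      rw [List.map_map]; rfl
    rw [this]
    simp [sgn]

/-- Only the linear part of φ has a function component, so Q must swallow the whole word. -/
theorem compCoder_phi_fst (w : List (Forms A)) :
    (compCoder (phi c) (formsStr c) w).1 = (proj c (formsStr c w)).1 := by
  rw [compCoder_eq (linearInLetters_phi c) rfl]
  refine (map_tripleSum (AddMonoidHom.fst (k × k) k) _ w).trans ?_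
  rw [tripleSum, cutSum_eq_right, cutSum_eq_left]
  · simp [phi_singleton]
  · intro a b _ hb
    have := List.length_pos_iff.2 hb
    rw [phi_of_two_le c (by simp; omega)]
    rfl
  · intro a b _ ha
    have := List.length_pos_iff.2 ha
    refine cutSum_eq_zero fun d e _ => ?_
    rw [phi_of_two_le c (by simp; omega)]
    rfl

theorem phi_fst_of_two_le {w : List (Forms A)} (hw : 2 ≤ w.length) : (phi c w).1 = 0 := by
  rw [phi_of_two_le c hw]

/-- Function components come only from m_2 applied to two functions, hence from two single letters;
there the claim is that evaluation at the endpoints is multiplicative. -/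
theorem comp_whitneyStr_phi_fst (w : List (Forms A)) :
    (comp (whitneyStr k) (phi c) w).1 = (proj c (formsStr c w)).1 := by
  match w with
  | [] => simp [comp, splits, whitneyStr, proj]; rfl
  | [x] => simp [comp, splits, whitneyStr, proj]
  | [x, y] => simp [comp, splits, whitneyStr, phi_singleton, proj]
  | x :: y :: z :: w =>
    rw [formsStr_cons₃, comp_eq_splitSum]
    refine (map_splitSum (AddMonoidHom.fst (k × k) k) _ _).trans ?_
    have hp : (proj c 0).1 = 0 := by simp [proj]
    rw [hp]
    refine splitSum_eq_zero fun us hus => ?_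
    match us with
    | [] => rfl
    | [u] => rfl
    | [u, v] =>
      have := congrArg List.length (flatten_of_mem_splits hus)
      simp at this
      have h : (phi c u).1 = 0 ∨ (phi c v).1 = 0 := by
        by_cases hu : 2 ≤ u.length
        · exact Or.inl (phi_fst_of_two_le c hu)
        · exact Or.inr (phi_fst_of_two_le c (by omega))
      rcases h with h | h <;> simp [whitneyStr, h]
    | u :: v :: z :: us => rfl

/-- The sum of the values of `ψ` on the one-form components of the words obtained by applying the
coderivation of the dg algebra of forms. -/
def coderSum (ψ : List A → k) (w : List (Forms A)) : k :=
  tripleSum (fun a b d => ψ (a.map Prod.snd ++ (formsStr c b).2 :: d.map Prod.snd)) w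

omit [CharZero k] in
theorem coderSum_nil {ψ : List A → k} (hψ : LinearInLetters k ψ) : coderSum c ψ [] = 0 := by
  simpa [coderSum, tripleSum] using hψ.map_zero [] []

omit [CharZero k] in
theorem coderSum_cons {ψ : List A → k} (hψ : LinearInLetters k ψ) (x : Forms A)
    (w : List (Forms A)) : coderSum c ψ (x :: w) =
      ψ (-c.D x.1 :: w.map Prod.snd) +
        (match w with
          | [] => 0
          | y :: w => ψ ((x.1 * y.2 - x.2 * y.1) :: w.map Prod.snd)) +
      coderSum c (fun w => ψ (x.2 :: w)) w := by
  have h0 : ∀ d, ψ (0 :: d) = 0 := hψ.map_zero []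
  rw [coderSum, tripleSum, cutSum_cons, cutSum_cons]
  congr 1
  cases w with
  | nil => simp [h0]
  | cons y w =>
    rw [cutSum_cons]
    have : cutSum (fun a b => ψ (([] : List (Forms A)).map Prod.snd ++
        (formsStr c (x :: y :: a)).2 :: b.map Prod.snd)) w =
        ψ ((x.1 * y.2 - x.2 * y.1) :: w.map Prod.snd) := by
      rw [cutSum_eq_right]
      · simp
      · intro a b _ ha
        obtain ⟨z, a, rfl⟩ := List.exists_cons_of_ne_nil ha
        simpa using h0 _
    rw [this]
    simp [h0]

omit [CharZero k] in
theorem coderSum_of_oneForms {ψ : List A → k} (hψ : LinearInLetters k ψ) {w : List (Forms A)}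
    (hw : ∀ x ∈ w, x.1 = 0) : coderSum c ψ w = 0 := by
  induction w generalizing ψ with
  | nil => exact coderSum_nil c hψ
  | cons x w ih =>
    have h0 : ∀ d, ψ (0 :: d) = 0 := hψ.map_zero []
    rw [coderSum_cons c hψ, ih (hψ.cons _) fun y hy => hw y (by simp [hy]), hw x (by simp)]
    cases w with
    | nil => simp [h0]
    | cons y w => simp [h0, hw y]

omit [CharZero k] in
-- One-forms have suspended degree zero, so the only signs are those in Q_1 and Q_2; together they
-- are the signs of `del`, up to a global one.
theorem coderSum_middle {ψ : List A → k} (hψ : LinearInLetters k ψ) {u v : List (Forms A)}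
    {z : Forms A} (hu : ∀ x ∈ u, x.1 = 0) (hv : ∀ x ∈ v, x.1 = 0) (hz : z.2 = 0) :
    coderSum c ψ (u ++ z :: v) = -del z.1 (c.D z.1) ψ (u.map Prod.snd) (v.map Prod.snd) := by
  induction u generalizing ψ with
  | nil =>
    have hn := hψ.map_neg []
    simp only [List.nil_append] at hn
    have h0 : LinearInLetters k fun w => ψ (0 :: w) := hψ.cons 0
    rw [List.nil_append, coderSum_cons c hψ, hz, coderSum_of_oneForms c h0 hv, List.map_nil,
      del_nil, hn]
    cases v with
    | nil => simp [mergeRight]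
    | cons y v => simp [mergeRight]; ring
  | cons x u ih =>
    have h0 : ∀ d, ψ (0 :: d) = 0 := hψ.map_zero []
    have hn := hψ.map_neg []
    simp only [List.nil_append] at hn
    rw [List.cons_append, coderSum_cons c hψ, ih (hψ.cons _) fun y hy => hu y (by simp [hy]),
      hu x (by simp), List.map_cons, del_cons]
    cases u with
    | nil => simp [mergeLeft, h0, hz, hn]
    | cons y u => simp [mergeLeft, h0, hu y]

theorem compCoder_phi_snd (w : List (Forms A)) :
    (compCoder (phi c) (formsStr c) w).2 = coderSum c (logHol c) w := by
  rw [compCoder_eq (linearInLetters_phi c) rfl]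
  refine (map_tripleSum (AddMonoidHom.snd (k × k) k) _ w).trans ?_
  refine tripleSum_congr fun a b d _ => ?_
  refine (congrArg Prod.snd (phi_eq c _)).trans ?_
  simp only [List.map_append, List.map_cons, List.map_map]
  rfl

omit [CharZero k] in
theorem formsStr_snd_of_functionCount {w : List (Forms A)} (h : 2 ≤ functionCount w) :
    (formsStr c w).2 = 0 := by
  match w with
  | [] => rfl
  | [x] => have := functionCount_le_length [x]; simp at this; omega
  | [x, y] =>
    have h1 : x.2 = 0 := by
      by_contra hx
      rw [functionCount_cons_of_ne _ hx] at h
      have := functionCount_le_length [y]; simp at this; omega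
    have h2 : y.2 = 0 := by
      by_contra hy
      rw [functionCount_cons_of_eq _ h1, functionCount_cons_of_ne _ hy] at h
      simp at h
    simp [h1, h2]
  | x :: y :: z :: w => rfl

/-- One application of Q always leaves a letter without one-form component: either a function
outside the window, or the result itself if both functions lie inside. -/
theorem compCoder_phi_snd_of_functionCount {w : List (Forms A)} (h : 2 ≤ functionCount w) :
    (compCoder (phi c) (formsStr c) w).2 = 0 := by
  rw [compCoder_eq (linearInLetters_phi c) rfl]
  refine (map_tripleSum (AddMonoidHom.snd (k × k) k) _ w).trans ?_
  refine tripleSum_eq_zero fun a b d e => ?_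
  subst e
  rw [functionCount_append, functionCount_append] at h
  suffices ∃ x ∈ a.map sgn ++ formsStr c b :: d, x.2 = 0 by
    obtain ⟨x, hx, h0⟩ := this
    exact phi_snd_of_mem c hx h0
  by_cases ha : 0 < functionCount a
  · obtain ⟨x, hx, h0⟩ := functionCount_pos.1 ha
    exact ⟨sgn x, List.mem_append_left _ (List.mem_map_of_mem hx), h0⟩
  by_cases hd : 0 < functionCount d
  · obtain ⟨x, hx, h0⟩ := functionCount_pos.1 hd
    exact ⟨x, by simp [hx], h0⟩
  · exact ⟨formsStr c b, by simp, formsStr_snd_of_functionCount c (by omega)⟩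

theorem functionCount_flatten_le (us : List (List (Forms A)))
    (h : ∀ u ∈ us, functionCount u ≤ 1) :
    functionCount us.flatten ≤ functionCount (us.map (phi c)) := by
  induction us with
  | nil => simp
  | cons u us ih =>
    have h1 := ih fun v hv => h v (by simp [hv])
    have h2 := h u (by simp)
    rw [List.flatten_cons, functionCount_append, List.map_cons]
    by_cases hu : 0 < functionCount u
    · obtain ⟨x, hx, h0⟩ := functionCount_pos.1 hu
      rw [functionCount_cons_of_eq _ (phi_snd_of_mem c hx h0)]
      omega
    · by_cases hp : (phi c u).2 = 0
      · rw [functionCount_cons_of_eq _ hp]; omega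
      · rw [functionCount_cons_of_ne _ hp]; omega

/-- A block with two functions is killed by φ. Otherwise the functions lie in different blocks, each
of which yields a letter without one-form component, and the structure vanishes on two such letters.
-/
theorem comp_whitneyStr_phi_snd_of_functionCount {w : List (Forms A)}
    (h : 2 ≤ functionCount w) : (comp (whitneyStr k) (phi c) w).2 = 0 := by
  refine (map_splitSum (AddMonoidHom.snd (k × k) k) _ w).trans ?_
  refine splitSum_eq_zero fun us hus => ?_
  rw [← flatten_of_mem_splits hus] at h
  by_cases hu : ∀ u ∈ us, functionCount u ≤ 1
  · exact whitneyStr_snd_of_functionCount (h.trans (functionCount_flatten_le c us hu))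
  · push Not at hu
    obtain ⟨u, hu, h1⟩ := hu
    obtain ⟨x, hx, h0⟩ := functionCount_pos.1 (by omega : 0 < functionCount u)
    have hl := functionCount_le_length u
    rw [linearInLetters_whitneyStr.map_of_mem, map_zero]
    rw [← phi_of_mem c (by omega) hx h0]
    exact List.mem_map_of_mem hu

theorem phi_of_oneForms {u : List (Forms A)} (h : ∀ x ∈ u, x.1 = 0) :
    phi c u = (0, logHol c (u.map Prod.snd)) := by
  match u with
  | [] => rw [phi_eq]; rfl
  | [x] =>
    rw [phi_eq]
    simp [gugenheim_singleton, proj, h x]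
  | x :: y :: w => exact phi_of_two_le c (by simp)

theorem forall_phi_fst_eq_zero {u : List (Forms A)} (h : ∀ x ∈ u, x.1 = 0)
    {us : List (List (Forms A))} (hus : us ∈ splits u) : ∀ x ∈ us.map (phi c), x.1 = 0 := by
  intro x hx
  obtain ⟨v, hv, rfl⟩ := List.mem_map.1 hx
  rw [phi_of_oneForms]
  intro y hy
  refine h y ?_
  rw [← flatten_of_mem_splits hus]
  exact List.mem_flatten_of_mem hv hy

/-- Summing over decompositions of a stretch of letters into φ-blocks turns the number of blocks
into the exponent of a convolution power of the logarithm. -/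
theorem splitSum_logHol (f : ℕ → k) (u : List (Forms A)) :
    splitSum (fun us => f us.length * ((us.map (phi c)).map Prod.snd).prod) u =
      ∑ a ∈ Finset.range (u.length + 1), f a * ((logHol c ^ a) (u.map Prod.snd)) := by
  have h := Conv.splitSum_prod (g := logHol c) Conv.log_nil f
    (w := u.map Prod.snd) le_rfl
  rw [List.length_map, splitSum_map] at h
  rw [← h]
  refine splitSum_congr fun us _ => ?_
  rw [List.length_map, List.map_map, List.map_map]
  congr 2
  refine List.map_congr_left fun v _ => ?_
  rw [Function.comp_apply, phi_eq]
  rfl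

omit [CharZero k] in
theorem sum_range_ite_mul (f g : ℕ → k) {m n p q : ℕ} (hf : m ≤ p → f p = 0)
    (hg : n ≤ q → g q = 0) :
    ∑ a ∈ Finset.range m, ∑ b ∈ Finset.range n,
      (if a = p ∧ b = q then 1 else 0) * (f a * g b) = f p * g q := by
  simp only [ite_and, ite_mul, one_mul, zero_mul, Finset.sum_ite_irrel, Finset.sum_const_zero,
    Finset.sum_ite_eq', Finset.mem_range]
  by_cases h1 : p < m
  · by_cases h2 : q < n
    · simp [h1, h2]
    · simp [h2, hg (not_lt.1 h2)]
  · simp [h1, hf (not_lt.1 h1)]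

/-- The higher components of φ vanish on zero-forms, so the function forms a block of its own and
the two sides decompose independently. -/
theorem comp_phi_middle {R : List (Whitney k) → Whitney k} (hR : LinearInLetters k R)
    {u v : List (Forms A)} {z : Forms A} (hz : z.2 = 0) : comp R (phi c) (u ++ z :: v) =
      splitSum (fun a => splitSum (fun b => R (a.map (phi c) ++ proj c z :: b.map (phi c))) v) u := by
  have h0 : ∀ {a d : List (Forms A)} (_ : a ≠ [] ∨ d ≠ []) (p q : List (Whitney k)),
      R (p ++ phi c (a ++ z :: d) :: q) = 0 := by
    intro a d h p q
    rw [phi_of_mem c (x := z) _ (by simp) hz, hR.map_zero]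
    rcases h with h | h <;> have := List.length_pos_iff.2 h <;> simp <;> omega
  rw [comp_eq_splitSum, splitSum_append_cons, cutSum_eq_left]
  · refine splitSum_congr fun a _ => ?_
    rw [cutSum_eq_right]
    · refine splitSum_congr fun b _ => ?_
      simp [phi_singleton]
    · intro d e _ hd
      refine splitSum_eq_zero fun b _ => ?_
      simpa using h0 (a := []) (Or.inr hd) (a.map (phi c)) (b.map (phi c))
  · intro a b _ hb
    refine splitSum_eq_zero fun p _ => cutSum_eq_zero fun d e _ => splitSum_eq_zero fun q _ => ?_
    simpa using h0 (d := d) (Or.inl hb) (p.map (phi c)) (q.map (phi c))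

/-- The core of the morphism equation. Both sides are double sums of L^a(u) L^b(v), where L is the
logarithm of the holonomy. The coefficients on the left are those of the Whitney structure, and on
the right those found in `Conv.del_log` from Stokes' formula. -/
theorem comp_whitneyStr_phi_snd_middle {u v : List (Forms A)} {z : Forms A}
    (hu : ∀ x ∈ u, x.1 = 0) (hv : ∀ x ∈ v, x.1 = 0) (hz : z.2 = 0) :
    (comp (whitneyStr k) (phi c) (u ++ z :: v)).2 =
      -del z.1 (c.D z.1) (logHol c) (u.map Prod.snd) (v.map Prod.snd) := by
  have hL : ∀ u v, del z.1 (c.D z.1) (1 + c.holRed : Conv A k) u v =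
      c.ev1 z.1 * ((1 + c.holRed : Conv A k) u * (1 : Conv A k) v) -
        c.ev0 z.1 * ((1 : Conv A k) u * (1 + c.holRed : Conv A k) v) := by
    rw [c.one_add_holRed]
    exact c.del_hol z.1
  let e₀ := c.ev0 z.1
  let e₁ := c.ev1 z.1
  let B : ℕ → ℕ → k := fun a b =>
    (-1) ^ a * ((bernoulli (a + b) : ℚ) : k) / (a.factorial * b.factorial)
  let F : ℕ → ℕ → k := fun a b => -((e₁ - e₀) * B a b) +
    e₀ * ((if a = 0 ∧ b = 1 then 1 else 0) - (if a = 1 ∧ b = 0 then 1 else 0))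
  have h1 : (comp (whitneyStr k) (phi c) (u ++ z :: v)).2 =
      splitSum (fun a => splitSum (fun b => (F a.length b.length * ((a.map (phi c)).map Prod.snd).prod)
        * ((b.map (phi c)).map Prod.snd).prod) v) u := by
    rw [comp_phi_middle c linearInLetters_whitneyStr hz]
    refine (map_splitSum (AddMonoidHom.snd (k × k) k) _ u).trans (splitSum_congr fun a ha => ?_)
    refine (map_splitSum (AddMonoidHom.snd (k × k) k) _ v).trans (splitSum_congr fun b hb => ?_)
    refine (whitneyStr_snd_middle (forall_phi_fst_eq_zero c hu ha) (forall_phi_fst_eq_zero c hv hb)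
      (by simp [proj, hz])).trans ?_
    simp only [proj, List.length_map, mul_assoc, F, B, e₀, e₁]
  have h2 : ∀ a : List (List (Forms A)), splitSum (fun b => (F a.length b.length *
      ((a.map (phi c)).map Prod.snd).prod) * ((b.map (phi c)).map Prod.snd).prod) v =
      (∑ b ∈ Finset.range (v.length + 1), F a.length b * ((logHol c ^ b) (v.map Prod.snd))) *
        ((a.map (phi c)).map Prod.snd).prod := by
    intro a
    rw [splitSum_logHol c (fun b => F a.length b * ((a.map (phi c)).map Prod.snd).prod),
      Finset.sum_mul]
    exact Finset.sum_congr rfl fun b _ => by ring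
  simp only [h2] at h1
  rw [h1, splitSum_logHol c (fun a => ∑ b ∈ Finset.range (v.length + 1),
    F a b * ((logHol c ^ b) (v.map Prod.snd)))]
  rw [logHol, Conv.del_log c.holRed_nil hL, ← logHol, List.length_map, List.length_map]
  have hlog : logHol c [] = 0 := Conv.log_nil
  have hpow : ∀ (w : List (Forms A)) (n : ℕ), w.length + 1 ≤ n →
      (logHol c ^ n) (w.map Prod.snd) = 0 := fun w n h =>
    Conv.pow_eq_zero_of_length_lt hlog (by rw [List.length_map]; omega)
  -- The e₀-terms of `Conv.del_log` are written as double sums with indicators at (0,1) and (1,0),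
  -- to be matched with the unit terms in `F`.
  have i1 := sum_range_ite_mul (fun a => (logHol c ^ a) (u.map Prod.snd))
    (fun a => (logHol c ^ a) (v.map Prod.snd)) (p := 0) (q := 1) (hpow u 0) (hpow v 1)
  have i2 := sum_range_ite_mul (fun a => (logHol c ^ a) (u.map Prod.snd))
    (fun a => (logHol c ^ a) (v.map Prod.snd)) (p := 1) (q := 0) (hpow u 1) (hpow v 0)
  simp only [pow_zero, pow_one] at i1 i2
  rw [neg_add, ← mul_neg (c.ev0 z.1), neg_sub, ← i1, ← i2, ← Finset.sum_sub_distrib, Finset.mul_sum,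
    Finset.mul_sum, ← Finset.sum_neg_distrib, ← Finset.sum_add_distrib]
  refine Finset.sum_congr rfl fun a _ => ?_
  rw [Finset.sum_mul, ← Finset.sum_sub_distrib, Finset.mul_sum, Finset.mul_sum,
    ← Finset.sum_neg_distrib, ← Finset.sum_add_distrib]
  refine Finset.sum_congr rfl fun b _ => ?_
  simp only [F, B, e₀, e₁]
  ring

/-- By linearity the letters may be taken homogeneous. With no function, or with at least two, both
one-form components vanish; exactly one function is the computation with Bernoulli numbers. -/
theorem comp_whitneyStr_phi : comp (whitneyStr k) (phi c) = compCoder (phi c) (formsStr c) := by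
  refine (linearInLetters_whitneyStr.comp (linearInLetters_phi c)).ext
    ((linearInLetters_phi c).compCoder rfl (linearInLetters_formsStr c)) fun w hw => ?_
  refine Prod.ext ((comp_whitneyStr_phi_fst c w).trans (compCoder_phi_fst c w).symm) ?_
  have key : ∀ w : List (Forms A), (∀ x ∈ w, x.1 = 0 ∨ x.2 = 0) → functionCount w = 0 →
      ∀ x ∈ w, x.1 = 0 := by
    intro w hw h0 x hx
    refine (hw x hx).resolve_right fun h => ?_
    have := functionCount_pos.2 ⟨x, hx, h⟩
    omega
  rcases Nat.lt_or_ge 1 (functionCount w) with h | h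
  · rw [comp_whitneyStr_phi_snd_of_functionCount c h, compCoder_phi_snd_of_functionCount c h]
  rcases Nat.eq_zero_or_pos (functionCount w) with h0 | h0
  · have hw' := key w hw h0
    rw [compCoder_phi_snd, coderSum_of_oneForms c (linearInLetters_logHol c) hw']
    refine (map_splitSum (AddMonoidHom.snd (k × k) k) _ w).trans ?_
    exact splitSum_eq_zero fun us hus =>
      whitneyStr_snd_of_oneForms (forall_phi_fst_eq_zero c hw' hus)
  · obtain ⟨z, hzw, hz⟩ := functionCount_pos.1 h0
    obtain ⟨u, v, rfl⟩ := List.append_of_mem hzw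
    rw [functionCount_append, functionCount_cons_of_eq _ hz] at h
    have hu := key u (fun x hx => hw x (by simp [hx])) (by omega)
    have hv := key v (fun x hx => hw x (by simp [hx])) (by omega)
    rw [compCoder_phi_snd, coderSum_middle c (linearInLetters_logHol c) hu hv hz,
      comp_whitneyStr_phi_snd_middle c hu hv hz]

end Phi

/-! ### Windows of length one. -/

section Windows

variable {α M : Type*} [AddCommMonoid M]

theorem length_of_mem_windows {m : ℕ} {w : List α} {p : List α × List α × List α}
    (h : p ∈ windows m w) :
    p.2.1.length = m ∧ p.1.length + m + p.2.2.length = w.length := by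
  obtain ⟨i, hi, rfl⟩ := List.mem_map.1 h
  rw [List.mem_range] at hi
  simp only [List.length_take, List.length_drop]
  omega

theorem windows_one_cons (x : α) (w : List α) : windows 1 (x :: w) =
    ([], [x], w) :: (windows 1 w).map fun p => (x :: p.1, p.2) := by
  rw [windows, List.length_cons, Nat.add_sub_cancel, List.range_succ_eq_map, List.map_cons,
    List.map_map, windows, List.map_map, Nat.add_sub_cancel]
  refine congrArg₂ _ (by simp) (List.map_congr_left fun i _ => ?_)
  simp

/-- For `g` that vanishes whenever x survives outside the window; it isolates the term where the
differential hits the value of the homotopy. -/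
theorem sum_windows_one_append_cons {g : List α × List α × List α → M} (u : List α) (x : α)
    (v : List α) (hg : ∀ p, x ∈ p.1 ∨ x ∈ p.2.2 → g p = 0) :
    ((windows 1 (u ++ x :: v)).map g).sum = g (u, [x], v) := by
  induction u generalizing g with
  | nil =>
    rw [List.nil_append, windows_one_cons, List.map_cons, List.sum_cons, List.map_map,
      List.sum_eq_zero, add_zero]
    intro m hm
    obtain ⟨p, _, rfl⟩ := List.mem_map.1 hm
    exact hg _ (by simp)
  | cons y u ih =>
    rw [List.cons_append, windows_one_cons, List.map_cons, List.sum_cons, hg _ (by simp), zero_add,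
      List.map_map]
    exact ih fun p hp => hg _ (hp.imp (List.mem_cons_of_mem y) id)

end Windows

/-! ### The A_∞ relations on Whitney forms, and the comparison with φ. -/

section Whitney

variable {k A : Type*} [Field k] [CharZero k] [CommRing A] [Algebra k A] (c : Calculus k A)

/-- Because φ restricts to the identity on Whitney forms, an identity for `G` may be checked after
composing with φ. -/
theorem comp_phi_map_incl {V : Type*} [AddCommGroup V] [Module k V] {G : List (Whitney k) → V}
    (hG : LinearInLetters k G) (w : List (Whitney k)) : comp G (phi c) (w.map (incl c)) = G w := by
  rw [comp_eq_splitSum, splitSum_map, splitSum_eq_singletons]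
  · rw [List.map_map, List.map_map]
    exact congrArg G ((List.map_congr_left fun x _ => phi_map_incl c [x]).trans (List.map_id w))
  · intro us _ u hu hl
    refine hG.map_of_mem (List.mem_map.2 ⟨_, List.mem_map_of_mem hu, ?_⟩)
    rw [phi_map_incl]
    match u, hl with
    | _ :: _ :: _, _ => rfl

/-- The square of the structure, evaluated through φ on included Whitney forms, becomes φ composed
twice with the coderivation of the dg algebra of forms, hence zero. The morphism equation was proved
without presupposing these relations, and polynomial forms suffice over any field of characteristic
zero. -/
theorem compCoder_whitneyStr (w : List (Whitney k)) :
    compCoder (whitneyStr k) (whitneyStr k) w = 0 := by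
  let c := polyCalculus k
  have hR := linearInLetters_whitneyStr (k := k)
  have h := comp_whitneyStr_phi c
  rw [← comp_phi_map_incl c (hR.compCoder rfl hR),
    comp_compCoder hR rfl rfl (linearInLetters_phi c) (sgn_phi c) h, h]
  exact compCoder_compCoder (linearInLetters_phi c) rfl (linearInLetters_formsStr c)
    (sgn_formsStr c) (compCoder_formsStr c) _

theorem isCInfAlgebra_whitneyStr : IsCInfAlgebra k (whitneyStr k) :=
  ⟨⟨⟨rfl, linearInLetters_whitneyStr⟩, hasDegree_whitneyStr, compCoder_whitneyStr⟩,
    vanishesOnShuffles_whitneyStr⟩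

theorem isAInfMorphism_phi : IsAInfMorphism k (formsStr c) (whitneyStr k) (phi c) :=
  ⟨⟨phi_nil c, linearInLetters_phi c⟩, hasDegree_phi c, congrFun (comp_whitneyStr_phi c)⟩

theorem isCInfMorphism_phi : IsCInfMorphism k (formsStr c) (whitneyStr k) (phi c) :=
  ⟨isCInfAlgebra_formsStr c, isCInfAlgebra_whitneyStr, isAInfMorphism_phi c,
    vanishesOnShuffles_phi c⟩

/-! ## Homological perturbation theory -/

theorem compCoder_phi_eq_add {w : List (Forms A)} (hw : 2 ≤ w.length) :
    compCoder (phi c) (formsStr c) w =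
      ((windows 1 w).map fun p => phi c (p.1.map sgn ++ formsStr c p.2.1 :: p.2.2)).sum +
        ((quadraticTerms (formsStr c) w).map (phi c)).sum := by
  have hs : ({1, 2} : Finset ℕ) ⊆ Finset.Icc 1 w.length := by
    intro j hj
    simp only [Finset.mem_insert, Finset.mem_singleton, Finset.mem_Icc] at *
    omega
  rw [compCoder, ← Finset.sum_subset hs, Finset.sum_pair (by omega), quadraticTerms, List.map_map]
  · rfl
  · intro j hj hj'
    simp only [Finset.mem_insert, Finset.mem_singleton, Finset.mem_Icc] at hj hj'
    refine List.sum_eq_zero fun m hm => ?_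
    obtain ⟨p, hp, rfl⟩ := List.mem_map.1 hm
    rw [formsStr_of_three_le c (by rw [(length_of_mem_windows hp).1]; omega)]
    exact (linearInLetters_phi c).map_zero _ _

/-- The block containing the null function is killed by φ, whatever its length. -/
theorem comp_phi_of_isNullFunction {R : List (Whitney k) → Whitney k} (hR : LinearInLetters k R)
    {w : List (Forms A)} {x : Forms A} (hx : x ∈ w) (h : IsNullFunction c x) :
    comp R (phi c) w = 0 := by
  rw [comp_eq_splitSum]
  refine splitSum_eq_zero fun us hus => ?_
  rw [← flatten_of_mem_splits hus] at hx
  obtain ⟨u, hu, hxu⟩ := List.mem_flatten.1 hx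
  exact hR.map_of_mem (List.mem_map.2 ⟨u, hu, phi_of_isNullFunction c hxu h⟩)

omit [CharZero k] in
theorem isNullFunction_neg_homotopy (x : Forms A) : IsNullFunction c (-homotopy c x) := by
  refine ⟨?_, ?_, ?_⟩ <;> simp [homotopy, c.ev0_t, c.ev1_t, c.ev0_prim]

/-- The morphism equation on the word with -h(x) in the middle: its left side vanishes, and the
differential contributes only where it hits -h(x), since otherwise a null function survives. What
remains determines the quadratic terms. -/
theorem sum_quadraticTerms (p r : List (Forms A)) (x : Forms A) (h : 1 ≤ p.length + r.length) :
    ((quadraticTerms (formsStr c) (p.map sgn ++ -homotopy c x :: r)).map (phi c)).sum =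
      phi c (p ++ x :: r) - phi c (p ++ incl c (proj c x) :: r) := by
  have hK := isNullFunction_neg_homotopy c x
  have h1 := comp_phi_of_isNullFunction c linearInLetters_whitneyStr
    (w := p.map sgn ++ -homotopy c x :: r) (by simp) hK
  -- The signs from moving the homotopy past the prefix and those from moving the differential past
  -- it cancel.
  rw [comp_whitneyStr_phi, compCoder_phi_eq_add c (by simp; omega), sum_windows_one_append_cons,
    map_sgn_map_sgn] at h1
  · rw [eq_neg_of_add_eq_zero_right h1]
    have hl : ∀ y, 2 ≤ (p ++ y :: r).length := fun y => by simp; omega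
    rw [phi_of_two_le c (hl _), phi_of_two_le c (hl _), phi_of_two_le c (hl _)]
    -- The homotopy identity dh = ιπ - id on one-forms. The zero-form parts need no attention, as φ
    -- ignores them on words of length at least two.
    have hD : (formsStr c [-homotopy c x]).2 = (-1 : k) • x.2 + (incl c (proj c x)).2 := by
      simp [homotopy, incl, proj, c.D_t, c.D_prim, Algebra.algebraMap_eq_smul_one]
      abel
    have hL := linearInLetters_logHol c
    simp only [List.map_append, List.map_cons, hD, add_comm ((-1 : k) • x.2), hL _ _ _ _ (-1 : k)]
    refine Prod.ext ?_ ?_ <;> simp [sub_eq_add_neg]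
  · rintro ⟨a, b, d⟩ hx
    by_cases hx' : -homotopy c x ∈ d
    · exact phi_of_isNullFunction c (by simp [hx']) hK
    · refine phi_of_isNullFunction c (x := sgn (-homotopy c x)) ?_ ?_
      · simp only [List.mem_append]
        exact Or.inl (List.mem_map_of_mem (hx.resolve_right hx'))
      · simpa [IsNullFunction, sgn] using hK

/-- Telescoping: the i-th term of H replaces the i-th letter by its projection ιπ when everything to
its right is already projected. The prefix `p` holds the letters passed over in the induction. -/
theorem sum_homotopyTerms (p w : List (Forms A)) (h : 2 ≤ p.length + w.length) :
    ((windows 1 w).map fun q => ((quadraticTerms (formsStr c) ((p ++ q.1).map sgn ++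
      (q.2.1.map (fun x => -homotopy c x) ++ q.2.2.map fun x => incl c (proj c x)))).map
        (phi c)).sum).sum =
      phi c (p ++ w) - phi c (p ++ w.map fun x => incl c (proj c x)) := by
  induction w generalizing p with
  | nil => simp [windows]
  | cons x w ih =>
    have h1 := ih (p ++ [x]) (by simp at *; omega)
    have h2 := sum_quadraticTerms c p (w.map fun x => incl c (proj c x)) x (by simp at *; omega)
    simp only [List.append_assoc, List.singleton_append] at h1
    rw [windows_one_cons, List.map_cons, List.sum_cons, List.map_map]
    refine (congrArg₂ (· + ·) (Eq.trans (by simp) h2) h1).trans ?_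
    rw [List.map_cons]
    abel

/-- φ obeys the recursion defining the transfer, since the telescoped sum ends in φ of a word of at
least two Whitney forms, which is zero. -/
theorem transferAux_eq_phi (n : ℕ) {w : List (Forms A)} (hw : w.length = n) :
    transferAux (formsStr c) (incl c) (proj c) (homotopy c) n w = phi c w := by
  induction n using Nat.strong_induction_on generalizing w with
  | _ n ih =>
    match n, w, hw with
    | 0, [], _ => rw [phi_nil]; rfl
    | 1, [x], _ => rw [phi_singleton]; simp [transferAux]
    | n + 2, w, hw =>
      rw [transferAux, homotopyTerms, List.map_map]
      have h := sum_homotopyTerms c [] w (by simp; omega)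
      have h0 : phi c ([] ++ w.map fun x => incl c (proj c x)) = 0 := by
        have := phi_map_incl c (w.map (proj c))
        rw [List.map_map] at this
        refine this.trans ?_
        match w, hw with
        | _ :: _ :: _, _ => rfl
      rw [h0, sub_zero, List.nil_append] at h
      rw [← h]
      refine congrArg List.sum (List.map_congr_left fun q hq => ?_)
      refine congrArg List.sum (List.map_congr_left fun w' hw' => ih (n + 1) (by omega) ?_)
      obtain ⟨q', hq', rfl⟩ := List.mem_map.1 hw'
      have l1 := length_of_mem_windows hq
      have l2 := length_of_mem_windows hq'
      simp only [List.length_append, List.length_map, List.length_cons] at *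
      omega

theorem dupontTransfer_eq_phi : dupontTransfer c = phi c :=
  funext fun _ => transferAux_eq_phi c _ rfl

/-- The comparison of Dupont's transfer with the logarithm of Gugenheim's morphism, for an arbitrary
calculus of functions on the interval. -/
theorem dupontTransfer_comparison :
    comp (expMap c) (logMap c) = idFamily ∧ comp (logMap c) (expMap c) = idFamily ∧
      IsAInfMorphism k (formsStr c) (whitneyStr k) (dupontTransfer c) ∧
      IsCInfMorphism k (formsStr c) (whitneyStr k) (phi c) ∧ dupontTransfer c = phi c := by
  rw [expMap_eq, logMap_eq, dupontTransfer_eq_phi]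
  exact ⟨comp_exp_log, comp_log_exp, isAInfMorphism_phi c, isCInfMorphism_phi c, rfl⟩

end Whitney

end AInf

theorem mainTheorem5 :
    (∀ (k : Type*) [Field k] [CharZero k],
      AInf.comp (AInf.expMap (AInf.polyCalculus k)) (AInf.logMap (AInf.polyCalculus k))
          = AInf.idFamily ∧
      AInf.comp (AInf.logMap (AInf.polyCalculus k)) (AInf.expMap (AInf.polyCalculus k))
          = AInf.idFamily ∧
      AInf.IsAInfMorphism k (AInf.formsStr (AInf.polyCalculus k)) (AInf.whitneyStr k)
        (AInf.dupontTransfer (AInf.polyCalculus k)) ∧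
      AInf.IsCInfMorphism k (AInf.formsStr (AInf.polyCalculus k)) (AInf.whitneyStr k)
        (AInf.phi (AInf.polyCalculus k)) ∧
      AInf.dupontTransfer (AInf.polyCalculus k) = AInf.phi (AInf.polyCalculus k)) ∧
    (AInf.comp (AInf.expMap AInf.smoothCalculus) (AInf.logMap AInf.smoothCalculus)
          = AInf.idFamily ∧
      AInf.comp (AInf.logMap AInf.smoothCalculus) (AInf.expMap AInf.smoothCalculus)
          = AInf.idFamily ∧
      AInf.IsAInfMorphism ℝ (AInf.formsStr AInf.smoothCalculus) (AInf.whitneyStr ℝ)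
        (AInf.dupontTransfer AInf.smoothCalculus) ∧
      AInf.IsCInfMorphism ℝ (AInf.formsStr AInf.smoothCalculus) (AInf.whitneyStr ℝ)
        (AInf.phi AInf.smoothCalculus) ∧
      AInf.dupontTransfer AInf.smoothCalculus = AInf.phi AInf.smoothCalculus) := by
  exact ⟨fun k _ _ => AInf.dupontTransfer_comparison (AInf.polyCalculus k),
    AInf.dupontTransfer_comparison AInf.smoothCalculus⟩
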